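/- For $d\ge 1$, integers $q>2$ and $1\le k\le q-1$, a unit vector $r_*\in\mathbb R^d$ and a positive definite $\Sigma\in\mathbb R^{d\times d}$ with largest and smallest eigenvalues $\lambda_{\max},\lambda_{\min}$, let $\mathcal D=N(0,\Sigma)$ and $f(x)=\mathsf{pos}(r_*^{\mathsf T}x)$, where $\mathsf{pos}(a)=1$ if $a>0$ and $\mathsf{pos}(a)=0$ otherwise. The bag oracle $\mathsf{Ex}(f,\mathcal D,q,k)$ generates an (unordered) bag of $q$ independent vectors, $k$ of them distributed as $\mathcal D$ conditioned on $f(x)=1$ and $q-k$ of them as $\mathcal D$ conditioned on $f(x)=0$; the labels of the individual vectors are not revealed. There are an absolute constant $C>0$, a fixed polynomial and a single algorithm (a program for a real-number random access machine with unit-cost $+,-,\times,/$ and comparisons) which, given $d,q,k,m$ and $m$ i.i.d. bags from $\mathsf{Ex}(f,\mathcal D,q,k)$, whose vectors may be listed in any order, computes a vector $\hat r\in\mathbb R^d$ and has the following properties. It always halts within a number of steps polynomial in $\max(m,d,q)$. For all $d,q,k,r_*,\Sigma$ as above, all $\varepsilon,\delta>0$ and all $$m\;\ge\; C\,\frac{d}{\varepsilon^4}\,\log\!\Big(\frac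 d\delta\Big)\Big(\frac{\lambda_{\max}}{\lambda_{\min}}\Big)^{6}q^{8},$$ the running time is polynomial in $m$ (as long as $\varepsilon\le 1$ and $\delta\le d/2$, which excludes only degenerate parameters), and with probability at least $1-\delta$ over the sampling the hypotheses $h(x)=\mathsf{pos}(\hat r^{\mathsf T}x)$ and $\tilde h(x)=\mathsf{pos}(-\hat r^{\mathsf T}x)$ satisfy * if $k\ne q/2$: $\Pr_{\mathcal D}[f(x)\ne h(x)]\le\varepsilon$; * if $k=q/2$: $\min\{\Pr_{\mathcal D}[f(x)\ne h(x)],\ \Pr_{\mathcal D}[f(x)\ne\tilde h(x)]\}\le\varepsilon$. -/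

import Mathlib

open MeasureTheory ProbabilityTheory

/-! ### Linear threshold functions, bag oracles, instance error -/

namespace LLP

/-- The feature space `ℝ^d` with its Euclidean structure. -/
abbrev Vec (d : ℕ) : Type := EuclideanSpace ℝ (Fin d)

/-- `pos a = 1` if `a > 0`, and `pos a = 0` otherwise. -/
noncomputable def pos (a : ℝ) : Fin 2 := if 0 < a then 1 else 0

/-- The homogeneous linear threshold function with normal vector `r`. -/
noncomputable def ltf {d : ℕ} (r : Vec d) : Vec d → Fin 2 := fun x => pos (inner ℝ r x)

/-- The distribution `D` conditioned on `f x = a`. -/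
noncomputable def condLabel {d : ℕ} (D : Measure (Vec d)) (f : Vec d → Fin 2) (a : Fin 2) :
    Measure (Vec d) :=
  ProbabilityTheory.cond D {x | f x = a}

/-- The bag oracle: the law of a bag of `q` independent vectors, the first `k` of them from `D`
conditioned on label `1`, the other `q - k` from `D` conditioned on label `0`. -/
noncomputable def bagOracle {d : ℕ} (f : Vec d → Fin 2) (D : Measure (Vec d)) (q k : ℕ) :
    Measure (Fin q → Vec d) :=
  Measure.pi fun j => condLabel D f (if (j : ℕ) < k then 1 else 0)

/-- The law of `m` independent bags from the bag oracle. -/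
noncomputable def sampleLaw {d : ℕ} (f : Vec d → Fin 2) (D : Measure (Vec d)) (q k m : ℕ) :
    Measure (Fin m → Fin q → Vec d) :=
  Measure.pi fun _ => bagOracle f D q k

/-- The instance-level error `Pr_D[f x ≠ h x]`. -/
noncomputable def instErr {d : ℕ} (D : Measure (Vec d)) (f h : Vec d → Fin 2) : ℝ :=
  D.real {x | f x ≠ h x}

/-- The largest eigenvalue of a real symmetric matrix. -/
noncomputable def lamMax {d : ℕ} {A : Matrix (Fin d) (Fin d) ℝ} (hA : A.IsHermitian) : ℝ :=
  ⨆ i, hA.eigenvalues i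

/-- The smallest eigenvalue of a real symmetric matrix. -/
noncomputable def lamMin {d : ℕ} {A : Matrix (Fin d) (Fin d) ℝ} (hA : A.IsHermitian) : ℝ :=
  ⨅ i, hA.eigenvalues i

/-! ### A real random access machine with a step count

Programs are finite texts, uniform in all sizes. A machine has integer registers and a memory of
real numbers, made of arrays whose cells are addressed by three integers. Real numbers are handled
only through `+`, `-`, `*`, `/` and comparisons, integers only through constants, `+`, truncated
`-` and comparisons (no multiplication, hence no fast growing addresses); there is no conversion
from reals to integers and there are no real constants beyond integers. Every node of an
expression, every statement and every pass through a loop costs one step. The only loops are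
`for` loops, whose number of passes is fixed on entry; so every program halts on every input, and
each can be run on a usual real RAM with constant overhead. -/

/-- Integer expressions over the integer registers. -/
inductive IExpr : Type
  | const (n : ℕ)
  | reg (a : ℕ)
  | add (e₁ e₂ : IExpr)
  | sub (e₁ e₂ : IExpr)

/-- Real expressions; `cell a e₁ e₂ e₃` is the cell with address `(e₁, e₂, e₃)` of array `a`. -/
inductive RExpr : Type
  | cell (a : ℕ) (e₁ e₂ e₃ : IExpr)
  | ofInt (e : IExpr)
  | add (x y : RExpr)
  | sub (x y : RExpr)
  | mul (x y : RExpr)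
  | div (x y : RExpr)

/-- Tests for branching. -/
inductive Test : Type
  | intLt (e₁ e₂ : IExpr)
  | realLt (x y : RExpr)

/-- Programs. -/
inductive Prog : Type
  | skip
  | seq (p₁ p₂ : Prog)
  | setInt (a : ℕ) (e : IExpr)
  | setReal (a : ℕ) (e₁ e₂ e₃ : IExpr) (x : RExpr)
  | branch (t : Test) (p₁ p₂ : Prog)
  | forLoop (a : ℕ) (e : IExpr) (p : Prog)

/-- Machine states: integer registers and real arrays. -/
structure State : Type where
  reg : ℕ → ℕ
  mem : ℕ → ℕ → ℕ → ℕ → ℝ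

/-- Write `n` into integer register `a`. -/
def State.setReg (s : State) (a n : ℕ) : State :=
  { s with reg := Function.update s.reg a n }

/-- Write `v` into the cell `(i, j, l)` of array `a`. -/
def State.setMem (s : State) (a i j l : ℕ) (v : ℝ) : State :=
  { s with
    mem := fun a' i' j' l' =>
      if a' = a ∧ i' = i ∧ j' = j ∧ l' = l then v else s.mem a' i' j' l' }

/-- Value of an integer expression. -/
def IExpr.eval (s : State) : IExpr → ℕ
  | .const n => n
  | .reg a => s.reg a
  | .add e₁ e₂ => e₁.eval s + e₂.eval s
  | .sub e₁ e₂ => e₁.eval s - e₂.eval s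

/-- Number of steps needed to evaluate an integer expression. -/
def IExpr.steps : IExpr → ℕ
  | .const _ => 1
  | .reg _ => 1
  | .add e₁ e₂ => e₁.steps + e₂.steps + 1
  | .sub e₁ e₂ => e₁.steps + e₂.steps + 1

/-- Value of a real expression (division by zero gives `0`). -/
noncomputable def RExpr.eval (s : State) : RExpr → ℝ
  | .cell a e₁ e₂ e₃ => s.mem a (e₁.eval s) (e₂.eval s) (e₃.eval s)
  | .ofInt e => (e.eval s : ℝ)
  | .add x y => x.eval s + y.eval s
  | .sub x y => x.eval s - y.eval s
  | .mul x y => x.eval s * y.eval s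
  | .div x y => x.eval s / y.eval s

/-- Number of steps needed to evaluate a real expression. -/
def RExpr.steps : RExpr → ℕ
  | .cell _ e₁ e₂ e₃ => e₁.steps + e₂.steps + e₃.steps + 1
  | .ofInt e => e.steps + 1
  | .add x y => x.steps + y.steps + 1
  | .sub x y => x.steps + y.steps + 1
  | .mul x y => x.steps + y.steps + 1
  | .div x y => x.steps + y.steps + 1

/-- Truth of a test. -/
def Test.holds (s : State) : Test → Prop
  | .intLt e₁ e₂ => e₁.eval s < e₂.eval s
  | .realLt x y => x.eval s < y.eval s

/-- Number of steps needed to evaluate a test. -/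
def Test.steps : Test → ℕ
  | .intLt e₁ e₂ => e₁.steps + e₂.steps + 1
  | .realLt x y => x.steps + y.steps + 1

/-- The state after the first `n` passes of a `for` loop with counter `a` and body `f`, started
in state `s`; pass number `i` (from `0`) begins by writing `i` into the counter. -/
def loopState (f : State → State) (a : ℕ) (s : State) (n : ℕ) : State :=
  Nat.rec s (fun i t => f (t.setReg a i)) n

open Classical in
/-- The state in which a program halts. -/
noncomputable def Prog.exec : Prog → State → State
  | .skip, s => s
  | .seq p₁ p₂, s => p₂.exec (p₁.exec s)
  | .setInt a e, s => s.setReg a (e.eval s)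
  | .setReal a e₁ e₂ e₃ x, s => s.setMem a (e₁.eval s) (e₂.eval s) (e₃.eval s) (x.eval s)
  | .branch t p₁ p₂, s => if t.holds s then p₁.exec s else p₂.exec s
  | .forLoop a e p, s => loopState p.exec a s (e.eval s)

open Classical in
/-- The number of steps a program makes before it halts. -/
noncomputable def Prog.time : Prog → State → ℕ
  | .skip, _ => 1
  | .seq p₁ p₂, s => p₁.time s + p₂.time (p₁.exec s)
  | .setInt _ e, _ => e.steps + 1
  | .setReal _ e₁ e₂ e₃ x, _ => e₁.steps + e₂.steps + e₃.steps + x.steps + 1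
  | .branch t p₁ p₂, s => t.steps + (if t.holds s then p₁.time s else p₂.time s) + 1
  | .forLoop a e p, s =>
      e.steps + 1 +
        ∑ i ∈ Finset.range (e.eval s), (p.time ((loopState p.exec a s i).setReg a i) + 1)

/-- The initial state on `m` bags of `q` vectors in `ℝ^d`: integer registers `0, 1, 2, 3` hold
`d, q, k, m`, and cell `(i, j, l)` of array `0` holds coordinate `l` of vector `j` of bag `i`;
everything else is `0`. -/
noncomputable def inputState (d q k m : ℕ) (B : Fin m → Fin q → Vec d) : State where
  reg := fun a => if a = 0 then d else if a = 1 then q else if a = 2 then k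
    else if a = 3 then m else 0
  mem := fun a i j l =>
    if h : a = 0 ∧ i < m ∧ j < q ∧ l < d then B ⟨i, h.2.1⟩ ⟨j, h.2.2.1⟩ ⟨l, h.2.2.2⟩ else 0

/-- The number of steps of the program on the given bags. -/
noncomputable def runTime (P : Prog) {d q m : ℕ} (k : ℕ) (B : Fin m → Fin q → Vec d) : ℕ :=
  P.time (inputState d q k m B)

/-- The vector that the program computes from the given bags: cells `(0, 0, l)`, `l < d`, of
array `1` at the end of the run. -/
noncomputable def output (P : Prog) {d q m : ℕ} (k : ℕ) (B : Fin m → Fin q → Vec d) : Vec d :=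
  WithLp.toLp 2 fun l => (P.exec (inputState d q k m B)).mem 1 0 0 l

/-- A sample with the members of each bag listed in another order. -/
def relist {d q m : ℕ} (σ : Fin m → Equiv.Perm (Fin q)) (B : Fin m → Fin q → Vec d) :
    Fin m → Fin q → Vec d :=
  fun i j => B i (σ i j)

/-- The hypothesis `x ↦ pos (rᵀ x)` meets the error bound `ε`: its instance error is at most `ε`
if the bags are unbalanced; if they are balanced, it or `x ↦ pos (- rᵀ x)` has error at most
`ε`. -/
def Succeeds {d : ℕ} (D : Measure (Vec d)) (f : Vec d → Fin 2) (q k : ℕ) (ε : ℝ) (r : Vec d) :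
    Prop :=
  (2 * k ≠ q → instErr D f (ltf r) ≤ ε) ∧
    (2 * k = q → min (instErr D f (ltf r)) (instErr D f (ltf (-r))) ≤ ε)

end LLP

/-!
Write `L`, `l` for the extreme eigenvalues of the covariance matrix `S` and `σ² = ⟪r, S r⟫`. Under
`x ↦ -x` the conditional laws given the two labels are exchanged, so both have second moment
operator `S` (`integral_inner_mul_inner_condLabel`), and their means are `±c u` with
`u = S r / σ` and `c` the mean absolute value of a standard Gaussian variable
(`integral_inner_condLabel`): the part of `⟪w, x⟫` that is uncorrelated with `⟪r, x⟫` is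
independent of the label. Hence the Gram operator `G` of all vectors is about `m q S`, and `S⁻¹ u`
is a multiple of `r`; it remains to find a multiple of `u` and to solve a linear system.

* If the bags are unbalanced, the sum of all vectors is about `m (2 k - q) c u`, and multiplying it
  by `2 k - q` makes the coefficient positive (`Typical.close_unbalanced`).
* If they are balanced, the bag sums have mean zero, and the expected Gram operator of a bag sum
  is `q (S - c² u uᵀ)` (`integral_bag_sum_mul_sum`). So `G` minus the Gram operator of the bag sums
  is about `m q c² u uᵀ`, an operator of rank one, and the power method finds a multiple of `u` of
  unknown sign (`IsPowerVec.exists_near`, `Typical.close_balanced`).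

The linear system is solved by Richardson iteration with step `1 / tr G`; `tr G` is at most about
`m q d L`, and so `m` steps suffice (`norm_richardson_sub_le`, `Typical.norm_solution_sub_le`). A
vector that is close to a positive multiple of `r` makes a small error, since the two half-spaces
differ only where `⟪r, x⟫` is small or the deviation is large (`instErr_le`).

The statistics concentrate because, in a fixed direction, each statistic of a bag is dominated by
an average of squares of Gaussian variables, which has an exponential moment
(`bagMajorant_exp_moment`); a Chernoff bound and a union bound over a net of the unit ball then
give operator norm bounds (`exists_typical_bound`). The union bound costs a factor `6 * 25 ^ d`.
In dimension at least two this is absorbed by `d log (d / δ) ≥ d log 2`. In dimension one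
`log (d / δ)` may be arbitrarily small; there the sign of one number decides, and a one-sided
Chernoff bound without a leading factor suffices for unbalanced bags, while for balanced bags every
nonzero vector is a good answer (`sampleLaw_failSet_le_of_dim_one`).

The algorithm is an explicit program. What it computes is determined with an invariant rule for
loops (`exists_rhs_output`); its running time is polynomial because every loop runs to one of the
input sizes, which are never overwritten (`Prog.Plain.exists_time_le`).
-/

/-! ### Semantics of accumulating loops -/

namespace LLP

/-- The states `s` and `t` agree on the registers below `c` and on every array except `A`. -/
structure Agree (c A : ℕ) (s t : State) : Prop where
  reg : ∀ a < c, t.reg a = s.reg a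
  mem : ∀ A', A' ≠ A → t.mem A' = s.mem A'

theorem Agree.refl {c A : ℕ} (s : State) : Agree c A s s := ⟨fun _ _ => rfl, fun _ _ => rfl⟩

theorem Agree.trans {c A : ℕ} {s t u : State} (h : Agree c A s t) (h' : Agree c A t u) :
    Agree c A s u :=
  ⟨fun a ha => (h'.reg a ha).trans (h.reg a ha), fun a ha => (h'.mem a ha).trans (h.mem a ha)⟩

theorem Agree.setReg_right {c A n v : ℕ} {s t : State} (h : Agree c A s t) (hn : c ≤ n) :
    Agree c A s (t.setReg n v) :=
  ⟨fun a ha => by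
    rw [← h.reg a ha]; exact Function.update_of_ne (by omega) _ _, h.mem⟩

theorem Agree.setReg {c A v : ℕ} {s t : State} (h : Agree c A s t) :
    Agree (c + 1) A (s.setReg c v) (t.setReg c v) := by
  refine ⟨fun a ha => ?_, h.mem⟩
  by_cases hac : a = c
  · subst hac; simp [State.setReg]
  · simp only [State.setReg, Function.update_of_ne hac]
    exact h.reg a (by omega)

theorem Agree.mono {c c' A : ℕ} {s t : State} (h : Agree c A s t) (hc : c' ≤ c) :
    Agree c' A s t := ⟨fun a ha => h.reg a (by omega), h.mem⟩

@[simp] theorem reg_setReg (s : State) (a n b : ℕ) :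
    (s.setReg a n).reg b = if b = a then n else s.reg b := by
  simp [State.setReg, Function.update_apply]

@[simp] theorem mem_setReg (s : State) (a n : ℕ) : (s.setReg a n).mem = s.mem := rfl

theorem loopState_succ (f : State → State) (a : ℕ) (s : State) (n : ℕ) :
    loopState f a s (n + 1) = f ((loopState f a s n).setReg a n) := rfl

/-- Invariant rule for `for` loops. -/
theorem loopState_induction {f : State → State} {a : ℕ} {s : State} (I : ℕ → State → Prop)
    (n : ℕ) (h0 : I 0 s) (hs : ∀ i < n, ∀ t, I i t → I (i + 1) (f (t.setReg a i))) :
    I n (loopState f a s n) := by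
  suffices h : ∀ i ≤ n, I i (loopState f a s i) from h n le_rfl
  intro i hi
  induction i with
  | zero => exact h0
  | succ i ih => rw [loopState_succ]; exact hs i (by omega) _ (ih (by omega))

/-- The program `p` adds to array `A` the quantity `g`, which depends only on the registers
below `c` and on the other arrays, and it changes no other array and no register below `c`. -/
structure Adds (p : Prog) (c A : ℕ) (g : State → ℕ → ℕ → ℕ → ℝ) : Prop where
  agree : ∀ s, Agree c A s (p.exec s)
  add : ∀ s i j l, (p.exec s).mem A i j l = s.mem A i j l + g s i j l
  congr : ∀ s t, Agree c A s t → g t = g s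

/-- An accumulating assignment. -/
theorem Adds.assign (c A : ℕ) (e₁ e₂ e₃ : IExpr) (x : RExpr)
    (hx : ∀ s t, Agree c A s t → e₁.eval t = e₁.eval s ∧ e₂.eval t = e₂.eval s ∧
      e₃.eval t = e₃.eval s ∧ x.eval t = x.eval s) :
    Adds (.setReal A e₁ e₂ e₃ (.add (.cell A e₁ e₂ e₃) x)) c A
      (fun s i j l => if i = e₁.eval s ∧ j = e₂.eval s ∧ l = e₃.eval s then x.eval s else 0) := by
  refine ⟨fun s => ⟨fun _ _ => rfl, fun A' hA' => ?_⟩, fun s i j l => ?_, fun s t h => ?_⟩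
  · funext i j l; simp [Prog.exec, State.setMem, hA']
  · simp only [Prog.exec, State.setMem, RExpr.eval, true_and]
    split_ifs with h
    · obtain ⟨rfl, rfl, rfl⟩ := h; rfl
    · simp
  · obtain ⟨h1, h2, h3, h4⟩ := hx s t h
    simp only [h1, h2, h3, h4]

/-- A loop whose body accumulates adds the sum over the passes. -/
theorem Adds.loop {p : Prog} {c A n : ℕ} {g : State → ℕ → ℕ → ℕ → ℝ} (h : Adds p (c + 1) A g)
    (hn : n < c) :
    Adds (.forLoop c (.reg n) p) c A
      (fun s i j l => ∑ t ∈ Finset.range (s.reg n), g (s.setReg c t) i j l) := by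
  have key : ∀ s N, Agree c A s (loopState p.exec c s N) ∧ ∀ i j l,
      (loopState p.exec c s N).mem A i j l =
        s.mem A i j l + ∑ t ∈ Finset.range N, g (s.setReg c t) i j l := by
    intro s N
    induction N with
    | zero => exact ⟨Agree.refl s, by simp [loopState]⟩
    | succ N ih =>
      obtain ⟨h1, h2⟩ := ih
      rw [loopState_succ]
      refine ⟨?_, fun i j l => ?_⟩
      · exact (h1.setReg_right le_rfl).trans ((h.agree _).mono (by omega))
      · rw [h.add, Finset.sum_range_succ, mem_setReg, h2, h.congr _ _ h1.setReg]
        ring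
  refine ⟨fun s => (key s _).1, fun s => (key s _).2, fun s t hst => ?_⟩
  funext i j l
  rw [hst.reg n hn]
  exact Finset.sum_congr rfl fun x _ => by rw [h.congr _ _ hst.setReg]

/-- The integer expression `0`. -/
abbrev IExpr.zero : IExpr := .const 0

/-- The cell `(0, 0, e)` of array `a`, used as entry `e` of a vector. -/
abbrev RExpr.entry (a : ℕ) (e : IExpr) : RExpr := .cell a .zero .zero e

/-- Set entry `r` of the vector in array `A` to `x`, for every `r < d`; register `c` is the
counter. -/
def fillVec (c A : ℕ) (x : RExpr) : Prog :=
  .forLoop c (.reg 0) (.setReal A .zero .zero (.reg c) x)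

theorem fillVec_spec (c A : ℕ) (x : RExpr)
    (hx : ∀ s t, Agree (c + 1) A s t → x.eval t = x.eval s) (s : State) :
    Agree c A s ((fillVec c A x).exec s) ∧
      ∀ a < s.reg 0, ((fillVec c A x).exec s).mem A 0 0 a = x.eval (s.setReg c a) := by
  have key : ∀ N, Agree c A s (loopState (Prog.exec (.setReal A .zero .zero (.reg c) x)) c s N) ∧
      ∀ a < N, (loopState (Prog.exec (.setReal A .zero .zero (.reg c) x)) c s N).mem A 0 0 a
        = x.eval (s.setReg c a) := by
    intro N
    induction N with
    | zero => exact ⟨Agree.refl s, fun a ha => absurd ha (by omega)⟩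
    | succ N ih =>
      obtain ⟨h1, h2⟩ := ih
      rw [loopState_succ]
      refine ⟨⟨fun a ha => ?_, fun A' hA' => ?_⟩, fun a ha => ?_⟩
      · rw [← h1.reg a ha]
        simp [Prog.exec, State.setMem, show a ≠ c by omega]
      · rw [← h1.mem A' hA']
        funext i j l
        simp [Prog.exec, State.setMem, hA']
      · simp only [Prog.exec, State.setMem, IExpr.eval, reg_setReg, true_and, if_true, mem_setReg]
        split_ifs with haN
        · subst haN
          exact hx _ _ h1.setReg
        · exact h2 a (by omega)
  exact ⟨(key _).1, (key _).2⟩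

/-! ### The program -/

/-- `y ← A w` for the square matrix in rows of array `A`; registers `c`, `c + 1` are counters. -/
def matVec (c A w y : ℕ) : Prog :=
  .seq (fillVec c y (.ofInt .zero))
    (.forLoop c (.reg 0) (.forLoop (c + 1) (.reg 0)
      (.setReal y .zero .zero (.reg c) (.add (.cell y .zero .zero (.reg c))
        (.mul (.cell A .zero (.reg c) (.reg (c + 1))) (.entry w (.reg (c + 1))))))))

/-- Array `3` receives the bag sums. -/
def progSums : Prog :=
  .forLoop 4 (.reg 3) (.forLoop 5 (.reg 1) (.forLoop 6 (.reg 0)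
    (.setReal 3 (.reg 4) .zero (.reg 6) (.add (.cell 3 (.reg 4) .zero (.reg 6))
      (.cell 0 (.reg 4) (.reg 5) (.reg 6))))))

/-- Array `2` receives the Gram operator of the vectors in all bags. -/
def progGram : Prog :=
  .forLoop 4 (.reg 3) (.forLoop 5 (.reg 1) (.forLoop 6 (.reg 0) (.forLoop 7 (.reg 0)
    (.setReal 2 .zero (.reg 6) (.reg 7) (.add (.cell 2 .zero (.reg 6) (.reg 7))
      (.mul (.cell 0 (.reg 4) (.reg 5) (.reg 6)) (.cell 0 (.reg 4) (.reg 5) (.reg 7))))))))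

/-- Array `4` receives a copy of array `2`. -/
def progCopy : Prog :=
  .forLoop 4 (.reg 0) (.forLoop 5 (.reg 0)
    (.setReal 4 .zero (.reg 4) (.reg 5) (.add (.cell 4 .zero (.reg 4) (.reg 5))
      (.cell 2 .zero (.reg 4) (.reg 5)))))

/-- The Gram operator of the bag sums is subtracted from array `4`. -/
def progDiff : Prog :=
  .forLoop 4 (.reg 3) (.forLoop 5 (.reg 0) (.forLoop 6 (.reg 0)
    (.setReal 4 .zero (.reg 5) (.reg 6) (.add (.cell 4 .zero (.reg 5) (.reg 6))
      (.sub (.ofInt .zero)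
        (.mul (.cell 3 (.reg 4) .zero (.reg 5)) (.cell 3 (.reg 4) .zero (.reg 6))))))))

/-- Array `7` receives the trace of the Gram operator. -/
def progTrace : Prog :=
  .forLoop 4 (.reg 0) (.setReal 7 .zero .zero .zero (.add (.cell 7 .zero .zero .zero)
    (.cell 2 .zero (.reg 4) (.reg 4))))

/-- Array `5` receives `2k - q` times the sum of all vectors. -/
def progMean : Prog :=
  .forLoop 4 (.reg 3) (.forLoop 5 (.reg 0)
    (.setReal 5 .zero .zero (.reg 5) (.add (.cell 5 .zero .zero (.reg 5))
      (.mul (.sub (.ofInt (.add (.reg 2) (.reg 2))) (.ofInt (.reg 1)))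
        (.cell 3 (.reg 4) .zero (.reg 5))))))

/-- The vector in array `10` is multiplied `m` times by the matrix in array `4`. -/
def progIterate : Prog :=
  .forLoop 5 (.reg 3) (.seq (matVec 6 4 10 6) (fillVec 6 10 (.entry 6 (.reg 6))))

/-- Array `8` receives the squared norm of the vector in array `10`. -/
def progNorm : Prog :=
  .seq (.setReal 8 .zero .zero .zero (.ofInt .zero))
    (.forLoop 5 (.reg 0) (.setReal 8 .zero .zero .zero (.add (.cell 8 .zero .zero .zero)
      (.mul (.entry 10 (.reg 5)) (.entry 10 (.reg 5))))))

/-- If the vector in array `10` is longer than all its predecessors, then it is kept in array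
`5`; array `9` holds the record of the squared norms. -/
def progRecord : Prog :=
  .branch (.realLt (.cell 9 .zero .zero .zero) (.cell 8 .zero .zero .zero))
    (.seq (.setReal 9 .zero .zero .zero (.cell 8 .zero .zero .zero))
      (fillVec 5 5 (.entry 10 (.reg 5)))) .skip

/-- Array `10` receives the standard basis vector whose index is in register `4`. -/
def progBasis : Prog :=
  .seq (fillVec 5 10 (.ofInt .zero)) (.setReal 10 .zero .zero (.reg 4) (.ofInt (.const 1)))

/-- Array `5` receives the longest of the vectors `M ^ m e`, where `M` is the matrix in array `4`
and `e` runs over the standard basis; if all of them vanish, it receives the first basis vector. -/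
def progPower : Prog :=
  .seq (.setReal 5 .zero .zero .zero (.ofInt (.const 1)))
    (.forLoop 4 (.reg 0) (.seq progBasis (.seq progIterate (.seq progNorm progRecord))))

/-- `m` Richardson steps for the linear system with the matrix in array `2` and the right-hand
side in array `5`; array `1` holds the iterate. -/
def progSolve : Prog :=
  .forLoop 4 (.reg 3) (.seq (matVec 5 2 1 6)
    (.forLoop 5 (.reg 0) (.setReal 1 .zero .zero (.reg 5) (.add (.cell 1 .zero .zero (.reg 5))
      (.div (.sub (.entry 5 (.reg 5)) (.entry 6 (.reg 5))) (.cell 7 .zero .zero .zero))))))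

/-- The right-hand side of the linear system: a multiple of the sum of all vectors if the bags
are unbalanced, a vector found by the power method if they are balanced. -/
def progRhs : Prog :=
  .branch (.intLt (.add (.reg 2) (.reg 2)) (.reg 1)) progMean
    (.branch (.intLt (.reg 1) (.add (.reg 2) (.reg 2))) progMean progPower)

/-- The learning algorithm. -/
def learner : Prog :=
  .seq progSums (.seq progGram (.seq progCopy (.seq progDiff (.seq progTrace
    (.seq progRhs progSolve)))))

/-! ### Running time -/

/-- All loops of the program run to register `0`, `1` or `3`, and no register below `4` is
written. -/
def Prog.Plain : Prog → Prop
  | .skip => True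
  | .seq p₁ p₂ => p₁.Plain ∧ p₂.Plain
  | .setInt a _ => 4 ≤ a
  | .setReal _ _ _ _ _ => True
  | .branch _ p₁ p₂ => p₁.Plain ∧ p₂.Plain
  | .forLoop a e p => 4 ≤ a ∧ (e = .reg 0 ∨ e = .reg 1 ∨ e = .reg 3) ∧ p.Plain

theorem Prog.Plain.reg_exec {p : Prog} (hp : p.Plain) (s : State) :
    ∀ a < 4, (p.exec s).reg a = s.reg a := by
  induction p generalizing s with
  | skip => intro a _; rfl
  | seq p₁ p₂ h₁ h₂ =>
    intro a ha
    rw [Prog.exec, h₂ hp.2 _ a ha, h₁ hp.1 _ a ha]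
  | setInt b e =>
    intro a ha
    have : 4 ≤ b := hp
    simp [Prog.exec, show a ≠ b by omega]
  | setReal => intro a _; rfl
  | branch t p₁ p₂ h₁ h₂ =>
    intro a ha
    rw [Prog.exec]
    split_ifs
    · exact h₁ hp.1 s a ha
    · exact h₂ hp.2 s a ha
  | forLoop b e p h =>
    obtain ⟨hb, _, hp⟩ := hp
    rw [Prog.exec]
    refine loopState_induction (fun _ t => ∀ a < 4, t.reg a = s.reg a) _ (fun a _ => rfl) ?_
    intro i _ t ht a ha
    rw [h hp _ a ha, reg_setReg, if_neg (by omega), ht a ha]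

/-- A plain program runs in time polynomial in any bound for the registers `0`, `1`, `3`. -/
theorem Prog.Plain.exists_time_le {p : Prog} (hp : p.Plain) :
    ∃ K : ℕ, ∀ N : ℕ, 1 ≤ N → ∀ s : State, s.reg 0 ≤ N → s.reg 1 ≤ N → s.reg 3 ≤ N →
      p.time s ≤ K * N ^ K := by
  have mono : ∀ {K K' N : ℕ}, K ≤ K' → 1 ≤ N → K * N ^ K ≤ K * N ^ K' := fun h hN =>
    Nat.mul_le_mul_left _ (Nat.pow_le_pow_right hN h)
  induction p with
  | skip => exact ⟨1, fun N hN s _ _ _ => by simp only [Prog.time]; nlinarith⟩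
  | seq p₁ p₂ h₁ h₂ =>
    obtain ⟨K₁, h₁⟩ := h₁ hp.1
    obtain ⟨K₂, h₂⟩ := h₂ hp.2
    refine ⟨K₁ + K₂, fun N hN s a b c => ?_⟩
    rw [Prog.time, add_mul]
    have r := hp.1.reg_exec s
    exact add_le_add ((h₁ N hN s a b c).trans (mono (by omega) hN))
      ((h₂ N hN _ (by rwa [r 0 (by omega)]) (by rwa [r 1 (by omega)])
        (by rwa [r 3 (by omega)])).trans (mono (by omega) hN))
  | setInt b e =>
    refine ⟨e.steps + 1, fun N hN s _ _ _ => ?_⟩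
    rw [Prog.time]
    exact Nat.le_mul_of_pos_right _ (Nat.pow_pos hN)
  | setReal a e₁ e₂ e₃ x =>
    refine ⟨e₁.steps + e₂.steps + e₃.steps + x.steps + 1, fun N hN s _ _ _ => ?_⟩
    rw [Prog.time]
    exact Nat.le_mul_of_pos_right _ (Nat.pow_pos hN)
  | branch t p₁ p₂ h₁ h₂ =>
    obtain ⟨K₁, h₁⟩ := h₁ hp.1
    obtain ⟨K₂, h₂⟩ := h₂ hp.2
    refine ⟨t.steps + K₁ + K₂ + 1, fun N hN s a b c => ?_⟩
    have e₁ := (h₁ N hN s a b c).trans (mono (show K₁ ≤ t.steps + K₁ + K₂ + 1 by omega) hN)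
    have e₂ := (h₂ N hN s a b c).trans (mono (show K₂ ≤ t.steps + K₁ + K₂ + 1 by omega) hN)
    have hP := Nat.pow_pos (n := t.steps + K₁ + K₂ + 1) hN
    rw [Prog.time]
    generalize N ^ (t.steps + K₁ + K₂ + 1) = P at *
    have e₃ : t.steps ≤ t.steps * P := Nat.le_mul_of_pos_right _ hP
    split_ifs <;> nlinarith
  | forLoop b e p h =>
    obtain ⟨hb, he, hp⟩ := hp
    obtain ⟨K, h⟩ := h hp
    have hsteps : e.steps = 1 := by rcases he with rfl | rfl | rfl <;> rfl
    refine ⟨K + 3, fun N hN s a b' c => ?_⟩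
    have heN : e.eval s ≤ N := by rcases he with rfl | rfl | rfl <;> assumption
    rw [Prog.time, hsteps]
    have hsum : ∑ i ∈ Finset.range (e.eval s),
        (p.time ((loopState p.exec b s i).setReg b i) + 1) ≤ N * (K * N ^ K + 1) := by
      refine (Finset.sum_le_card_nsmul _ _ (K * N ^ K + 1) fun i _ => ?_).trans ?_
      · have r : ∀ a < 4, ((loopState p.exec b s i).setReg b i).reg a = s.reg a := by
          intro a ha
          rw [reg_setReg, if_neg (by omega)]
          refine loopState_induction (f := p.exec) (a := b) (s := s)
            (fun _ t => ∀ a < 4, t.reg a = s.reg a) i (fun a _ => rfl) ?_ a ha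
          intro j _ t ht a ha
          rw [hp.reg_exec _ a ha, reg_setReg, if_neg (by omega), ht a ha]
        exact Nat.succ_le_succ (h N hN _ (by rwa [r 0 (by omega)]) (by rwa [r 1 (by omega)])
          (by rwa [r 3 (by omega)]))
      · rw [Finset.card_range, smul_eq_mul]
        exact Nat.mul_le_mul_right _ heN
    refine (Nat.add_le_add_left hsum _).trans ?_
    have hP := Nat.pow_pos (n := K + 1) hN
    have e₁ : N * (K * N ^ K + 1) ≤ K * N ^ (K + 1) + N ^ (K + 1) := by
      have : N ≤ N ^ (K + 1) := Nat.le_self_pow (by omega) N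
      calc N * (K * N ^ K + 1) = K * N ^ (K + 1) + N := by ring
        _ ≤ _ := by omega
    have e₂ : N ^ (K + 1) ≤ N ^ (K + 3) := Nat.pow_le_pow_right hN (by omega)
    nlinarith

theorem learner_plain : learner.Plain := by
  simp [learner, progSums, progGram, progCopy, progDiff, progTrace, progRhs, progMean, progPower,
    progBasis, progIterate, progNorm, progRecord, progSolve, matVec, fillVec, Prog.Plain]

/-- The running time of the algorithm is polynomial in the size of the input. -/
theorem exists_runTime_le : ∃ K : ℕ, ∀ (d q k m N : ℕ), 1 ≤ N → d ≤ N → q ≤ N → m ≤ N →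
    ∀ B : Fin m → Fin q → Vec d, runTime learner k B ≤ K * N ^ K := by
  obtain ⟨K, h⟩ := learner_plain.exists_time_le
  exact ⟨K, fun d q k m N hN hd hq hm B => h N hN _ (by simpa [inputState] using hd)
    (by simpa [inputState] using hq) (by simpa [inputState] using hm)⟩

/-! ### What the program computes -/

/-- The Gram operator `x ↦ ∑ ⟪X i, x⟫ X i` of a finite family of vectors. -/
noncomputable def gramOp {d : ℕ} {ι : Type*} [Fintype ι] (X : ι → Vec d) : Vec d →ₗ[ℝ] Vec d :=
  ∑ i, (innerₛₗ ℝ (X i)).smulRight (X i)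

theorem gramOp_apply {d : ℕ} {ι : Type*} [Fintype ι] (X : ι → Vec d) (x : Vec d) :
    gramOp X x = ∑ i, inner ℝ (X i) x • X i := by
  simp [gramOp, LinearMap.sum_apply]

/-- All vectors of a sample, as one family. -/
def allVecs {d q m : ℕ} (B : Fin m → Fin q → Vec d) : Fin m × Fin q → Vec d :=
  fun p => B p.1 p.2

/-- The sums of the bags. -/
noncomputable def bagSum {d q m : ℕ} (B : Fin m → Fin q → Vec d) : Fin m → Vec d :=
  fun i => ∑ j, B i j

/-- The Gram operator of the vectors minus the Gram operator of the bag sums. For balanced bags its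
expectation has rank one. -/
noncomputable def diffOp {d q m : ℕ} (B : Fin m → Fin q → Vec d) : Vec d →ₗ[ℝ] Vec d :=
  gramOp (allVecs B) - gramOp (bagSum B)

/-- `v` is a longest one among the vectors `A ^ m e`, where `e` runs over the standard basis; if
all of them vanish, `v` is the first basis vector. -/
def IsPowerVec {d : ℕ} (A : Vec d → Vec d) (m : ℕ) (v : Vec d) : Prop :=
  (∀ j, ‖A^[m] (EuclideanSpace.single j 1)‖ ≤ ‖v‖) ∧
    ((v ≠ 0 ∧ ∃ j, v = A^[m] (EuclideanSpace.single j 1)) ∨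
    ((∀ j, A^[m] (EuclideanSpace.single j 1) = 0) ∧
      ∀ i : Fin d, v i = if (i : ℕ) = 0 then 1 else 0))

/-- `v` is an admissible right-hand side of the linear system: a multiple of the sum of all vectors
if the bags are unbalanced, a vector found by the power method if they are balanced. -/
def IsRhs {d q m : ℕ} (k : ℕ) (B : Fin m → Fin q → Vec d) (v : Vec d) : Prop :=
  (2 * k ≠ q → v = (2 * k - q : ℝ) • ∑ i, bagSum B i) ∧
    (2 * k = q → IsPowerVec (diffOp B) m v)

/-- One Richardson step for the system `G r = v`. -/
noncomputable def richardson {d : ℕ} (G : Vec d → Vec d) (τ : ℝ) (v r : Vec d) : Vec d :=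
  r + τ⁻¹ • (v - G r)

/-- The vector stored in the cells `(0, 0, l)`, `l < d`, of array `A`. -/
noncomputable def vecAt (d : ℕ) (s : State) (A : ℕ) : Vec d := WithLp.toLp 2 fun l => s.mem A 0 0 l

/-- The matrix stored in the cells `(0, a, b)` of array `A`, as an operator. -/
noncomputable def opAt (d : ℕ) (s : State) (A : ℕ) (x : Vec d) : Vec d :=
  WithLp.toLp 2 fun a => ∑ b : Fin d, s.mem A 0 a b * x b

theorem vecAt_congr {d : ℕ} {s t : State} {A : ℕ} (h : t.mem A = s.mem A) :
    vecAt d t A = vecAt d s A := by simp [vecAt, h]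

theorem opAt_congr {d : ℕ} {s t : State} {A : ℕ} (h : t.mem A = s.mem A) :
    opAt d t A = opAt d s A := by funext x; simp [opAt, h]

theorem matVec_spec {d c A w y : ℕ} (hA : A ≠ y) (hw : w ≠ y) (hc : 0 < c) (s : State)
    (hd : s.reg 0 = d) :
    Agree c y s ((matVec c A w y).exec s) ∧
      vecAt d ((matVec c A w y).exec s) y = opAt d s A (vecAt d s w) := by
  have hfill := fillVec_spec c y (.ofInt .zero) (fun _ _ _ => rfl) s
  have hadd := ((Adds.assign (c + 2) y .zero .zero (.reg c)
    (.mul (.cell A .zero (.reg c) (.reg (c + 1))) (.entry w (.reg (c + 1)))) (fun s t h => by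
      simp [IExpr.eval, RExpr.eval, h.reg c (by omega), h.reg (c + 1) (by omega),
        h.mem A hA, h.mem w hw])).loop (n := 0) (by omega)).loop (n := 0) hc
  refine ⟨hfill.1.trans (hadd.agree _), ?_⟩
  ext a
  simp only [vecAt, matVec, Prog.exec, opAt]
  have h1 := hadd.add ((fillVec c y (.ofInt .zero)).exec s) 0 0 a
  simp only [Prog.exec] at h1
  rw [h1, hfill.2 a (by rw [hd]; exact a.2)]
  have hr : ((fillVec c y (.ofInt .zero)).exec s).reg 0 = d := by rw [hfill.1.reg 0 hc, hd]
  simp only [IExpr.eval, RExpr.eval, reg_setReg, mem_setReg, hr, hfill.1.mem A hA,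
    hfill.1.mem w hw, if_true, show (0 : ℕ) ≠ c by omega, if_false, true_and,
    show c ≠ c + 1 by omega, Nat.cast_zero, zero_add]
  rw [Finset.sum_eq_single (a : ℕ)]
  · simp [Finset.sum_range]
  · intro b _ hb
    simp [hb.symm]
  · intro h
    exact absurd (Finset.mem_range.2 a.2) h

theorem progSums_spec {d q m : ℕ} (s : State) (h0 : s.reg 0 = d) (h1 : s.reg 1 = q)
    (h3 : s.reg 3 = m) : Agree 4 3 s (progSums.exec s) ∧ ∀ i < m, ∀ l < d,
      (progSums.exec s).mem 3 i 0 l = s.mem 3 i 0 l + ∑ j ∈ Finset.range q, s.mem 0 i j l := by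
  have hadd := (((Adds.assign 7 3 (.reg 4) .zero (.reg 6) (.cell 0 (.reg 4) (.reg 5) (.reg 6))
    (fun s t h => by
      simp [IExpr.eval, RExpr.eval, h.reg, h.mem])).loop (n := 0) (by omega)).loop (n := 1)
      (by omega)).loop (n := 3) (by omega)
  refine ⟨hadd.agree s, fun i hi l hl => ?_⟩
  refine (hadd.add s i 0 l).trans ?_
  simp only [IExpr.eval, RExpr.eval, reg_setReg, mem_setReg, h0, h1, h3]
  norm_num
  rw [Finset.sum_eq_single i]
  · refine Finset.sum_congr rfl fun j _ => ?_
    rw [Finset.sum_eq_single l]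
    · simp
    · intro b _ hb; simp [hb.symm]
    · intro h; exact absurd (Finset.mem_range.2 hl) h
  · intro b _ hb; simp [hb.symm]
  · intro h; exact absurd (Finset.mem_range.2 hi) h

theorem progGram_spec {d q m : ℕ} (s : State) (h0 : s.reg 0 = d) (h1 : s.reg 1 = q)
    (h3 : s.reg 3 = m) : Agree 4 2 s (progGram.exec s) ∧ ∀ a < d, ∀ b < d,
      (progGram.exec s).mem 2 0 a b = s.mem 2 0 a b +
        ∑ i ∈ Finset.range m, ∑ j ∈ Finset.range q, s.mem 0 i j a * s.mem 0 i j b := by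
  have hadd := ((((Adds.assign 8 2 .zero (.reg 6) (.reg 7)
    (.mul (.cell 0 (.reg 4) (.reg 5) (.reg 6)) (.cell 0 (.reg 4) (.reg 5) (.reg 7)))
    (fun s t h => by
      simp [IExpr.eval, RExpr.eval, h.reg, h.mem])).loop (n := 0) (by omega)).loop (n := 0)
      (by omega)).loop (n := 1) (by omega)).loop (n := 3) (by omega)
  refine ⟨hadd.agree s, fun a ha b hb => ?_⟩
  refine (hadd.add s 0 a b).trans ?_
  simp only [IExpr.eval, RExpr.eval, reg_setReg, mem_setReg, h0, h1, h3]
  norm_num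
  refine Finset.sum_congr rfl fun i _ => Finset.sum_congr rfl fun j _ => ?_
  rw [Finset.sum_eq_single a]
  · rw [Finset.sum_eq_single b]
    · simp
    · intro x _ hx; simp [hx.symm]
    · intro h; exact absurd (Finset.mem_range.2 hb) h
  · intro x _ hx; simp [hx.symm]
  · intro h; exact absurd (Finset.mem_range.2 ha) h

theorem progCopy_spec {d : ℕ} (s : State) (h0 : s.reg 0 = d) :
    Agree 4 4 s (progCopy.exec s) ∧ ∀ a < d, ∀ b < d,
      (progCopy.exec s).mem 4 0 a b = s.mem 4 0 a b + s.mem 2 0 a b := by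
  have hadd := ((Adds.assign 6 4 .zero (.reg 4) (.reg 5)
    (.cell 2 .zero (.reg 4) (.reg 5))
    (fun s t h => by
      simp [IExpr.eval, RExpr.eval, h.reg, h.mem])).loop (n := 0) (by omega)).loop (n := 0)
      (by omega)
  refine ⟨hadd.agree s, fun a ha b hb => ?_⟩
  refine (hadd.add s 0 a b).trans ?_
  simp only [IExpr.eval, RExpr.eval, reg_setReg, mem_setReg, h0]
  norm_num
  rw [Finset.sum_eq_single a]
  · rw [Finset.sum_eq_single b]
    · simp
    · intro x _ hx; simp [hx.symm]
    · intro h; exact absurd (Finset.mem_range.2 hb) h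
  · intro x _ hx; simp [hx.symm]
  · intro h; exact absurd (Finset.mem_range.2 ha) h

theorem progDiff_spec {d m : ℕ} (s : State) (h0 : s.reg 0 = d)
    (h3 : s.reg 3 = m) : Agree 4 4 s (progDiff.exec s) ∧ ∀ a < d, ∀ b < d,
      (progDiff.exec s).mem 4 0 a b = s.mem 4 0 a b -
        ∑ i ∈ Finset.range m, s.mem 3 i 0 a * s.mem 3 i 0 b := by
  have hadd := (((Adds.assign 7 4 .zero (.reg 5) (.reg 6)
    (.sub (.ofInt .zero) (.mul (.cell 3 (.reg 4) .zero (.reg 5)) (.cell 3 (.reg 4) .zero (.reg 6))))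
    (fun s t h => by
      simp [IExpr.eval, RExpr.eval, h.reg, h.mem])).loop (n := 0) (by omega)).loop (n := 0)
      (by omega)).loop (n := 3) (by omega)
  refine ⟨hadd.agree s, fun a ha b hb => ?_⟩
  refine (hadd.add s 0 a b).trans ?_
  simp only [IExpr.eval, RExpr.eval, reg_setReg, mem_setReg, h0, h3]
  norm_num
  rw [sub_eq_add_neg, ← Finset.sum_neg_distrib]
  congr 1
  refine Finset.sum_congr rfl fun i _ => ?_
  rw [Finset.sum_eq_single a]
  · rw [Finset.sum_eq_single b]
    · simp
    · intro x _ hx; simp [hx.symm]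
    · intro h; exact absurd (Finset.mem_range.2 hb) h
  · intro x _ hx; simp [hx.symm]
  · intro h; exact absurd (Finset.mem_range.2 ha) h

theorem progTrace_spec {d : ℕ} (s : State) (h0 : s.reg 0 = d) :
    Agree 4 7 s (progTrace.exec s) ∧
      (progTrace.exec s).mem 7 0 0 0 = s.mem 7 0 0 0 + ∑ a ∈ Finset.range d, s.mem 2 0 a a := by
  have hadd := (Adds.assign 5 7 .zero .zero .zero (.cell 2 .zero (.reg 4) (.reg 4))
    (fun s t h => by
      simp [IExpr.eval, RExpr.eval, h.reg, h.mem])).loop (n := 0) (by omega)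
  refine ⟨hadd.agree s, ?_⟩
  refine (hadd.add s 0 0 0).trans ?_
  simp [IExpr.eval, RExpr.eval, h0]

theorem progMean_spec {d q k m : ℕ} (s : State) (h0 : s.reg 0 = d) (h1 : s.reg 1 = q)
    (h2 : s.reg 2 = k) (h3 : s.reg 3 = m) : Agree 4 5 s (progMean.exec s) ∧ ∀ a < d,
      (progMean.exec s).mem 5 0 0 a = s.mem 5 0 0 a +
        ∑ i ∈ Finset.range m, ((2 * k - q : ℝ)) * s.mem 3 i 0 a := by
  have hadd := ((Adds.assign 6 5 .zero .zero (.reg 5)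
    (.mul (.sub (.ofInt (.add (.reg 2) (.reg 2))) (.ofInt (.reg 1))) (.cell 3 (.reg 4) .zero (.reg 5)))
    (fun s t h => by
      simp [IExpr.eval, RExpr.eval, h.reg, h.mem])).loop (n := 0) (by omega)).loop (n := 3) (by omega)
  refine ⟨hadd.agree s, fun a ha => ?_⟩
  refine (hadd.add s 0 0 a).trans ?_
  simp only [IExpr.eval, RExpr.eval, reg_setReg, mem_setReg, h0, h1, h2, h3]
  congr 1
  refine Finset.sum_congr rfl fun i _ => ?_
  rw [Finset.sum_eq_single a]
  · simp; left; ring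
  · intro x _ hx; simp [hx.symm]
  · intro h; exact absurd (Finset.mem_range.2 ha) h

theorem progIterate_spec {d m : ℕ} (s : State) (h0 : s.reg 0 = d) (h3 : s.reg 3 = m) :
    (∀ a < 5, (progIterate.exec s).reg a = s.reg a) ∧
    (∀ A, A ≠ 6 → A ≠ 10 → (progIterate.exec s).mem A = s.mem A) ∧
      vecAt d (progIterate.exec s) 10 = (opAt d s 4)^[m] (vecAt d s 10) := by
  have := loopState_induction (f := Prog.exec (.seq (matVec 6 4 10 6) (fillVec 6 10 (.entry 6 (.reg 6)))))
    (a := 5) (s := s) (fun i t => (∀ a < 5, t.reg a = s.reg a) ∧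
    (∀ A, A ≠ 6 → A ≠ 10 → t.mem A = s.mem A) ∧
      vecAt d t 10 = (opAt d s 4)^[i] (vecAt d s 10)) m ⟨fun _ _ => rfl, fun _ _ _ => rfl, rfl⟩ ?_
  · simpa only [progIterate, Prog.exec, IExpr.eval, h3] using this
  rintro i - t ⟨hreg, hmem, hv⟩
  have hd : (t.setReg 5 i).reg 0 = d := by simp [hreg, h0]
  obtain ⟨f1, f2⟩ := matVec_spec (d := d) (c := 6) (A := 4) (w := 10) (y := 6) (by omega) (by omega)
    (by omega) (t.setReg 5 i) hd
  obtain ⟨g1, g2⟩ := fillVec_spec 6 10 (.entry 6 (.reg 6)) (fun s t h => by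
    simp [IExpr.eval, RExpr.eval, h.reg, h.mem]) ((matVec 6 4 10 6).exec (t.setReg 5 i))
  refine ⟨fun a ha => ?_, fun A h6 h10 => ?_, ?_⟩
  · rw [Prog.exec, g1.reg a (by omega), f1.reg a (by omega), reg_setReg, if_neg (by omega), hreg a ha]
  · rw [Prog.exec, g1.mem A h10, f1.mem A h6, mem_setReg, hmem A h6 h10]
  · rw [Function.iterate_succ_apply', ← hv, ← opAt_congr (hmem 4 (by omega) (by omega))]
    refine Eq.trans ?_ f2
    ext a
    simp only [vecAt, Prog.exec]
    rw [g2 a (by rw [f1.reg 0 (by omega), hd]; exact a.2)]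
    simp [RExpr.eval, IExpr.eval]

theorem progBasis_spec {d : ℕ} (s : State) (h0 : s.reg 0 = d) (j : Fin d) (h4 : s.reg 4 = j) :
    Agree 5 10 s (progBasis.exec s) ∧
      vecAt d (progBasis.exec s) 10 = EuclideanSpace.single j 1 := by
  obtain ⟨g1, g2⟩ := fillVec_spec 5 10 (.ofInt .zero) (fun s t h => by
    simp [IExpr.eval, RExpr.eval]) s
  have h4' : ((fillVec 5 10 (.ofInt .zero)).exec s).reg 4 = j := by rw [g1.reg 4 (by omega), h4]
  refine ⟨⟨g1.reg, fun A hA => ?_⟩, ?_⟩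
  · rw [← g1.mem A hA]
    funext i j l
    simp [progBasis, Prog.exec, State.setMem, hA]
  · ext a
    simp only [vecAt, progBasis, Prog.exec, State.setMem, IExpr.eval, h4', true_and]
    by_cases haj : a = j
    · simp [haj, RExpr.eval, IExpr.eval]
    · have : (a : ℕ) ≠ j := fun h => haj (Fin.ext h)
      rw [if_neg this, g2 a (by rw [h0]; exact a.2)]
      simp [RExpr.eval, IExpr.eval, haj]

theorem progNorm_spec {d : ℕ} (s : State) (h0 : s.reg 0 = d) :
    Agree 5 8 s (progNorm.exec s) ∧
      (progNorm.exec s).mem 8 0 0 0 = ‖vecAt d s 10‖ ^ 2 := by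
  have hadd := (Adds.assign 6 8 .zero .zero .zero (.mul (.entry 10 (.reg 5)) (.entry 10 (.reg 5)))
    (fun s t h => by
      simp [IExpr.eval, RExpr.eval, h.reg, h.mem])).loop (n := 0) (by omega)
  have h1 : Agree 5 8 s (Prog.exec (.setReal 8 .zero .zero .zero (.ofInt .zero)) s) := by
    refine ⟨fun _ _ => rfl, fun A hA => ?_⟩
    funext i j l; simp [Prog.exec, State.setMem, hA]
  refine ⟨h1.trans (hadd.agree _), ?_⟩
  refine (hadd.add _ 0 0 0).trans ?_
  rw [EuclideanSpace.norm_sq_eq]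
  simp [Prog.exec, IExpr.eval, RExpr.eval, h0, State.setMem, vecAt, Finset.sum_range, sq]

theorem progRecord_spec {d : ℕ} (s : State) (h0 : s.reg 0 = d) :
    (∀ a < 5, (progRecord.exec s).reg a = s.reg a) ∧
    (∀ A, A ≠ 5 → A ≠ 9 → (progRecord.exec s).mem A = s.mem A) ∧
    ((s.mem 9 0 0 0 < s.mem 8 0 0 0 ∧ (progRecord.exec s).mem 9 0 0 0 = s.mem 8 0 0 0 ∧
      vecAt d (progRecord.exec s) 5 = vecAt d s 10) ∨
     (s.mem 8 0 0 0 ≤ s.mem 9 0 0 0 ∧ progRecord.exec s = s)) := by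
  by_cases h : s.mem 9 0 0 0 < s.mem 8 0 0 0
  · set t := Prog.exec (.setReal 9 .zero .zero .zero (.cell 8 .zero .zero .zero)) s with ht
    have h1 : Agree 5 9 s t := by
      refine ⟨fun _ _ => rfl, fun A hA => ?_⟩
      funext i j l; simp [t, Prog.exec, State.setMem, hA]
    have he : progRecord.exec s = (fillVec 5 5 (.entry 10 (.reg 5))).exec t := by
      simp [progRecord, Prog.exec, Test.holds, RExpr.eval, IExpr.eval, h, t]
    obtain ⟨g1, g2⟩ := fillVec_spec 5 5 (.entry 10 (.reg 5)) (fun s t h => by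
      simp [IExpr.eval, RExpr.eval, h.reg, h.mem]) t
    rw [he]
    refine ⟨fun a ha => by rw [g1.reg a ha, h1.reg a ha], fun A h5 h9 => by
      rw [g1.mem A h5, h1.mem A h9], Or.inl ⟨h, ?_, ?_⟩⟩
    · rw [g1.mem 9 (by omega)]
      simp [t, Prog.exec, State.setMem, RExpr.eval, IExpr.eval]
    · ext a
      simp only [vecAt]
      rw [g2 a (by rw [h1.reg 0 (by omega), h0]; exact a.2)]
      simp [RExpr.eval, IExpr.eval, h1.mem]
  · have he : progRecord.exec s = s := by
      simp [progRecord, Prog.exec, Test.holds, RExpr.eval, IExpr.eval, h]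
    rw [he]
    exact ⟨fun _ _ => rfl, fun _ _ _ => rfl, Or.inr ⟨not_lt.1 h, rfl⟩⟩

theorem progPower_spec {d m : ℕ} (s : State) (h0 : s.reg 0 = d) (h3 : s.reg 3 = m)
    (h5 : s.mem 5 = 0) (h9 : s.mem 9 0 0 0 = 0) :
    (∀ a < 4, (progPower.exec s).reg a = s.reg a) ∧
    (∀ A < 5, (progPower.exec s).mem A = s.mem A) ∧ (progPower.exec s).mem 7 = s.mem 7 ∧
      IsPowerVec (opAt d s 4) m (vecAt d (progPower.exec s) 5) := by
  set F := opAt d s 4 with hF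
  set s' := Prog.exec (.setReal 5 .zero .zero .zero (.ofInt (.const 1))) s with hs'
  have ha : Agree 4 5 s s' := by
    refine ⟨fun _ _ => rfl, fun A hA => ?_⟩
    funext i j l; simp [s', Prog.exec, State.setMem, hA]
  set body : Prog := .seq progBasis (.seq progIterate (.seq progNorm progRecord)) with hbody
  -- The record in array `9` is the squared norm of the kept vector unless none was kept.
  have key := loopState_induction (f := body.exec) (a := 4) (s := s') (fun i t =>
    (∀ a < 4, t.reg a = s.reg a) ∧ (∀ A < 5, t.mem A = s.mem A) ∧ t.mem 7 = s.mem 7 ∧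
    ((t.mem 9 0 0 0 = ‖vecAt d t 5‖ ^ 2 ∧ vecAt d t 5 ≠ 0 ∧
        (∀ j : Fin d, (j : ℕ) < i → ‖F^[m] (EuclideanSpace.single j 1)‖ ≤ ‖vecAt d t 5‖) ∧
        ∃ j, vecAt d t 5 = F^[m] (EuclideanSpace.single j 1)) ∨
      (t.mem 9 0 0 0 = 0 ∧ vecAt d t 5 = vecAt d s' 5 ∧
        ∀ j : Fin d, (j : ℕ) < i → F^[m] (EuclideanSpace.single j 1) = 0))) d ?_ ?_
  · have he : progPower.exec s = loopState body.exec 4 s' d := by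
      have : s'.reg 0 = d := by rw [ha.reg 0 (by omega), h0]
      rw [← this]
      rfl
    rw [he]
    obtain ⟨k1, k2, k3, k4⟩ := key
    refine ⟨k1, k2, k3, ?_⟩
    rcases k4 with ⟨-, n0, n1, n2⟩ | ⟨-, n1, n2⟩
    · exact ⟨fun j => n1 j j.2, Or.inl ⟨n0, n2⟩⟩
    · refine ⟨fun j => by rw [n2 j j.2]; simp, Or.inr ⟨fun j => n2 j j.2, fun i => ?_⟩⟩
      rw [n1]
      simp [vecAt, s', Prog.exec, State.setMem, RExpr.eval, IExpr.eval, h5]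
  · exact ⟨ha.reg, fun A hA => ha.mem A (by omega), ha.mem 7 (by omega),
      Or.inr ⟨by rw [ha.mem 9 (by omega), h9], rfl, fun j hj => absurd hj (by omega)⟩⟩
  · rintro i hi t ⟨k1, k2, k3, k4⟩
    set t0 := t.setReg 4 i
    obtain ⟨a1, a2⟩ := progBasis_spec (d := d) t0 (by simp [t0, k1, h0]) ⟨i, hi⟩ (by simp [t0])
    set t1 := progBasis.exec t0
    have r1 : ∀ a < 4, t1.reg a = s.reg a := fun a ha => by
      rw [a1.reg a (by omega), reg_setReg, if_neg (by omega), k1 a ha]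
    obtain ⟨b1, b2, b3⟩ := progIterate_spec (d := d) (m := m) t1 (by rw [r1 0 (by omega), h0])
      (by rw [r1 3 (by omega), h3])
    set t2 := progIterate.exec t1
    have r2 : ∀ a < 4, t2.reg a = s.reg a := fun a ha => by rw [b1 a (by omega), r1 a ha]
    obtain ⟨c1, c2⟩ := progNorm_spec (d := d) t2 (by rw [r2 0 (by omega), h0])
    set t3 := progNorm.exec t2
    have r3 : ∀ a < 4, t3.reg a = s.reg a := fun a ha => by rw [c1.reg a (by omega), r2 a ha]
    obtain ⟨d1, d2, d3⟩ := progRecord_spec (d := d) t3 (by rw [r3 0 (by omega), h0])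
    have he : body.exec t0 = progRecord.exec t3 := rfl
    rw [he]
    have m3 : ∀ A, A ≠ 6 → A ≠ 8 → A ≠ 10 → t3.mem A = t.mem A := fun A x6 x8 x10 => by
      rw [c1.mem A x8, b2 A x6 x10, a1.mem A x10, mem_setReg]
    have hw : vecAt d t3 10 = F^[m] (EuclideanSpace.single ⟨i, hi⟩ 1) := by
      rw [vecAt_congr (c1.mem 10 (by omega)), b3, a2, opAt_congr (a1.mem 4 (by omega)), hF,
        opAt_congr (t := t0) (s := s) (k2 4 (by omega))]
    have h8 : t3.mem 8 0 0 0 = ‖vecAt d t3 10‖ ^ 2 := by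
      rw [c2, vecAt_congr (c1.mem 10 (by omega))]
    have h9' : t3.mem 9 = t.mem 9 := m3 9 (by omega) (by omega) (by omega)
    have h5' : vecAt d t3 5 = vecAt d t 5 := vecAt_congr (m3 5 (by omega) (by omega) (by omega))
    refine ⟨fun a ha => by rw [d1 a (by omega), r3 a ha], fun A hA => by
      rcases eq_or_ne A 5 with rfl | h
      · omega
      · rw [d2 A h (by omega), m3 A (by omega) (by omega) (by omega), k2 A hA], by
      rw [d2 7 (by omega) (by omega), m3 7 (by omega) (by omega) (by omega), k3], ?_⟩
    rcases d3 with ⟨e1, e2, e3⟩ | ⟨e1, e2⟩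
    · left
      rw [h9'] at e1
      have hpos : 0 < t3.mem 8 0 0 0 := by
        refine lt_of_le_of_lt ?_ e1
        rcases k4 with ⟨x, -⟩ | ⟨x, -⟩ <;> rw [x]
        positivity
      rw [e2, e3]
      refine ⟨h8, ?_, fun j hj => ?_, ⟨i, hi⟩, hw⟩
      · intro h
        rw [h8, h] at hpos
        simp at hpos
      · rcases Nat.lt_succ_iff_lt_or_eq.1 hj with hj | hj
        · rcases k4 with ⟨x, -, y, -⟩ | ⟨-, -, y⟩
          · refine (y j hj).trans (le_of_lt (lt_of_pow_lt_pow_left₀ 2 (norm_nonneg _) ?_))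
            rwa [← x, ← h8]
          · rw [y j hj]; simp
        · have : j = ⟨i, hi⟩ := Fin.ext hj
          rw [this, hw]
    · rw [e2, h9', h5']
      rw [h9', h8, hw] at e1
      rcases k4 with ⟨x, x', y, z⟩ | ⟨x, x', y⟩
      · refine Or.inl ⟨x, x', fun j hj => ?_, z⟩
        rcases Nat.lt_succ_iff_lt_or_eq.1 hj with hj | hj
        · exact y j hj
        · have : j = ⟨i, hi⟩ := Fin.ext hj
          rw [this]
          rw [x] at e1
          exact le_of_pow_le_pow_left₀ two_ne_zero (norm_nonneg _) e1
      · refine Or.inr ⟨x, x', fun j hj => ?_⟩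
        rcases Nat.lt_succ_iff_lt_or_eq.1 hj with hj | hj
        · exact y j hj
        · have : j = ⟨i, hi⟩ := Fin.ext hj
          rw [this, ← norm_eq_zero, ← sq_eq_zero_iff]
          rw [x] at e1
          exact le_antisymm e1 (sq_nonneg _)

theorem progSolve_spec {d m : ℕ} (s : State) (h0 : s.reg 0 = d) (h3 : s.reg 3 = m) :
    vecAt d (progSolve.exec s) 1 =
      (richardson (opAt d s 2) (s.mem 7 0 0 0) (vecAt d s 5))^[m] (vecAt d s 1) := by
  set body : Prog := .seq (matVec 5 2 1 6)
    (.forLoop 5 (.reg 0) (.setReal 1 .zero .zero (.reg 5) (.add (.cell 1 .zero .zero (.reg 5))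
      (.div (.sub (.entry 5 (.reg 5)) (.entry 6 (.reg 5))) (.cell 7 .zero .zero .zero))))) with hbody
  have key := loopState_induction (f := body.exec) (a := 4) (s := s) (fun i t =>
    (∀ a < 4, t.reg a = s.reg a) ∧ (∀ A, A ≠ 1 → A ≠ 6 → t.mem A = s.mem A) ∧
    vecAt d t 1 = (richardson (opAt d s 2) (s.mem 7 0 0 0) (vecAt d s 5))^[i] (vecAt d s 1)) m
    ⟨fun _ _ => rfl, fun _ _ _ => rfl, rfl⟩ ?_
  · have he : progSolve.exec s = loopState body.exec 4 s m := by
      rw [← h3]; rfl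
    rw [he]
    exact key.2.2
  rintro i - t ⟨k1, k2, k3⟩
  set t0 := t.setReg 4 i
  have r0 : ∀ a < 4, t0.reg a = s.reg a := fun a ha => by
    simp only [t0]; rw [reg_setReg, if_neg (by omega), k1 a ha]
  obtain ⟨a1, a2⟩ := matVec_spec (d := d) (c := 5) (A := 2) (w := 1) (y := 6) (by omega) (by omega)
    (by omega) t0 (by rw [r0 0 (by omega), h0])
  set t1 := (matVec 5 2 1 6).exec t0
  have r1 : ∀ a < 4, t1.reg a = s.reg a := fun a ha => by rw [a1.reg a (by omega), r0 a ha]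
  have hadd := (Adds.assign 6 1 .zero .zero (.reg 5)
    (.div (.sub (.entry 5 (.reg 5)) (.entry 6 (.reg 5))) (.cell 7 .zero .zero .zero))
    (fun s t h => by
      simp [IExpr.eval, RExpr.eval, h.reg, h.mem])).loop (n := 0) (by omega)
  refine ⟨fun a ha => ((hadd.agree t1).reg a (by omega)).trans (r1 a ha), fun A x1 x6 =>
    ((hadd.agree t1).mem A x1).trans ((a1.mem A x6).trans (k2 A x1 x6)), ?_⟩
  rw [Function.iterate_succ_apply', ← k3]
  ext a
  refine (hadd.add t1 0 0 a).trans ?_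
  have m1 : ∀ A, A ≠ 1 → A ≠ 6 → t1.mem A = s.mem A := fun A x1 x6 =>
    (a1.mem A x6).trans (k2 A x1 x6)
  have e6 : t1.mem 6 0 0 a = opAt d s 2 (vecAt d t 1) a := by
    have : vecAt d t1 6 a = opAt d t0 2 (vecAt d t0 1) a := by rw [a2]
    rw [opAt_congr (t := t0) (s := s) (k2 2 (by omega) (by omega))] at this
    exact this
  have e1 : t1.mem 1 = t.mem 1 := a1.mem 1 (by omega)
  simp only [IExpr.eval, RExpr.eval, reg_setReg, mem_setReg, r1 0 (by omega), h0, if_true,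
    true_and, m1 5 (by omega) (by omega), m1 7 (by omega) (by omega), e1]
  rw [Finset.sum_eq_single (a : ℕ)]
  · simp only [if_true, e6]
    simp [richardson, vecAt, div_eq_inv_mul]
  · intro x _ hx; simp [hx.symm]
  · intro h; exact absurd (Finset.mem_range.2 a.2) h

theorem progRhs_spec {d q k m : ℕ} (s : State) (h0 : s.reg 0 = d) (h1 : s.reg 1 = q)
    (h2 : s.reg 2 = k) (h3 : s.reg 3 = m) (h5 : s.mem 5 = 0) (h9 : s.mem 9 0 0 0 = 0) :
    (∀ a < 4, (progRhs.exec s).reg a = s.reg a) ∧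
    (∀ A < 5, (progRhs.exec s).mem A = s.mem A) ∧ (progRhs.exec s).mem 7 = s.mem 7 ∧
    (2 * k ≠ q → ∀ a : Fin d, vecAt d (progRhs.exec s) 5 a =
      ∑ i ∈ Finset.range m, ((2 * k - q : ℝ)) * s.mem 3 i 0 a) ∧
    (2 * k = q → IsPowerVec (opAt d s 4) m (vecAt d (progRhs.exec s) 5)) := by
  by_cases hk : 2 * k = q
  · have he : progRhs.exec s = progPower.exec s := by
      simp [progRhs, Prog.exec, Test.holds, IExpr.eval, h1, h2, show ¬ k + k < q by omega,
        show ¬ q < k + k by omega]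
    rw [he]
    obtain ⟨p1, p2, p3, p4⟩ := progPower_spec s h0 h3 h5 h9
    exact ⟨p1, p2, p3, fun h => absurd hk h, fun _ => p4⟩
  · have he : progRhs.exec s = progMean.exec s := by
      by_cases hk' : k + k < q
      · simp [progRhs, Prog.exec, Test.holds, IExpr.eval, h1, h2, hk']
      · simp [progRhs, Prog.exec, Test.holds, IExpr.eval, h1, h2, hk',
          show q < k + k by omega]
    rw [he]
    obtain ⟨p1, p2⟩ := progMean_spec s h0 h1 h2 h3
    refine ⟨p1.reg, fun A hA => p1.mem A (by omega), p1.mem 7 (by omega), fun _ a => ?_,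
      fun h => absurd h hk⟩
    simp only [vecAt]
    rw [p2 a a.2, h5]
    simp

/-- The algorithm computes the `m`-th Richardson iterate for the Gram operator of all vectors. -/
theorem exists_rhs_output {d q k m : ℕ} (B : Fin m → Fin q → Vec d) :
    ∃ v, IsRhs k B v ∧ output learner k B =
      (richardson (gramOp (allVecs B)) (∑ p, ‖allVecs B p‖ ^ 2) v)^[m] 0 := by
  set s := inputState d q k m B with hs
  have r0 : s.reg 0 = d := rfl
  have r1 : s.reg 1 = q := rfl
  have r2 : s.reg 2 = k := rfl
  have r3 : s.reg 3 = m := rfl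
  have hX : ∀ (i : Fin m) (j : Fin q) (l : Fin d), s.mem 0 i j l = B i j l := fun i j l => by
    simp [s, inputState]
  have hZ : ∀ A, A ≠ 0 → s.mem A = 0 := fun A hA => by
    funext i j l; simp [s, inputState, hA]
  obtain ⟨a1, a2⟩ := progSums_spec s r0 r1 r3
  set s1 := progSums.exec s
  obtain ⟨b1, b2⟩ := progGram_spec (d := d) (q := q) (m := m) s1 (a1.reg 0 (by omega))
    (a1.reg 1 (by omega)) (a1.reg 3 (by omega))
  set s2 := progGram.exec s1
  have ab : ∀ a < 4, s2.reg a = s.reg a := fun a ha => (b1.reg a ha).trans (a1.reg a ha)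
  obtain ⟨c1, c2⟩ := progCopy_spec (d := d) s2 (ab 0 (by omega))
  set s3 := progCopy.exec s2
  have ac : ∀ a < 4, s3.reg a = s.reg a := fun a ha => (c1.reg a ha).trans (ab a ha)
  obtain ⟨d1, d2⟩ := progDiff_spec (d := d) (m := m) s3 (ac 0 (by omega)) (ac 3 (by omega))
  set s4 := progDiff.exec s3
  have ad : ∀ a < 4, s4.reg a = s.reg a := fun a ha => (d1.reg a ha).trans (ac a ha)
  obtain ⟨e1, e2⟩ := progTrace_spec (d := d) s4 (ad 0 (by omega))
  set s5 := progTrace.exec s4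
  have ae : ∀ a < 4, s5.reg a = s.reg a := fun a ha => (e1.reg a ha).trans (ad a ha)
  have mz : ∀ A, A ≠ 0 → A ≠ 2 → A ≠ 3 → A ≠ 4 → A ≠ 7 → s5.mem A = 0 := by
    intro A x0 x2 x3 x4 x7
    rw [e1.mem A x7, d1.mem A x4, c1.mem A x4, b1.mem A x2, a1.mem A x3, hZ A x0]
  have m3 : s5.mem 3 = s1.mem 3 := by
    rw [e1.mem 3 (by omega), d1.mem 3 (by omega), c1.mem 3 (by omega), b1.mem 3 (by omega)]
  have hS : ∀ (i : Fin m) (l : Fin d), s1.mem 3 i 0 l = bagSum B i l := by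
    intro i l
    rw [a2 i i.2 l l.2, hZ 3 (by omega), Finset.sum_range]
    simp [hX, bagSum]
  have hG : ∀ a b : Fin d, s2.mem 2 0 a b = ∑ p, allVecs B p a * allVecs B p b := by
    intro a b
    rw [b2 a a.2 b b.2, a1.mem 2 (by omega), hZ 2 (by omega), a1.mem 0 (by omega),
      Finset.sum_range, Fintype.sum_prod_type]
    simp [Finset.sum_range, hX, allVecs]
  have m2 : s5.mem 2 = s2.mem 2 := by
    rw [e1.mem 2 (by omega), d1.mem 2 (by omega), c1.mem 2 (by omega)]
  have hM : ∀ a b : Fin d, s5.mem 4 0 a b =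
      ∑ p, allVecs B p a * allVecs B p b - ∑ i, bagSum B i a * bagSum B i b := by
    intro a b
    rw [e1.mem 4 (by omega), d2 a a.2 b b.2, c2 a a.2 b b.2, hG, b1.mem 4 (by omega),
      a1.mem 4 (by omega), hZ 4 (by omega), Finset.sum_range, c1.mem 3 (by omega),
      b1.mem 3 (by omega)]
    simp [hS]
  have inner_eq : ∀ x y : Vec d, inner ℝ x y = ∑ b, x b * y b := by
    intro x y
    rw [PiLp.inner_apply]
    exact Finset.sum_congr rfl fun b _ => by simp [mul_comm]
  have op2 : opAt d s5 2 = gramOp (allVecs B) := by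
    funext x
    ext a
    rw [gramOp_apply]
    simp only [opAt, m2, hG, Finset.sum_mul, inner_eq, WithLp.ofLp_sum, Finset.sum_apply,
      WithLp.ofLp_smul, Pi.smul_apply, smul_eq_mul]
    rw [Finset.sum_comm]
    exact Finset.sum_congr rfl fun i _ => Finset.sum_congr rfl fun b _ => by ring
  have op4 : opAt d s5 4 = diffOp B := by
    funext x
    ext a
    rw [diffOp, LinearMap.sub_apply, gramOp_apply, gramOp_apply]
    simp only [opAt, hM, Finset.sum_mul, inner_eq, WithLp.ofLp_sum, Finset.sum_apply,
      WithLp.ofLp_smul, Pi.smul_apply, smul_eq_mul, sub_mul, Finset.sum_sub_distrib,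
      WithLp.ofLp_sub, Pi.sub_apply]
    congr 1 <;> rw [Finset.sum_comm] <;>
      exact Finset.sum_congr rfl fun i _ => Finset.sum_congr rfl fun b _ => by ring
  have htr : s5.mem 7 0 0 0 = ∑ p, ‖allVecs B p‖ ^ 2 := by
    rw [e2, d1.mem 7 (by omega), c1.mem 7 (by omega), b1.mem 7 (by omega), a1.mem 7 (by omega),
      hZ 7 (by omega), d1.mem 2 (by omega), c1.mem 2 (by omega), Finset.sum_range]
    simp only [hG, EuclideanSpace.norm_sq_eq]
    rw [Finset.sum_comm]
    simp [sq]
  obtain ⟨f1, f2, f3, f4, f5⟩ := progRhs_spec (d := d) (q := q) (k := k) (m := m) s5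
    (ae 0 (by omega)) (ae 1 (by omega)) (ae 2 (by omega)) (ae 3 (by omega))
    (mz 5 (by omega) (by omega) (by omega) (by omega) (by omega))
    (by rw [mz 9 (by omega) (by omega) (by omega) (by omega) (by omega)]; rfl)
  set s6 := progRhs.exec s5
  refine ⟨vecAt d s6 5, ⟨fun hk => ?_, fun hk => ?_⟩, ?_⟩
  · ext a
    rw [f4 hk a, Finset.sum_range]
    simp [m3, hS, Finset.mul_sum]
  · rw [← op4]; exact f5 hk
  · have h := progSolve_spec (d := d) (m := m) s6 ((f1 0 (by omega)).trans (ae 0 (by omega)))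
      ((f1 3 (by omega)).trans (ae 3 (by omega)))
    rw [opAt_congr (s := s5) (f2 2 (by omega)), op2, f3, htr] at h
    have h1 : vecAt d s6 1 = 0 := by
      ext a
      simp [vecAt, f2 1 (by omega), mz 1 (by omega) (by omega) (by omega) (by omega) (by omega)]
    rw [h1] at h
    exact h

/-! ### Richardson iteration and the power method -/

section Operators

variable {d : ℕ}

theorem inner_gramOp {ι : Type*} [Fintype ι] (X : ι → Vec d) (x y : Vec d) :
    inner ℝ (gramOp X x) y = ∑ i, inner ℝ (X i) x * inner ℝ (X i) y := by
  rw [gramOp_apply, sum_inner]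
  exact Finset.sum_congr rfl fun i _ => by rw [real_inner_smul_left]

theorem gramOp_isSymmetric {ι : Type*} [Fintype ι] (X : ι → Vec d) : (gramOp X).IsSymmetric := by
  intro x y
  rw [real_inner_comm (gramOp X y) x, inner_gramOp, inner_gramOp]
  exact Finset.sum_congr rfl fun i _ => mul_comm _ _

/-- The Gram operator is bounded by its trace, in the form needed for Richardson iteration. -/
theorem norm_gramOp_sq_le {ι : Type*} [Fintype ι] (X : ι → Vec d) (x : Vec d) :
    ‖gramOp X x‖ ^ 2 ≤ (∑ i, ‖X i‖ ^ 2) * inner ℝ (gramOp X x) x := by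
  have h1 : ‖gramOp X x‖ ≤ ∑ i, |inner ℝ (X i) x| * ‖X i‖ := by
    rw [gramOp_apply]
    refine (norm_sum_le _ _).trans (Finset.sum_le_sum fun i _ => ?_)
    rw [norm_smul, Real.norm_eq_abs]
  calc ‖gramOp X x‖ ^ 2 ≤ (∑ i, |inner ℝ (X i) x| * ‖X i‖) ^ 2 := by gcongr
    _ ≤ (∑ i, |inner ℝ (X i) x| ^ 2) * ∑ i, ‖X i‖ ^ 2 := Finset.sum_mul_sq_le_sq_mul_sq _ _ _
    _ = _ := by
      rw [mul_comm, inner_gramOp]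
      congr 1
      exact Finset.sum_congr rfl fun i _ => by rw [sq_abs, sq]

/-- A Richardson step contracts: the operator `1 - G / τ` has norm below `1`. -/
theorem norm_sub_smul_le (G : Vec d →ₗ[ℝ] Vec d) {τ l : ℝ} (hτ : 0 < τ) (hl : 0 ≤ l)
    (hG : ∀ x, ‖G x‖ ^ 2 ≤ τ * inner ℝ (G x) x) (hGl : ∀ x, l * ‖x‖ ^ 2 ≤ inner ℝ (G x) x)
    (x : Vec d) : ‖x - τ⁻¹ • G x‖ ≤ (1 - l / (2 * τ)) * ‖x‖ := by
  rcases eq_or_ne x 0 with rfl | hx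
  · simp
  have hx' : 0 < ‖x‖ ^ 2 := by positivity
  have key : ‖x - τ⁻¹ • G x‖ ^ 2 ≤ (1 - l / τ) * ‖x‖ ^ 2 := by
    rw [norm_sub_sq_real, real_inner_smul_right, norm_smul, mul_pow, Real.norm_eq_abs, sq_abs,
      real_inner_comm]
    have h1 : τ⁻¹ ^ 2 * ‖G x‖ ^ 2 ≤ τ⁻¹ * inner ℝ (G x) x := by
      calc τ⁻¹ ^ 2 * ‖G x‖ ^ 2 ≤ τ⁻¹ ^ 2 * (τ * inner ℝ (G x) x) := by gcongr; exact hG x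
        _ = _ := by field_simp
    have h2 : τ⁻¹ * (l * ‖x‖ ^ 2) ≤ τ⁻¹ * inner ℝ (G x) x := by gcongr; exact hGl x
    have h3 : τ⁻¹ * (l * ‖x‖ ^ 2) = l / τ * ‖x‖ ^ 2 := by ring
    nlinarith
  have hle : 0 ≤ 1 - l / τ := by
    by_contra h
    nlinarith [sq_nonneg ‖x - τ⁻¹ • G x‖, mul_pos (neg_pos.2 (not_le.1 h)) hx']
  have hy : l / (2 * τ) = (l / τ) / 2 := by ring
  have hy0 : 0 ≤ l / τ := by positivity
  rw [hy]
  refine le_of_pow_le_pow_left₀ two_ne_zero (mul_nonneg (by linarith) (norm_nonneg _))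
    (key.trans ?_)
  rw [mul_pow]
  gcongr
  nlinarith [sq_nonneg (l / τ)]

/-- Error bound for Richardson iteration, in terms of the residual of the reference vector
`ρ`. -/
theorem norm_richardson_sub_le (G : Vec d →ₗ[ℝ] Vec d) {τ l : ℝ} (hτ : 0 < τ) (hl : 0 < l)
    (hG : ∀ x, ‖G x‖ ^ 2 ≤ τ * inner ℝ (G x) x) (hGl : ∀ x, l * ‖x‖ ^ 2 ≤ inner ℝ (G x) x)
    (v ρ : Vec d) (t : ℕ) :
    ‖(richardson G τ v)^[t] 0 - ρ‖ ≤
      Real.exp (-(t * (l / (2 * τ)))) * ‖ρ‖ + 2 * ‖v - G ρ‖ / l := by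
  rcases eq_or_ne d 0 with rfl | hd
  · rw [Subsingleton.elim ((richardson G τ v)^[t] 0 - ρ) 0, norm_zero]
    positivity
  have hy : l / (2 * τ) ≤ 1 := by
    have : NeZero d := ⟨hd⟩
    have h := norm_sub_smul_le G hτ hl.le hG hGl (EuclideanSpace.single 0 1)
    have h0 := norm_nonneg ((EuclideanSpace.single 0 1 : Vec d) - τ⁻¹ • G (EuclideanSpace.single 0 1))
    simp only [PiLp.norm_single, norm_one, mul_one] at h
    linarith
  set y := l / (2 * τ) with hydef
  have hy0 : 0 < y := by positivity
  have key : ∀ t, ‖(richardson G τ v)^[t] 0 - ρ‖ ≤ (1 - y) ^ t * ‖ρ‖ + 2 * ‖v - G ρ‖ / l := by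
    intro t
    induction t with
    | zero => simp; positivity
    | succ t ih =>
      rw [Function.iterate_succ_apply']
      set r := (richardson G τ v)^[t] 0
      have e : richardson G τ v r - ρ = (r - ρ - τ⁻¹ • G (r - ρ)) + τ⁻¹ • (v - G ρ) := by
        simp only [richardson, map_sub, smul_sub]
        abel
      rw [e]
      refine (norm_add_le _ _).trans ?_
      have h1 := norm_sub_smul_le G hτ hl.le hG hGl (r - ρ)
      have h2 : ‖τ⁻¹ • (v - G ρ)‖ = y * (2 * ‖v - G ρ‖ / l) := by
        rw [norm_smul, norm_inv, Real.norm_of_nonneg hτ.le, hydef]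
        field_simp
      have h3 := mul_le_mul_of_nonneg_left ih (sub_nonneg.2 hy)
      rw [h2, pow_succ]
      nlinarith
  refine (key t).trans ?_
  gcongr
  calc (1 - y) ^ t ≤ (Real.exp (-y)) ^ t := by
        refine pow_le_pow_left₀ (by linarith) ?_ t
        linarith [Real.add_one_le_exp (-y)]
    _ = _ := by rw [← Real.exp_nat_mul]; congr 1; ring

theorem norm_sub_inner_smul_sq (p x : Vec d) (hp : ‖p‖ = 1) :
    ‖x - (inner ℝ p x : ℝ) • p‖ ^ 2 = ‖x‖ ^ 2 - (inner ℝ p x : ℝ) ^ 2 := by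
  rw [norm_sub_sq_real, real_inner_smul_right, norm_smul, hp, real_inner_comm, Real.norm_eq_abs,
    mul_one, sq_abs]
  ring

/-- A perturbation of a rank one projection has an eigenvector close to its range, and it is
small on the orthogonal complement of that eigenvector. -/
theorem exists_top_eigenvector (A : Vec d →ₗ[ℝ] Vec d) (hA : A.IsSymmetric) (p : Vec d)
    (hp : ‖p‖ = 1) {γ e : ℝ} (hγ : 0 < γ) (he : 0 ≤ e) (he' : e ≤ 1 / 10)
    (h : ∀ x, ‖A x - (γ * inner ℝ p x) • p‖ ≤ e * γ * ‖x‖) :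
    ∃ (lam : ℝ) (u : Vec d), ‖u‖ = 1 ∧ A u = lam • u ∧ 3 * (γ / 4) ≤ lam ∧ ‖u - p‖ ≤ 4 * e ∧
      ∀ x, inner ℝ u x = 0 → ‖A x‖ ≤ γ / 4 * ‖x‖ := by
  have hp0 : p ≠ 0 := fun h0 => by simp [h0] at hp
  have : Nontrivial (Vec d) := ⟨p, 0, hp0⟩
  have hE := hA.hasEigenvalue_iSup_of_finiteDimensional
  set lam : ℝ := ⨆ x : { x : Vec d // x ≠ 0 }, RCLike.re (inner ℝ (A x) (x : Vec d)) / ‖(x : Vec d)‖ ^ 2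
    with hlam
  have hform : ∀ x, |inner ℝ (A x) x - γ * (inner ℝ p x : ℝ) ^ 2| ≤ e * γ * ‖x‖ ^ 2 := by
    intro x
    have h1 : inner ℝ (A x) x - γ * (inner ℝ p x : ℝ) ^ 2 =
        inner ℝ (A x - (γ * inner ℝ p x) • p) x := by
      rw [inner_sub_left, real_inner_smul_left]; ring
    rw [h1]
    refine (abs_real_inner_le_norm _ _).trans ?_
    have := mul_le_mul_of_nonneg_right (h x) (norm_nonneg x)
    nlinarith
  have hbdd : BddAbove (Set.range fun x : { x : Vec d // x ≠ 0 } =>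
      RCLike.re (inner ℝ (A x) (x : Vec d)) / ‖(x : Vec d)‖ ^ 2) := by
    refine ⟨γ + e * γ, ?_⟩
    rintro _ ⟨⟨x, hx⟩, rfl⟩
    have hx' : 0 < ‖x‖ ^ 2 := by positivity
    simp only [RCLike.re_to_real]
    rw [div_le_iff₀ hx']
    have h1 := (abs_le.1 (hform x)).2
    have h2 : (inner ℝ p x : ℝ) ^ 2 ≤ ‖x‖ ^ 2 := by
      have := norm_sub_inner_smul_sq p x hp
      nlinarith [sq_nonneg ‖x - (inner ℝ p x : ℝ) • p‖]
    nlinarith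
  have hlam_ge : (1 - e) * γ ≤ lam := by
    refine le_trans ?_ (le_ciSup hbdd ⟨p, hp0⟩)
    simp only [RCLike.re_to_real, hp]
    have h1 := (abs_le.1 (hform p)).1
    rw [real_inner_self_eq_norm_sq, hp] at h1
    norm_num at h1 ⊢
    linarith
  have hlam_pos : 9 / 10 * γ ≤ lam := le_trans (by nlinarith) hlam_ge
  -- a unit eigenvector with the sign that makes its inner product with `p` nonnegative
  obtain ⟨u, hu1, hAu, hc⟩ : ∃ u, ‖u‖ = 1 ∧ A u = lam • u ∧ 0 ≤ (inner ℝ p u : ℝ) := by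
    obtain ⟨w, hw⟩ := hE.exists_hasEigenvector
    have hw0 : ‖w‖ ≠ 0 := by simpa using hw.2
    have hAw : A w = lam • w := hw.apply_eq_smul
    have hn : ‖(‖w‖⁻¹ : ℝ) • w‖ = 1 := by
      rw [norm_smul, norm_inv, norm_norm, inv_mul_cancel₀ hw0]
    have hAn : A ((‖w‖⁻¹ : ℝ) • w) = lam • ((‖w‖⁻¹ : ℝ) • w) := by
      rw [map_smul, hAw, smul_comm]
    rcases le_total 0 (inner ℝ p ((‖w‖⁻¹ : ℝ) • w) : ℝ) with h0 | h0
    · exact ⟨_, hn, hAn, h0⟩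
    · refine ⟨-((‖w‖⁻¹ : ℝ) • w), by rwa [norm_neg], by rw [map_neg, hAn, smul_neg], ?_⟩
      rw [inner_neg_right]; linarith
  set c : ℝ := inner ℝ p u with hcdef
  have hs : ‖u - c • p‖ ^ 2 = 1 - c ^ 2 := by
    rw [hcdef, norm_sub_inner_smul_sq p u hp, hu1, one_pow]
  have hs' : ‖p - c • u‖ ^ 2 = 1 - c ^ 2 := by
    have := norm_sub_inner_smul_sq u p hu1
    rw [real_inner_comm, hp] at this
    rw [this, one_pow]
  have hse : ‖u - c • p‖ ≤ 10 / 9 * e := by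
    have h1 : lam • (u - c • p) = (A u - (γ * c) • p) -
        (inner ℝ p (A u - (γ * c) • p) : ℝ) • p := by
      rw [inner_sub_right, real_inner_smul_right, real_inner_self_eq_norm_sq, hp, hAu,
        real_inner_smul_right, ← hcdef]
      module
    have h2 : ‖lam • (u - c • p)‖ ≤ ‖A u - (γ * c) • p‖ := by
      rw [h1]
      refine le_of_pow_le_pow_left₀ two_ne_zero (norm_nonneg _) ?_
      rw [norm_sub_inner_smul_sq p _ hp]
      nlinarith [sq_nonneg (inner ℝ p (A u - (γ * c) • p) : ℝ)]
    have h3 := h2.trans (h u)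
    rw [norm_smul, Real.norm_of_nonneg (by nlinarith), hu1, mul_one] at h3
    have h4 : 9 / 10 * γ * ‖u - c • p‖ ≤ e * γ :=
      (mul_le_mul_of_nonneg_right hlam_pos (norm_nonneg _)).trans h3
    have h5 : γ * (9 / 10 * ‖u - c • p‖) ≤ γ * e := by linarith
    linarith [le_of_mul_le_mul_left h5 hγ]
  have heq : ‖p - c • u‖ = ‖u - c • p‖ :=
    (pow_left_inj₀ (norm_nonneg _) (norm_nonneg _) two_ne_zero).1 (hs'.trans hs.symm)
  have hc1 : c ≤ 1 := by nlinarith [sq_nonneg ‖u - c • p‖]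
  refine ⟨lam, u, hu1, hAu, by linarith, ?_, fun x hx => ?_⟩
  · have h1 : u - p = (u - c • p) - (1 - c) • p := by module
    have h2 : ‖u - p‖ ≤ ‖u - c • p‖ + (1 - c) := by
      rw [h1]
      refine (norm_sub_le _ _).trans ?_
      rw [norm_smul, hp, Real.norm_of_nonneg (by linarith), mul_one]
    have h3 : 1 - c ≤ ‖u - c • p‖ ^ 2 := by rw [hs]; nlinarith
    nlinarith [norm_nonneg (u - c • p)]
  · have h1 : (inner ℝ p x : ℝ) = inner ℝ (p - c • u) x := by
      rw [inner_sub_left, real_inner_smul_left, hx]; ring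
    have h2 : |(inner ℝ p x : ℝ)| ≤ 10 / 9 * e * ‖x‖ := by
      rw [h1]
      refine (abs_real_inner_le_norm _ _).trans ?_
      rw [heq]
      gcongr
    have h3 : ‖A x‖ ≤ e * γ * ‖x‖ + γ * |(inner ℝ p x : ℝ)| := by
      have : A x = (A x - (γ * inner ℝ p x) • p) + (γ * inner ℝ p x) • p := by abel
      rw [this]
      refine (norm_add_le _ _).trans (add_le_add (h x) ?_)
      rw [norm_smul, hp, Real.norm_eq_abs, abs_mul, abs_of_pos hγ, mul_one]
    have h4 := mul_le_mul_of_nonneg_left h2 hγ.le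
    have h5 : e * (γ * ‖x‖) ≤ 1 / 10 * (γ * ‖x‖) := by gcongr
    nlinarith [mul_nonneg hγ.le (norm_nonneg x)]

/-- The longest of the vectors `A ^ m e`, `e` in the standard basis, is close to a multiple of
`p` if `A` is close to a multiple of the projection on `p`. Some `e` has an inner product of at
least `d ^ (-1/2)` with the top eigenvector. -/
theorem IsPowerVec.exists_near {A : Vec d →ₗ[ℝ] Vec d} (hA : A.IsSymmetric) {p : Vec d}
    (hp : ‖p‖ = 1) {γ e : ℝ} (hγ : 0 < γ) (he : 0 ≤ e) (he' : e ≤ 1 / 10)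
    (h : ∀ x, ‖A x - (γ * inner ℝ p x) • p‖ ≤ e * γ * ‖x‖) {m : ℕ}
    (hm : 2 * Real.sqrt d ≤ 3 ^ m) {v : Vec d} (hv : IsPowerVec A m v) :
    ∃ a : ℝ, a ≠ 0 ∧ ‖v - a • p‖ ≤ (4 * e + 2 * Real.sqrt d / 3 ^ m) * |a| := by
  obtain ⟨lam, u, hu1, hAu, hlam, hup, hperp⟩ := exists_top_eigenvector A hA p hp hγ he he' h
  have hlam0 : 0 < lam := by linarith
  have hiter : ∀ x : Vec d, inner ℝ u x = 0 → ∀ t : ℕ,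
      inner ℝ u (A^[t] x) = 0 ∧ ‖A^[t] x‖ ≤ (γ / 4) ^ t * ‖x‖ := by
    intro x hx t
    induction t with
    | zero => simp [hx]
    | succ t ih =>
      rw [Function.iterate_succ_apply']
      refine ⟨?_, (hperp _ ih.1).trans ?_⟩
      · rw [← hA, hAu, real_inner_smul_left, ih.1, mul_zero]
      · rw [pow_succ']
        have := mul_le_mul_of_nonneg_left ih.2 (show 0 ≤ γ / 4 by positivity)
        linarith
  have hdec : ∀ x : Vec d, A^[m] x = (lam ^ m * inner ℝ u x) • u +
      A^[m] (x - (inner ℝ u x : ℝ) • u) := by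
    intro x
    have hit : ∀ (y : Vec d), A^[m] y = (A ^ m) y := fun y => (Module.End.pow_apply A m y).symm
    have hpow : ∀ t : ℕ, (A ^ t) u = lam ^ t • u := by
      intro t
      induction t with
      | zero => simp
      | succ t ih => rw [pow_succ', Module.End.mul_apply, ih, map_smul, hAu, smul_smul, pow_succ]
    rw [hit, hit, map_sub, map_smul, hpow, smul_smul, mul_comm]
    abel
  have hortho : ∀ x : Vec d, inner ℝ u (x - (inner ℝ u x : ℝ) • u) = 0 := by
    intro x
    rw [inner_sub_right, real_inner_smul_right, real_inner_self_eq_norm_sq, hu1]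
    ring
  have hinner : ∀ x : Vec d, inner ℝ u (A^[m] x) = lam ^ m * inner ℝ u x := by
    intro x
    rw [hdec x, inner_add_right, real_inner_smul_right, real_inner_self_eq_norm_sq, hu1,
      (hiter _ (hortho x) m).1]
    ring
  have hcoord : ∀ j, (inner ℝ u (EuclideanSpace.single j (1 : ℝ)) : ℝ) = u j := by
    intro j
    rw [EuclideanSpace.inner_single_right]; simp
  -- the length of the longest vector
  have hlen : lam ^ m ≤ Real.sqrt d * ‖v‖ := by
    have h1 : ∀ j : Fin d, (lam ^ m * u j) ^ 2 ≤ ‖v‖ ^ 2 := by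
      intro j
      have h2 : |lam ^ m * u j| ≤ ‖v‖ := by
        rw [← hcoord, ← hinner]
        refine ((abs_real_inner_le_norm _ _).trans ?_).trans (hv.1 j)
        rw [hu1, one_mul]
      rw [← sq_abs]
      gcongr
    have h3 := Finset.sum_le_sum fun j (_ : j ∈ Finset.univ) => h1 j
    have h4 : ∑ j, u j ^ 2 = 1 := by
      have := EuclideanSpace.norm_sq_eq u
      rw [hu1] at this
      simp only [Real.norm_eq_abs, sq_abs] at this
      rw [← this]; norm_num
    simp only [mul_pow, ← Finset.mul_sum, h4, Finset.sum_const, Finset.card_univ,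
      Fintype.card_fin, nsmul_eq_mul, mul_one] at h3
    refine le_of_pow_le_pow_left₀ two_ne_zero (by positivity) ?_
    rw [mul_pow, Real.sq_sqrt (Nat.cast_nonneg d)]
    exact h3
  have hd : 0 < d := by
    rcases Nat.eq_zero_or_pos d with rfl | hd
    · rw [Subsingleton.elim p 0, norm_zero] at hp
      norm_num at hp
    · exact hd
  have hsd : 0 < Real.sqrt d := Real.sqrt_pos.2 (by exact_mod_cast hd)
  have hv0 : v ≠ 0 := by
    rintro rfl
    rw [norm_zero, mul_zero] at hlen
    exact absurd hlen (not_le.2 (by positivity))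
  obtain ⟨j, hj⟩ : ∃ j, v = A^[m] (EuclideanSpace.single j 1) := by
    rcases hv.2 with ⟨-, hj⟩ | ⟨hz, -⟩
    · exact hj
    · exfalso
      have hz' : ∀ j, u j = 0 := by
        intro j
        have h1 := hinner (EuclideanSpace.single j 1)
        rw [hz j, inner_zero_right, hcoord] at h1
        rcases mul_eq_zero.1 h1.symm with h2 | h2
        · exact absurd h2 (by positivity)
        · exact h2
      have : u = 0 := by ext j; simpa using hz' j
      simp [this] at hu1
  set a : ℝ := lam ^ m * inner ℝ u (EuclideanSpace.single j (1 : ℝ)) with ha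
  set w := A^[m] (EuclideanSpace.single j (1 : ℝ) -
    (inner ℝ u (EuclideanSpace.single j (1 : ℝ)) : ℝ) • u) with hw
  have hva : v = a • u + w := by rw [hj]; exact hdec _
  set g := (γ / 4) ^ m with hg
  have hg0 : 0 < g := by positivity
  have hwn : ‖w‖ ≤ g := by
    refine ((hiter _ (hortho _) m).2).trans ?_
    have h1 : ‖EuclideanSpace.single j (1 : ℝ) -
        (inner ℝ u (EuclideanSpace.single j (1 : ℝ)) : ℝ) • u‖ ≤ 1 := by
      refine le_of_pow_le_pow_left₀ two_ne_zero zero_le_one ?_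
      rw [norm_sub_inner_smul_sq u _ hu1]
      simp only [PiLp.norm_single, norm_one]
      nlinarith [sq_nonneg (inner ℝ u (EuclideanSpace.single j (1 : ℝ)) : ℝ)]
    nlinarith
  have h3g : 3 ^ m * g ≤ lam ^ m := by
    rw [hg, ← mul_pow]
    exact pow_le_pow_left₀ (by positivity) hlam m
  have hvn : ‖v‖ ≤ |a| + g := by
    rw [hva]
    refine (norm_add_le _ _).trans (add_le_add ?_ hwn)
    rw [norm_smul, hu1, mul_one, Real.norm_eq_abs]
  have hag : g ≤ 2 * Real.sqrt d / 3 ^ m * |a| := by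
    have h3 : (0 : ℝ) < 3 ^ m := by positivity
    rw [div_mul_eq_mul_div, le_div_iff₀ h3]
    have h4 := mul_le_mul_of_nonneg_left hvn hsd.le
    nlinarith
  have ha0 : a ≠ 0 := by
    intro h0
    rw [h0, abs_zero, mul_zero] at hag
    linarith
  refine ⟨a, ha0, ?_⟩
  have h1 : v - a • p = a • (u - p) + w := by rw [hva, smul_sub]; abel
  rw [h1]
  refine (norm_add_le _ _).trans ?_
  rw [norm_smul, Real.norm_eq_abs]
  have := mul_le_mul_of_nonneg_left hup (abs_nonneg a)
  nlinarith

/-! ### Nets of the unit ball -/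

/-- `N` is a `1/2`-net of the unit ball. -/
def IsNet (N : Finset (Vec d)) : Prop :=
  (∀ n ∈ N, ‖n‖ ≤ 1) ∧ ∀ x : Vec d, ‖x‖ ≤ 1 → ∃ n ∈ N, ‖x - n‖ ≤ 1 / 2

/-- The unit ball of `ℝ^d` has a `1/2`-net with at most `5^d` points. -/
theorem exists_net (d : ℕ) : ∃ N : Finset (Vec d), N.card ≤ 5 ^ d ∧ IsNet N := by
  classical
  let Sep : Finset (Vec d) → Prop := fun N => (∀ n ∈ N, ‖n‖ ≤ 1) ∧
    ∀ a ∈ N, ∀ b ∈ N, a ≠ b → 1 / 2 ≤ ‖a - b‖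
  have hcard : ∀ N, Sep N → N.card ≤ 5 ^ d := by
    rintro N ⟨h1, h2⟩
    have hinj : Function.Injective fun x : Vec d => (2 : ℝ) • x := smul_right_injective _ two_ne_zero
    have h := Besicovitch.card_le_of_separated (N.image fun x : Vec d => (2 : ℝ) • x) ?_ ?_
    · rwa [Finset.card_image_of_injective _ hinj, finrank_euclideanSpace_fin] at h
    · intro c hc
      obtain ⟨x, hx, rfl⟩ := Finset.mem_image.1 hc
      rw [norm_smul]; norm_num; exact h1 x hx
    · intro c hc c' hc' hcc
      obtain ⟨x, hx, rfl⟩ := Finset.mem_image.1 hc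
      obtain ⟨y, hy, rfl⟩ := Finset.mem_image.1 hc'
      have hxy : x ≠ y := fun h => hcc (by rw [h])
      rw [← smul_sub, norm_smul]
      have := h2 x hx y hy hxy
      norm_num
      linarith
  -- a separated set with the largest number of points is a net
  obtain ⟨N, hN, hmax⟩ : ∃ N, Sep N ∧ ∀ N', Sep N' → N'.card ≤ N.card := by
    have hex : ∃ c, ∃ N, Sep N ∧ N.card = c := ⟨0, ∅, by simp [Sep], rfl⟩
    have hbd : ∀ c, (∃ N, Sep N ∧ N.card = c) → c ≤ 5 ^ d := by
      rintro c ⟨N, hN, rfl⟩; exact hcard N hN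
    obtain ⟨N, hN, hc⟩ := Nat.findGreatest_spec (P := fun c => ∃ N, Sep N ∧ N.card = c)
      (Nat.zero_le (5 ^ d)) ⟨∅, by simp [Sep], rfl⟩
    refine ⟨N, hN, fun N' hN' => ?_⟩
    rw [hc]
    exact Nat.le_findGreatest (hcard N' hN') ⟨N', hN', rfl⟩
  refine ⟨N, hcard N hN, hN.1, fun x hx => ?_⟩
  by_contra! hcon
  have hxN : x ∉ N := fun h => by have := hcon x h; norm_num at this
  have hS : Sep (insert x N) := by
    refine ⟨fun n hn => ?_, fun a ha b hb hab => ?_⟩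
    · rcases Finset.mem_insert.1 hn with rfl | hn
      exacts [hx, hN.1 n hn]
    · rcases Finset.mem_insert.1 ha with rfl | ha' <;> rcases Finset.mem_insert.1 hb with rfl | hb'
      · exact absurd rfl hab
      · exact (hcon b hb').le
      · rw [norm_sub_rev]; exact (hcon a ha').le
      · exact hN.2 a ha' b hb' hab
  have := hmax _ hS
  rw [Finset.card_insert_of_notMem hxN] at this
  omega

theorem IsNet.norm_le {N : Finset (Vec d)} (hN : IsNet N) {v : Vec d} {τ : ℝ}
    (h : ∀ n ∈ N, |(inner ℝ n v : ℝ)| ≤ τ) : ‖v‖ ≤ 2 * τ := by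
  rcases eq_or_ne v 0 with rfl | hv
  · obtain ⟨n, hn, -⟩ := hN.2 0 (by simp)
    have := (abs_nonneg _).trans (h n hn)
    simpa using this
  have hv' : 0 < ‖v‖ := norm_pos_iff.2 hv
  set x := (‖v‖⁻¹ : ℝ) • v with hx
  have hx1 : ‖x‖ = 1 := by rw [hx, norm_smul, norm_inv, norm_norm, inv_mul_cancel₀ hv'.ne']
  obtain ⟨n, hn, hxn⟩ := hN.2 x hx1.le
  have h1 : (inner ℝ x v : ℝ) = ‖v‖ := by
    rw [hx, real_inner_smul_left, real_inner_self_eq_norm_sq]; field_simp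
  have h2 : (inner ℝ x v : ℝ) = inner ℝ n v + inner ℝ (x - n) v := by
    rw [inner_sub_left]; ring
  have h3 := (real_inner_le_norm (x - n) v).trans (mul_le_mul_of_nonneg_right hxn hv'.le)
  have h4 := (le_abs_self _).trans (h n hn)
  linarith

theorem IsNet.norm_apply_le {N : Finset (Vec d)} (hN : IsNet N) {A : Vec d →ₗ[ℝ] Vec d}
    (hA : A.IsSymmetric) {τ : ℝ} (h : ∀ n ∈ N, ∀ n' ∈ N, |(inner ℝ n (A n') : ℝ)| ≤ τ)
    (x : Vec d) : ‖A x‖ ≤ 4 * τ * ‖x‖ := by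
  have h1 : ∀ n ∈ N, ‖A n‖ ≤ 2 * τ := fun n hn => hN.norm_le fun n' hn' => h n' hn' n hn
  have h2 : ∀ n ∈ N, |(inner ℝ n (A x) : ℝ)| ≤ 2 * τ * ‖x‖ := by
    intro n hn
    rw [← hA]
    exact (abs_real_inner_le_norm _ _).trans (mul_le_mul_of_nonneg_right (h1 n hn) (norm_nonneg x))
  have := hN.norm_le h2
  linarith

/-! ### The covariance operator -/

/-- The operator on `ℝ^d` given by a matrix. -/
noncomputable def covOp (S : Matrix (Fin d) (Fin d) ℝ) : Vec d →ₗ[ℝ] Vec d :=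
  Matrix.toEuclideanLin S

theorem inner_covOp (S : Matrix (Fin d) (Fin d) ℝ) (x y : Vec d) :
    inner ℝ x (covOp S y) = x ⬝ᵥ S.mulVec y := by
  simp [covOp, EuclideanSpace.inner_eq_star_dotProduct, dotProduct_comm]

variable {S : Matrix (Fin d) (Fin d) ℝ}

theorem covOp_isSymmetric (hS : S.IsHermitian) : (covOp S).IsSymmetric :=
  Matrix.isSymmetric_toEuclideanLin_iff.2 hS

theorem covOp_eigenvectorBasis (hS : S.IsHermitian) (i : Fin d) :
    covOp S (hS.eigenvectorBasis i) = hS.eigenvalues i • hS.eigenvectorBasis i := by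
  ext j
  have := congrFun (hS.mulVec_eigenvectorBasis i) j
  simpa [covOp, Matrix.toLpLin_apply] using this

theorem inner_eigenvectorBasis_covOp (hS : S.IsHermitian) (i : Fin d) (x : Vec d) :
    inner ℝ (hS.eigenvectorBasis i) (covOp S x) =
      hS.eigenvalues i * inner ℝ (hS.eigenvectorBasis i) x := by
  rw [← covOp_isSymmetric hS, covOp_eigenvectorBasis, real_inner_smul_left]

theorem inner_self_covOp_eq (hS : S.IsHermitian) (x : Vec d) :
    inner ℝ x (covOp S x) = ∑ i, hS.eigenvalues i * (inner ℝ (hS.eigenvectorBasis i) x : ℝ) ^ 2 := by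
  rw [← hS.eigenvectorBasis.sum_inner_mul_inner x (covOp S x)]
  refine Finset.sum_congr rfl fun i _ => ?_
  rw [inner_eigenvectorBasis_covOp, real_inner_comm]; ring

theorem norm_sq_eq_sum_eigenvectorBasis (hS : S.IsHermitian) (x : Vec d) :
    ‖x‖ ^ 2 = ∑ i, (inner ℝ (hS.eigenvectorBasis i) x : ℝ) ^ 2 := by
  rw [← real_inner_self_eq_norm_sq, ← hS.eigenvectorBasis.sum_inner_mul_inner x x]
  refine Finset.sum_congr rfl fun i _ => ?_
  rw [real_inner_comm]; ring

theorem eigenvalues_le_lamMax (hS : S.IsHermitian) (i : Fin d) : hS.eigenvalues i ≤ lamMax hS :=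
  le_ciSup (Set.finite_range _).bddAbove i

theorem lamMin_le_eigenvalues (hS : S.IsHermitian) (i : Fin d) : lamMin hS ≤ hS.eigenvalues i :=
  ciInf_le (Set.finite_range _).bddBelow i

theorem lamMin_pos (hS : S.PosDef) (hd : 0 < d) : 0 < lamMin hS.isHermitian := by
  have : Nonempty (Fin d) := ⟨⟨0, hd⟩⟩
  obtain ⟨i, hi⟩ := exists_eq_ciInf_of_finite (f := hS.isHermitian.eigenvalues)
  rw [lamMin, ← hi]
  exact hS.eigenvalues_pos i

theorem lamMin_le_lamMax (hS : S.IsHermitian) (hd : 0 < d) : lamMin hS ≤ lamMax hS :=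
  (lamMin_le_eigenvalues hS ⟨0, hd⟩).trans (eigenvalues_le_lamMax hS _)

theorem lamMin_mul_le_inner_covOp (hS : S.IsHermitian) (x : Vec d) :
    lamMin hS * ‖x‖ ^ 2 ≤ inner ℝ x (covOp S x) := by
  rw [inner_self_covOp_eq hS, norm_sq_eq_sum_eigenvectorBasis hS, Finset.mul_sum]
  gcongr with i
  exact lamMin_le_eigenvalues hS i

theorem inner_covOp_le_lamMax_mul (hS : S.IsHermitian) (x : Vec d) :
    inner ℝ x (covOp S x) ≤ lamMax hS * ‖x‖ ^ 2 := by
  rw [inner_self_covOp_eq hS, norm_sq_eq_sum_eigenvectorBasis hS, Finset.mul_sum]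
  gcongr with i
  exact eigenvalues_le_lamMax hS i

theorem norm_covOp_le (hS : S.PosDef) (hd : 0 < d) (x : Vec d) :
    ‖covOp S x‖ ≤ lamMax hS.isHermitian * ‖x‖ := by
  have hL : 0 ≤ lamMax hS.isHermitian := (lamMin_pos hS hd).le.trans (lamMin_le_lamMax _ hd)
  refine le_of_pow_le_pow_left₀ two_ne_zero (by positivity) ?_
  rw [mul_pow, norm_sq_eq_sum_eigenvectorBasis hS.isHermitian,
    norm_sq_eq_sum_eigenvectorBasis hS.isHermitian x, Finset.mul_sum]
  refine Finset.sum_le_sum fun i _ => ?_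
  rw [inner_eigenvectorBasis_covOp, mul_pow]
  have h0 := (hS.eigenvalues_pos i).le
  have h1 := eigenvalues_le_lamMax hS.isHermitian i
  gcongr

end Operators

/-! ### Gaussian vectors conditioned on a half-space -/

section Gaussian

variable {d : ℕ}

/-- The centred Gaussian law with covariance matrix `S`. -/
noncomputable abbrev normal (S : Matrix (Fin d) (Fin d) ℝ) : Measure (Vec d) :=
  multivariateGaussian 0 S

/-- The variance `⟪w, S w⟫` of `⟪w, x⟫`. -/
noncomputable def quad (S : Matrix (Fin d) (Fin d) ℝ) (w : Vec d) : ℝ := inner ℝ w (covOp S w)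

/-- The mean of the absolute value of a standard Gaussian variable. -/
noncomputable def absMean : ℝ := ∫ x, |x| ∂(gaussianReal 0 1)

theorem integrable_abs_gaussianReal (v : NNReal) : Integrable (fun x => |x|) (gaussianReal 0 v) :=
  (IsGaussian.integrable_id (μ := gaussianReal 0 v)).abs

theorem absMean_pos : 0 < absMean := by
  rw [absMean, integral_pos_iff_support_of_nonneg (fun x => abs_nonneg x)
    (integrable_abs_gaussianReal 1)]
  have : Function.support (fun x : ℝ => |x|) = {0}ᶜ := by ext x; simp
  have hn := nullSingletonClass_gaussianReal (μ := 0) (v := 1) one_ne_zero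
  rw [this, measure_compl (measurableSet_singleton 0) (measure_ne_top _ _), measure_singleton,
    measure_univ]
  norm_num

variable {S : Matrix (Fin d) (Fin d) ℝ}

theorem lamMin_mul_le_quad (hS : S.PosDef) (w : Vec d) :
    lamMin hS.isHermitian * ‖w‖ ^ 2 ≤ quad S w := lamMin_mul_le_inner_covOp _ _

theorem quad_le_lamMax_mul (hS : S.PosDef) (w : Vec d) :
    quad S w ≤ lamMax hS.isHermitian * ‖w‖ ^ 2 := inner_covOp_le_lamMax_mul _ _

theorem quad_pos (hS : S.PosDef) {w : Vec d} (hw : w ≠ 0) : 0 < quad S w := by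
  rcases Nat.eq_zero_or_pos d with rfl | hd
  · exact absurd (Subsingleton.elim w 0) hw
  · have := lamMin_pos hS hd
    exact lt_of_lt_of_le (by positivity) (lamMin_mul_le_quad hS w)

theorem quad_nonneg (hS : S.PosDef) (w : Vec d) : 0 ≤ quad S w := by
  rcases eq_or_ne w 0 with rfl | hw
  · simp [quad]
  · exact (quad_pos hS hw).le

theorem integrable_inner (w : Vec d) : Integrable (fun x => (inner ℝ w x : ℝ)) (normal S) :=
  (innerSL ℝ w).integrable_comp IsGaussian.integrable_id

theorem memLp_inner (w : Vec d) : MemLp (fun x => (inner ℝ w x : ℝ)) 2 (normal S) :=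
  (innerSL ℝ w).comp_memLp' IsGaussian.memLp_two_id

theorem integrable_inner_mul_inner (w w' : Vec d) :
    Integrable (fun x => (inner ℝ w x : ℝ) * inner ℝ w' x) (normal S) :=
  (memLp_inner w).integrable_mul (memLp_inner w')

theorem integral_inner (w : Vec d) : ∫ x, (inner ℝ w x : ℝ) ∂(normal S) = 0 := by
  have h := (innerSL ℝ w).integral_comp_comm
    (IsGaussian.integrable_id (μ := normal S))
  simp only [innerSL_apply_apply, id_eq] at h
  rw [h, integral_id_multivariateGaussian, inner_zero_right]

theorem cov_inner (hS : S.PosDef) (w w' : Vec d) :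
    cov[fun x => (inner ℝ w x : ℝ), fun x => (inner ℝ w' x : ℝ); normal S] =
      inner ℝ w (covOp S w') := by
  rw [← covarianceBilin_apply_eq_cov IsGaussian.memLp_two_id,
    covarianceBilin_multivariateGaussian hS.posSemidef, inner_covOp]

theorem integral_inner_mul_inner (hS : S.PosDef) (w w' : Vec d) :
    ∫ x, (inner ℝ w x : ℝ) * inner ℝ w' x ∂(normal S) = inner ℝ w (covOp S w') := by
  rw [← cov_inner hS, covariance_eq_sub (memLp_inner w) (memLp_inner w'), integral_inner,
    integral_inner]
  simp

theorem normal_map_inner (hS : S.PosDef) (w : Vec d) :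
    (normal S).map (fun x => (inner ℝ w x : ℝ)) = gaussianReal 0 (quad S w).toNNReal := by
  have h := IsGaussian.map_eq_gaussianReal (μ := normal S) (innerSL ℝ w)
  have h1 : ((innerSL ℝ w : Vec d →L[ℝ] ℝ) : Vec d → ℝ) = fun x => (inner ℝ w x : ℝ) := by
    funext x; simp
  rw [h1] at h
  rw [h, integral_inner, ← covariance_self (by fun_prop), cov_inner hS]
  rfl

theorem normal_map_neg (S : Matrix (Fin d) (Fin d) ℝ) (hS : S.PosDef) :
    (normal S).map (fun x => -x) = normal S := by
  refine Measure.ext_of_charFun ?_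
  funext t
  have h1 : (fun x : Vec d => -x) = fun x => (-1 : ℝ) • x := by funext x; simp
  rw [h1, charFun_map_smul, charFun_multivariateGaussian hS.posSemidef,
    charFun_multivariateGaussian hS.posSemidef]
  simp [Matrix.mulVec_neg]

theorem integral_comp_neg (hS : S.PosDef) (g : Vec d → ℝ) :
    ∫ x, g (-x) ∂(normal S) = ∫ x, g x ∂(normal S) := by
  conv_rhs => rw [← normal_map_neg S hS]
  exact ((MeasurableEquiv.neg (Vec d)).measurableEmbedding.integral_map g).symm

theorem normal_inner_eq_zero (hS : S.PosDef) {r : Vec d} (hr : r ≠ 0) :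
    normal S {x | (inner ℝ r x : ℝ) = 0} = 0 := by
  have hv : (quad S r).toNNReal ≠ 0 := by simpa using quad_pos hS hr
  have hn := nullSingletonClass_gaussianReal (μ := 0) hv
  have h := measure_singleton (μ := gaussianReal 0 (quad S r).toNNReal) (0 : ℝ)
  rw [← normal_map_inner hS, Measure.map_apply (by fun_prop) (measurableSet_singleton 0)] at h
  exact h

theorem normal_inner_ne_zero (hS : S.PosDef) {r : Vec d} (hr : r ≠ 0) :
    ∀ᵐ x ∂(normal S), (inner ℝ r x : ℝ) ≠ 0 :=
  ae_iff.2 (by simpa using normal_inner_eq_zero hS hr)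

theorem measurableSet_inner_pos (r : Vec d) : MeasurableSet {x : Vec d | 0 < (inner ℝ r x : ℝ)} :=
  measurableSet_lt measurable_const (by fun_prop)

theorem normal_inner_neg (hS : S.PosDef) (r : Vec d) :
    normal S {x | (inner ℝ r x : ℝ) < 0} = normal S {x | 0 < (inner ℝ r x : ℝ)} := by
  conv_lhs => rw [← normal_map_neg S hS]
  rw [Measure.map_apply (by fun_prop) (measurableSet_lt (by fun_prop) measurable_const)]
  congr 1
  ext x
  simp [inner_neg_right]

theorem ltf_eq_one_iff (r x : Vec d) : ltf r x = 1 ↔ 0 < (inner ℝ r x : ℝ) := by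
  simp only [ltf, pos]; split_ifs with h <;> simp [h]

theorem ltf_eq_zero_iff (r x : Vec d) : ltf r x = 0 ↔ (inner ℝ r x : ℝ) ≤ 0 := by
  simp only [ltf, pos]; split_ifs with h <;> simpa using h

theorem normal_inner_pos (hS : S.PosDef) {r : Vec d} (hr : r ≠ 0) :
    normal S {x | 0 < (inner ℝ r x : ℝ)} = 1 / 2 := by
  have hc : normal S {x | 0 < (inner ℝ r x : ℝ)}ᶜ = normal S {x | 0 < (inner ℝ r x : ℝ)} := by
    rw [← normal_inner_neg hS]
    refine measure_congr ?_
    filter_upwards [normal_inner_ne_zero hS hr] with x hx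
    refine propext ⟨fun h => ?_, fun h => ?_⟩
    · exact lt_of_le_of_ne (not_lt.1 h) hx
    · exact not_lt.2 (le_of_lt h)
  have h1 := measure_add_measure_compl (μ := normal S) (measurableSet_inner_pos r)
  rw [hc, measure_univ, ← two_mul] at h1
  rw [ENNReal.eq_div_iff (by norm_num) (by norm_num)]
  exact h1

theorem condLabel_one (hS : S.PosDef) {r : Vec d} (hr : r ≠ 0) :
    condLabel (normal S) (ltf r) 1 = (2 : ENNReal) • (normal S).restrict {x | 0 < (inner ℝ r x : ℝ)} := by
  have : {x | ltf r x = 1} = {x | 0 < (inner ℝ r x : ℝ)} := by ext x; exact ltf_eq_one_iff r x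
  rw [condLabel, this, ProbabilityTheory.cond, normal_inner_pos hS hr]
  simp

theorem condLabel_zero (hS : S.PosDef) {r : Vec d} (hr : r ≠ 0) :
    condLabel (normal S) (ltf r) 0 =
      (2 : ENNReal) • (normal S).restrict {x | 0 < (inner ℝ r x : ℝ)}ᶜ := by
  have : {x | ltf r x = 0} = {x | 0 < (inner ℝ r x : ℝ)}ᶜ := by
    ext x; simpa using ltf_eq_zero_iff r x
  have h1 : normal S {x | 0 < (inner ℝ r x : ℝ)}ᶜ = 1 / 2 := by
    rw [measure_compl (measurableSet_inner_pos r) (measure_ne_top _ _), normal_inner_pos hS hr,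
      measure_univ]
    simp
  rw [condLabel, this, ProbabilityTheory.cond, h1]
  simp

theorem condLabel_ac (D : Measure (Vec d)) (r : Vec d) (a : Fin 2) :
    condLabel D (ltf r) a ≪ D := cond_absolutelyContinuous

theorem isProbabilityMeasure_condLabel (hS : S.PosDef) {r : Vec d} (hr : r ≠ 0) (a : Fin 2) :
    IsProbabilityMeasure (condLabel (normal S) (ltf r) a) := by
  have h : ∀ s, normal S s = 1 / 2 → IsProbabilityMeasure ((2 : ENNReal) • (normal S).restrict s) := by
    intro s hs
    refine ⟨?_⟩
    rw [Measure.smul_apply, Measure.restrict_apply_univ, hs, smul_eq_mul, one_div,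
      ENNReal.mul_inv_cancel two_ne_zero ENNReal.ofNat_ne_top]
  fin_cases a
  · change IsProbabilityMeasure (condLabel (normal S) (ltf r) 0)
    rw [condLabel_zero hS hr]
    refine h _ ?_
    rw [measure_compl (measurableSet_inner_pos r) (measure_ne_top _ _), normal_inner_pos hS hr,
      measure_univ]
    simp
  · change IsProbabilityMeasure (condLabel (normal S) (ltf r) 1)
    rw [condLabel_one hS hr]
    exact h _ (normal_inner_pos hS hr)

/-- The sign of a label. -/
noncomputable def labelSign (a : Fin 2) : ℝ := if a = 1 then 1 else -1

theorem integrable_condLabel (hS : S.PosDef) {r : Vec d} (hr : r ≠ 0) (a : Fin 2)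
    {g : Vec d → ℝ} (hg : Integrable g (normal S)) :
    Integrable g (condLabel (normal S) (ltf r) a) := by
  fin_cases a
  · change Integrable g (condLabel (normal S) (ltf r) 0)
    rw [condLabel_zero hS hr]
    exact (hg.restrict).smul_measure ENNReal.ofNat_ne_top
  · change Integrable g (condLabel (normal S) (ltf r) 1)
    rw [condLabel_one hS hr]
    exact (hg.restrict).smul_measure ENNReal.ofNat_ne_top

theorem integral_condLabel_one (hS : S.PosDef) {r : Vec d} (hr : r ≠ 0) (g : Vec d → ℝ) :
    ∫ x, g x ∂(condLabel (normal S) (ltf r) 1) =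
      2 * ∫ x in {x | 0 < (inner ℝ r x : ℝ)}, g x ∂(normal S) := by
  rw [condLabel_one hS hr, integral_smul_measure]
  simp

/-- Reflection through the origin exchanges the two conditional laws. -/
theorem integral_condLabel_zero (hS : S.PosDef) {r : Vec d} (hr : r ≠ 0) (g : Vec d → ℝ) :
    ∫ x, g x ∂(condLabel (normal S) (ltf r) 0) =
      ∫ x, g (-x) ∂(condLabel (normal S) (ltf r) 1) := by
  rw [integral_condLabel_one hS hr, condLabel_zero hS hr, integral_smul_measure,
    ← integral_indicator (measurableSet_inner_pos r).compl,
    ← integral_indicator (measurableSet_inner_pos r), ← integral_comp_neg hS]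
  simp only [ENNReal.toReal_ofNat, smul_eq_mul]
  congr 1
  refine integral_congr_ae ?_
  filter_upwards [normal_inner_ne_zero hS hr] with x hx
  by_cases h : 0 < (inner ℝ r x : ℝ)
  · rw [Set.indicator_of_mem (by simpa using h.le), Set.indicator_of_mem (by simpa using h)]
  · have : (inner ℝ r x : ℝ) < 0 := lt_of_le_of_ne (not_lt.1 h) hx
    rw [Set.indicator_of_notMem (by simpa using this), Set.indicator_of_notMem (by simpa using h)]

theorem integral_condLabel_of_even (hS : S.PosDef) {r : Vec d} (hr : r ≠ 0) (a : Fin 2)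
    {g : Vec d → ℝ} (hg : Integrable g (normal S)) (he : ∀ x, g (-x) = g x) :
    ∫ x, g x ∂(condLabel (normal S) (ltf r) a) = ∫ x, g x ∂(normal S) := by
  have h01 : ∫ x, g x ∂(condLabel (normal S) (ltf r) 0) =
      ∫ x, g x ∂(condLabel (normal S) (ltf r) 1) := by
    rw [integral_condLabel_zero hS hr]; simp only [he]
  have hsum : ∫ x, g x ∂(condLabel (normal S) (ltf r) 1) +
      ∫ x, g x ∂(condLabel (normal S) (ltf r) 0) = 2 * ∫ x, g x ∂(normal S) := by
    rw [integral_condLabel_one hS hr, condLabel_zero hS hr, integral_smul_measure,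
      ← integral_add_compl (measurableSet_inner_pos r) hg]
    simp; ring
  fin_cases a
  · change ∫ x, g x ∂(condLabel (normal S) (ltf r) 0) = _
    linarith
  · change ∫ x, g x ∂(condLabel (normal S) (ltf r) 1) = _
    linarith

theorem gaussianReal_eq_map_sqrt {v : ℝ} (hv : 0 ≤ v) :
    gaussianReal 0 v.toNNReal = (gaussianReal 0 1).map (fun y => Real.sqrt v * y) := by
  rw [gaussianReal_map_const_mul, mul_zero, mul_one]
  congr 1
  ext
  simp [Real.sq_sqrt hv, hv]

theorem integral_abs_gaussianReal {v : ℝ} (hv : 0 ≤ v) :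
    ∫ x, |x| ∂(gaussianReal 0 v.toNNReal) = Real.sqrt v * absMean := by
  rw [gaussianReal_eq_map_sqrt hv, integral_map (by fun_prop) (by fun_prop), absMean, ← integral_const_mul]
  simp [abs_mul, abs_of_nonneg (Real.sqrt_nonneg v)]

/-- If `⟪w, x⟫` is uncorrelated with `⟪r, x⟫`, then it is independent of the label, so that it has
mean zero on the half-space. -/
theorem setIntegral_inner_eq_zero (hS : S.PosDef) {r w : Vec d}
    (h : inner ℝ r (covOp S w) = (0 : ℝ)) :
    ∫ x in {x | 0 < (inner ℝ r x : ℝ)}, (inner ℝ w x : ℝ) ∂(normal S) = 0 := by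
  have hG : HasGaussianLaw (fun x : Vec d => ((inner ℝ r x : ℝ), (inner ℝ w x : ℝ))) (normal S) :=
    (IsGaussian.hasGaussianLaw_id (μ := normal S)).map_fun ((innerSL ℝ r).prod (innerSL ℝ w))
  have hI := hG.indepFun_of_covariance_eq_zero (by rw [cov_inner hS, h])
  have hm : Measurable ((Set.Ioi (0 : ℝ)).indicator (fun _ => (1 : ℝ))) :=
    measurable_const.indicator measurableSet_Ioi
  have h1 := hI.integral_fun_comp_mul_comp (f := (Set.Ioi (0 : ℝ)).indicator (fun _ => (1 : ℝ)))
    (g := fun y => y) (by fun_prop) (by fun_prop) hm.aestronglyMeasurable (by fun_prop)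
  rw [integral_inner, mul_zero] at h1
  rw [← integral_indicator (measurableSet_inner_pos r)]
  refine Eq.trans ?_ h1
  congr 1
  funext x
  by_cases hx : 0 < (inner ℝ r x : ℝ)
  · rw [Set.indicator_of_mem (by simpa using hx), Set.indicator_of_mem (by simpa using hx)]; simp
  · rw [Set.indicator_of_notMem (by simpa using hx), Set.indicator_of_notMem (by simpa using hx)]
    simp

/-- The direction `S r / σ` of the conditional means, `σ² = ⟪r, S r⟫`. -/
noncomputable def meanDir (S : Matrix (Fin d) (Fin d) ℝ) (r : Vec d) : Vec d :=
  (Real.sqrt (quad S r))⁻¹ • covOp S r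

/-- The conditional means are the vectors `± absMean • meanDir S r`. -/
theorem integral_inner_condLabel (hS : S.PosDef) {r : Vec d} (hr : r ≠ 0) (a : Fin 2) (w : Vec d) :
    ∫ x, (inner ℝ w x : ℝ) ∂(condLabel (normal S) (ltf r) a) =
      labelSign a * (absMean * inner ℝ w (meanDir S r)) := by
  have hq := quad_pos hS hr
  have hone : ∫ x, (inner ℝ w x : ℝ) ∂(condLabel (normal S) (ltf r) 1) =
      absMean * inner ℝ w (meanDir S r) := by
    -- `w` minus its regression on `r`
    set α : ℝ := inner ℝ w (covOp S r) / quad S r with hα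
    set w' := w - α • r with hw'
    have hsymm : (inner ℝ r (covOp S w) : ℝ) = inner ℝ w (covOp S r) := by
      rw [← covOp_isSymmetric hS.isHermitian, real_inner_comm]
    have h0 : inner ℝ r (covOp S w') = (0 : ℝ) := by
      rw [hw', map_sub, map_smul, inner_sub_right, real_inner_smul_right, hsymm]
      change _ - α * quad S r = 0
      rw [hα]; field_simp; ring
    have hdec : ∀ x, (inner ℝ w x : ℝ) = α * inner ℝ r x + inner ℝ w' x := by
      intro x
      rw [hw', inner_sub_left, real_inner_smul_left]; ring
    have habs : ∫ x in {x | 0 < (inner ℝ r x : ℝ)}, (inner ℝ r x : ℝ) ∂(normal S) =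
        Real.sqrt (quad S r) * absMean / 2 := by
      have h1 : ∫ x, |(inner ℝ r x : ℝ)| ∂(condLabel (normal S) (ltf r) 1) =
          ∫ x, |(inner ℝ r x : ℝ)| ∂(normal S) :=
        integral_condLabel_of_even hS hr 1 (integrable_inner r).abs fun x => by
          rw [inner_neg_right, abs_neg]
      have h2 : ∫ x, |(inner ℝ r x : ℝ)| ∂(normal S) = Real.sqrt (quad S r) * absMean := by
        rw [← integral_abs_gaussianReal hq.le, ← normal_map_inner hS,
          integral_map (by fun_prop) (by fun_prop)]
      rw [integral_condLabel_one hS hr, h2] at h1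
      have h3 : ∫ x in {x | 0 < (inner ℝ r x : ℝ)}, |(inner ℝ r x : ℝ)| ∂(normal S) =
          ∫ x in {x | 0 < (inner ℝ r x : ℝ)}, (inner ℝ r x : ℝ) ∂(normal S) :=
        setIntegral_congr_fun (measurableSet_inner_pos r) fun x hx => abs_of_pos hx
      rw [← h3]; linarith
    rw [integral_condLabel_one hS hr]
    conv_lhs => simp only [hdec]
    rw [integral_add ((integrable_inner r).const_mul α).restrict (integrable_inner w').restrict,
      integral_const_mul, habs, setIntegral_inner_eq_zero hS h0, meanDir, real_inner_smul_right, hα]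
    have hs := Real.sqrt_pos.2 hq
    have hs2 := Real.sq_sqrt hq.le
    field_simp
    linear_combination (inner ℝ w (covOp S r) * absMean) * hs2
  fin_cases a
  · change ∫ x, (inner ℝ w x : ℝ) ∂(condLabel (normal S) (ltf r) 0) = labelSign 0 * _
    rw [integral_condLabel_zero hS hr]
    simp only [inner_neg_right]
    rw [integral_neg, hone]
    simp [labelSign]
  · change ∫ x, (inner ℝ w x : ℝ) ∂(condLabel (normal S) (ltf r) 1) = labelSign 1 * _
    rw [hone]
    simp [labelSign]

theorem integral_inner_mul_inner_condLabel (hS : S.PosDef) {r : Vec d} (hr : r ≠ 0) (a : Fin 2)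
    (w w' : Vec d) :
    ∫ x, (inner ℝ w x : ℝ) * inner ℝ w' x ∂(condLabel (normal S) (ltf r) a) =
      inner ℝ w (covOp S w') := by
  rw [integral_condLabel_of_even hS hr a (integrable_inner_mul_inner w w'),
    integral_inner_mul_inner hS]
  intro x
  simp [inner_neg_right]

/-- Squares of Gaussian variables of variance at most `L` have a bounded exponential moment, also
after conditioning on a label, since they are even functions. -/
theorem exists_exp_moment : ∃ c K : ℝ, 0 < c ∧ 1 ≤ K ∧ ∀ (d : ℕ) (S : Matrix (Fin d) (Fin d) ℝ)
    (_ : S.PosDef) (r : Vec d) (_ : r ≠ 0) (a : Fin 2) (w : Vec d) (L : ℝ) (_ : 0 < L)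
    (_ : quad S w ≤ L),
    Integrable (fun x => Real.exp (c * ((inner ℝ w x : ℝ) ^ 2 / L))) (condLabel (normal S) (ltf r) a) ∧
    ∫ x, Real.exp (c * ((inner ℝ w x : ℝ) ^ 2 / L)) ∂(condLabel (normal S) (ltf r) a) ≤ K := by
  obtain ⟨c, hc, hint⟩ := IsGaussian.exists_integrable_exp_sq (gaussianReal 0 1)
  simp only [Real.norm_eq_abs, sq_abs] at hint
  refine ⟨c, ∫ x, Real.exp (c * x ^ 2) ∂(gaussianReal 0 1), hc, ?_, ?_⟩
  · have h1 : ∫ _, (1 : ℝ) ∂(gaussianReal 0 1) = 1 := by simp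
    rw [← h1]
    exact integral_mono (integrable_const _) hint fun x => Real.one_le_exp (by positivity)
  intro d S hS r hr a w L hL hw
  have hq := quad_nonneg hS w
  have hmap := (gaussianReal_eq_map_sqrt hq).symm
  rw [← normal_map_inner hS] at hmap
  have hle : ∀ y : ℝ, Real.exp (c * ((Real.sqrt (quad S w) * y) ^ 2 / L)) ≤ Real.exp (c * y ^ 2) := by
    intro y
    rw [mul_pow, Real.sq_sqrt hq]
    gcongr
    rw [div_le_iff₀ hL, mul_comm (y ^ 2)]
    gcongr
  have hm : Measurable fun y : ℝ => Real.exp (c * (y ^ 2 / L)) := by fun_prop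
  have hint1 : Integrable (fun y : ℝ => Real.exp (c * ((Real.sqrt (quad S w) * y) ^ 2 / L)))
      (gaussianReal 0 1) := by
    refine hint.mono' (by fun_prop) (Filter.Eventually.of_forall fun y => ?_)
    rw [Real.norm_of_nonneg (Real.exp_pos _).le]
    exact hle y
  have hint2 : Integrable (fun x => Real.exp (c * ((inner ℝ w x : ℝ) ^ 2 / L))) (normal S) := by
    have h1 : Integrable (fun y : ℝ => Real.exp (c * (y ^ 2 / L)))
        ((normal S).map (fun x => (inner ℝ w x : ℝ))) := by
      rw [← hmap, integrable_map_measure hm.aestronglyMeasurable (by fun_prop)]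
      exact hint1
    exact (integrable_map_measure hm.aestronglyMeasurable (by fun_prop)).1 h1
  refine ⟨integrable_condLabel hS hr a hint2, ?_⟩
  rw [integral_condLabel_of_even hS hr a hint2 (fun x => by simp [inner_neg_right])]
  have h2 : ∫ x, Real.exp (c * ((inner ℝ w x : ℝ) ^ 2 / L)) ∂(normal S) =
      ∫ y, Real.exp (c * ((Real.sqrt (quad S w) * y) ^ 2 / L)) ∂(gaussianReal 0 1) := by
    rw [← integral_map (φ := fun x : Vec d => (inner ℝ w x : ℝ))
      (f := fun y : ℝ => Real.exp (c * (y ^ 2 / L))) (by fun_prop) hm.aestronglyMeasurable,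
      ← hmap, integral_map (by fun_prop) hm.aestronglyMeasurable]
  rw [h2]
  exact integral_mono hint1 hint hle

/-! ### The error of a nearby hypothesis -/

theorem normal_abs_inner_le (hS : S.PosDef) {w : Vec d} (hw : w ≠ 0) {t : ℝ} (ht : 0 ≤ t) :
    (normal S).real {x | |(inner ℝ w x : ℝ)| ≤ t} ≤ t / Real.sqrt (quad S w) := by
  have hq := quad_pos hS hw
  have hv : (quad S w).toNNReal ≠ 0 := by simpa using hq
  have hset : {x : Vec d | |(inner ℝ w x : ℝ)| ≤ t} =
      (fun x => (inner ℝ w x : ℝ)) ⁻¹' Set.Icc (-t) t := by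
    ext x; simp [abs_le]
  rw [hset, measureReal_def, ← Measure.map_apply (by fun_prop) measurableSet_Icc,
    normal_map_inner hS, gaussianReal_apply_eq_integral _ hv]
  have hb : ∀ x ∈ Set.Icc (-t) t, ‖gaussianPDFReal 0 (quad S w).toNNReal x‖ ≤
      1 / (2 * Real.sqrt (quad S w)) := by
    intro x _
    rw [Real.norm_of_nonneg (gaussianPDFReal_nonneg _ _ _), gaussianPDFReal, Real.coe_toNNReal _ hq.le]
    have h1 : Real.exp (-(x - 0) ^ 2 / (2 * quad S w)) ≤ 1 := by
      rw [Real.exp_le_one_iff]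
      exact div_nonpos_of_nonpos_of_nonneg (by nlinarith [sq_nonneg (x - 0)]) (by positivity)
    have h2 : 2 * Real.sqrt (quad S w) ≤ Real.sqrt (2 * Real.pi * quad S w) := by
      rw [Real.le_sqrt' (by positivity), mul_pow, Real.sq_sqrt hq.le]
      nlinarith [Real.pi_gt_three]
    have h3 := Real.sqrt_pos.2 hq
    calc _ ≤ (Real.sqrt (2 * Real.pi * quad S w))⁻¹ * 1 := by gcongr
      _ ≤ _ := by
        rw [mul_one, ← one_div]
        gcongr
  have hI := norm_setIntegral_le_of_norm_le_const (μ := volume) (s := Set.Icc (-t) t)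
    (by simp [Real.volume_Icc]) hb
  rw [ENNReal.toReal_ofReal (integral_nonneg fun x => gaussianPDFReal_nonneg _ _ _)]
  refine (le_abs_self _).trans (hI.trans ?_)
  rw [Real.volume_real_Icc_of_le (by linarith)]
  have h3 := Real.sqrt_pos.2 hq
  rw [div_mul_eq_mul_div, div_le_div_iff₀ (by positivity) h3]
  nlinarith

theorem normal_le_abs_inner (hS : S.PosDef) (w : Vec d) {t : ℝ} (ht : 0 < t) :
    (normal S).real {x | t ≤ |(inner ℝ w x : ℝ)|} ≤ quad S w / t ^ 2 := by
  have h := mul_meas_ge_le_integral_of_nonneg (μ := normal S)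
    (f := fun x => (inner ℝ w x : ℝ) * inner ℝ w x)
    (Filter.Eventually.of_forall fun x => mul_self_nonneg _) (integrable_inner_mul_inner w w) (t ^ 2)
  rw [integral_inner_mul_inner hS] at h
  rw [le_div_iff₀ (by positivity), mul_comm]
  refine le_trans (le_of_eq ?_) h
  congr 2
  ext x
  simp only [Set.mem_ofPred_eq, ← sq]
  rw [← sq_abs (inner ℝ w x : ℝ)]
  exact ⟨fun h => by gcongr, fun h => le_of_pow_le_pow_left₀ two_ne_zero (abs_nonneg _) h⟩

/-- If `r̂` is close to a positive multiple `ρ` of `r`, the halfspaces of `r` and `r̂` differ only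
where `⟪ρ, x⟫` is small or `⟪r̂ - ρ, x⟫` is large. -/
theorem instErr_le (hS : S.PosDef) {r r' ρ : Vec d} {c θ ε : ℝ} (hr : r ≠ 0) (hc : 0 < c)
    (hρ : ρ = c • r) (hε : 0 < ε) (hclose : ‖r' - ρ‖ ≤ θ * ‖ρ‖)
    (hθ : 8 * θ ^ 2 * (lamMax hS.isHermitian / lamMin hS.isHermitian) ≤ ε ^ 3) :
    instErr (normal S) (ltf r) (ltf r') ≤ ε := by
  have hd : 0 < d := by
    rcases Nat.eq_zero_or_pos d with rfl | hd
    · exact absurd (Subsingleton.elim r 0) hr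
    · exact hd
  have hl := lamMin_pos hS hd
  have hL : 0 < lamMax hS.isHermitian := lt_of_lt_of_le hl (lamMin_le_lamMax _ hd)
  have hρ0 : ρ ≠ 0 := by rw [hρ]; exact smul_ne_zero hc.ne' hr
  have hq := quad_pos hS hρ0
  set σ := Real.sqrt (quad S ρ) with hσ
  have hσ0 : 0 < σ := Real.sqrt_pos.2 hq
  have hσ2 : σ ^ 2 = quad S ρ := Real.sq_sqrt hq.le
  -- the threshold for which the first event has probability at most `ε / 2`
  set t := ε / 2 * σ with ht
  have ht0 : 0 < t := by positivity
  have hsub : {x | ltf r x ≠ ltf r' x} ⊆ {x | |(inner ℝ ρ x : ℝ)| ≤ t} ∪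
      {x | t ≤ |(inner ℝ (r' - ρ) x : ℝ)|} := by
    intro x hx
    simp only [Set.mem_union, Set.mem_ofPred_eq]
    by_contra! hcon
    apply hx
    obtain ⟨h1, h2⟩ := hcon
    have h3 : (inner ℝ r' x : ℝ) = inner ℝ ρ x + inner ℝ (r' - ρ) x := by rw [inner_sub_left]; ring
    have h4 : (inner ℝ ρ x : ℝ) = c * inner ℝ r x := by rw [hρ, real_inner_smul_left]
    have h5 := abs_lt.1 (h2.trans h1)
    simp only [ltf, pos]
    rcases lt_or_ge 0 (inner ℝ r x : ℝ) with h | h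
    · have hp : 0 < (inner ℝ ρ x : ℝ) := by rw [h4]; positivity
      rw [abs_of_pos hp] at h5
      rw [if_pos h, if_pos (by linarith)]
    · have hp : (inner ℝ ρ x : ℝ) ≤ 0 := by rw [h4]; exact mul_nonpos_of_nonneg_of_nonpos hc.le h
      rw [abs_of_nonpos hp] at h5
      rw [if_neg (not_lt.2 h), if_neg (by linarith)]
  have h1 := normal_abs_inner_le hS hρ0 ht0.le
  have h2 := normal_le_abs_inner hS (r' - ρ) ht0
  have h3 : t / Real.sqrt (quad S ρ) = ε / 2 := by rw [ht, ← hσ]; field_simp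
  have h4 : quad S (r' - ρ) / t ^ 2 ≤ ε / 2 := by
    have h5 : quad S (r' - ρ) ≤ lamMax hS.isHermitian * (θ * ‖ρ‖) ^ 2 :=
      (quad_le_lamMax_mul hS _).trans (by gcongr)
    have h6 : lamMin hS.isHermitian * ‖ρ‖ ^ 2 ≤ σ ^ 2 := by
      rw [hσ2]; exact lamMin_mul_le_quad hS ρ
    rw [div_le_iff₀ (by positivity)]
    refine h5.trans ?_
    have h7 : lamMax hS.isHermitian * (θ * ‖ρ‖) ^ 2 =
        (8 * θ ^ 2 * (lamMax hS.isHermitian / lamMin hS.isHermitian)) / 8 *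
          (lamMin hS.isHermitian * ‖ρ‖ ^ 2) := by field_simp
    rw [h7]
    calc _ ≤ ε ^ 3 / 8 * σ ^ 2 := by gcongr
      _ = _ := by rw [ht]; ring
  calc instErr (normal S) (ltf r) (ltf r')
      ≤ (normal S).real ({x | |(inner ℝ ρ x : ℝ)| ≤ t} ∪ {x | t ≤ |(inner ℝ (r' - ρ) x : ℝ)|}) :=
        measureReal_mono hsub
    _ ≤ _ := measureReal_union_le _ _
    _ ≤ ε / 2 + ε / 2 := add_le_add (h1.trans h3.le) (h2.trans h4)
    _ = ε := by ring

end Gaussian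

/-! ### A Chernoff bound for sub-exponential variables -/

theorem exp_le_one_add_add_sq_mul (x : ℝ) : Real.exp x ≤ 1 + x + x ^ 2 * Real.exp |x| := by
  have h := Complex.norm_exp_sub_sum_le_norm_mul_exp (x : ℂ) 2
  simp only [Finset.sum_range_succ, Finset.sum_range_zero, pow_zero, Nat.factorial, pow_one,
    Nat.cast_one, div_one, zero_add, Complex.norm_real, Real.norm_eq_abs, sq_abs, mul_one] at h
  have h2 : Complex.exp (x : ℂ) - (1 + (x : ℂ)) = ((Real.exp x - (1 + x) : ℝ) : ℂ) := by
    push_cast; ring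
  rw [h2, Complex.norm_real, Real.norm_eq_abs] at h
  linarith [le_abs_self (Real.exp x - (1 + x))]

section Chernoff

variable {Ω : Type*} [MeasurableSpace Ω] {μ : Measure Ω} {Y F : Ω → ℝ} {c K : ℝ}

/-- The constant in the exponent of the Chernoff bound for a variable dominated by `F`, where
`exp (c F)` has mean at most `K`. -/
noncomputable def chernoffConst (c K : ℝ) : ℝ := 8 * K / c ^ 2 + 1 / c

theorem integrable_exp_mul_of_abs_le (hY : Measurable Y) (hYF : ∀ ω, |Y ω| ≤ F ω)
    (hint : Integrable (fun ω => Real.exp (c * F ω)) μ) {t : ℝ} (ht : |t| ≤ c) :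
    Integrable (fun ω => Real.exp (t * Y ω)) μ := by
  refine hint.mono' (by fun_prop) (Filter.Eventually.of_forall fun ω => ?_)
  rw [Real.norm_of_nonneg (Real.exp_pos _).le]
  refine Real.exp_le_exp.2 ?_
  calc t * Y ω ≤ |t * Y ω| := le_abs_self _
    _ = |t| * |Y ω| := abs_mul _ _
    _ ≤ c * F ω := mul_le_mul ht (hYF ω) (abs_nonneg _) ((abs_nonneg _).trans ht)

theorem integrable_of_abs_le (hc : 0 < c) (hY : Measurable Y) (hYF : ∀ ω, |Y ω| ≤ F ω)
    (hint : Integrable (fun ω => Real.exp (c * F ω)) μ) : Integrable Y μ := by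
  refine (hint.const_mul c⁻¹).mono' hY.aestronglyMeasurable (Filter.Eventually.of_forall fun ω => ?_)
  rw [Real.norm_eq_abs]
  refine (hYF ω).trans ?_
  have h := Real.add_one_le_exp (c * F ω)
  rw [← mul_le_mul_iff_right₀ hc, mul_inv_cancel_left₀ hc.ne']
  linarith

/-- The moment generating function of a dominated variable is at most that of a Gaussian variable
with the same mean, near zero. -/
theorem integral_exp_mul_le [IsProbabilityMeasure μ] (hc : 0 < c) (hY : Measurable Y)
    (hYF : ∀ ω, |Y ω| ≤ F ω)
    (hint : Integrable (fun ω => Real.exp (c * F ω)) μ) (hK : ∫ ω, Real.exp (c * F ω) ∂μ ≤ K)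
    {t : ℝ} (ht : |t| ≤ c / 2) :
    ∫ ω, Real.exp (t * Y ω) ∂μ ≤ Real.exp (t * ∫ ω, Y ω ∂μ + chernoffConst c K * t ^ 2) := by
  have hYi := integrable_of_abs_le hc hY hYF hint
  have hpt : ∀ ω, Real.exp (t * Y ω) ≤ 1 + t * Y ω + (8 / c ^ 2 * t ^ 2) * Real.exp (c * F ω) := by
    intro ω
    refine (exp_le_one_add_add_sq_mul (t * Y ω)).trans ?_
    gcongr 1 + t * Y ω + ?_
    have hF0 : 0 ≤ F ω := (abs_nonneg _).trans (hYF ω)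
    have h1 : |t * Y ω| ≤ c / 2 * F ω := by
      rw [abs_mul]
      exact mul_le_mul ht (hYF ω) (abs_nonneg _) (by positivity)
    have h2 : (t * Y ω) ^ 2 ≤ 8 / c ^ 2 * t ^ 2 * Real.exp (c / 2 * F ω) := by
      have h3 := Real.quadratic_le_exp_of_nonneg (x := c / 2 * F ω) (by positivity)
      have h4 : (c / 2 * F ω) ^ 2 / 2 ≤ Real.exp (c / 2 * F ω) := by
        have : 0 ≤ c / 2 * F ω := by positivity
        linarith
      have h5 : Y ω ^ 2 ≤ F ω ^ 2 := by rw [← sq_abs]; gcongr; exact hYF ω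
      calc (t * Y ω) ^ 2 ≤ t ^ 2 * F ω ^ 2 := by rw [mul_pow]; gcongr
        _ = 8 / c ^ 2 * t ^ 2 * ((c / 2 * F ω) ^ 2 / 2) := by field_simp; ring
        _ ≤ _ := by gcongr
    calc (t * Y ω) ^ 2 * Real.exp |t * Y ω|
        ≤ (8 / c ^ 2 * t ^ 2 * Real.exp (c / 2 * F ω)) * Real.exp (c / 2 * F ω) := by gcongr
      _ = _ := by rw [mul_assoc, ← Real.exp_add]; ring_nf
  have hint1 : Integrable (fun ω => Real.exp (t * Y ω)) μ :=
    integrable_exp_mul_of_abs_le hY hYF hint (ht.trans (by linarith))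
  have hlin : Integrable (fun ω => 1 + t * Y ω) μ := (integrable_const _).add (hYi.const_mul t)
  have hb : ∫ ω, Real.exp (t * Y ω) ∂μ ≤ 1 + t * ∫ ω, Y ω ∂μ + 8 / c ^ 2 * t ^ 2 * K := by
    calc ∫ ω, Real.exp (t * Y ω) ∂μ
        ≤ ∫ ω, (1 + t * Y ω + (8 / c ^ 2 * t ^ 2) * Real.exp (c * F ω)) ∂μ :=
          integral_mono hint1 (hlin.add (hint.const_mul _)) hpt
      _ = 1 + t * ∫ ω, Y ω ∂μ + (8 / c ^ 2 * t ^ 2) * ∫ ω, Real.exp (c * F ω) ∂μ := by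
          rw [integral_add hlin (hint.const_mul _),
            integral_add (integrable_const _) (hYi.const_mul t), integral_const_mul,
            integral_const_mul]
          simp
      _ ≤ _ := by gcongr
  refine hb.trans ?_
  have h6 := Real.add_one_le_exp (t * ∫ ω, Y ω ∂μ + chernoffConst c K * t ^ 2)
  have h7 : 0 ≤ 1 / c * t ^ 2 := by positivity
  rw [chernoffConst] at h6 ⊢
  refine le_trans ?_ h6
  have : 8 / c ^ 2 * t ^ 2 * K = 8 * K / c ^ 2 * t ^ 2 := by ring
  nlinarith

/-- One-sided deviation bound for a sum of `m` independent copies. There is no factor in front of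
the exponential, which matters if the allowed failure probability is close to `1`. -/
theorem measure_sum_ge_le [IsProbabilityMeasure μ] (hc : 0 < c) (hK0 : 0 ≤ K) (hY : Measurable Y)
    (hYF : ∀ ω, |Y ω| ≤ F ω)
    (hint : Integrable (fun ω => Real.exp (c * F ω)) μ) (hK : ∫ ω, Real.exp (c * F ω) ∂μ ≤ K)
    {t : ℝ} (ht0 : 0 ≤ t) (ht1 : t ≤ 1) (m : ℕ) :
    Measure.pi (fun _ : Fin m => μ) {B | m * (∫ ω, Y ω ∂μ + t) ≤ ∑ i, Y (B i)} ≤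
      ENNReal.ofReal (Real.exp (-(m * t ^ 2 / (4 * chernoffConst c K)))) := by
  set A := chernoffConst c K with hA
  have hA0 : 1 / c ≤ A := by rw [hA, chernoffConst]; linarith [show 0 ≤ 8 * K / c ^ 2 by positivity]
  have hApos : 0 < A := lt_of_lt_of_le (by positivity) hA0
  -- the minimizer of `A s² - s t`; it is in the admissible range as `t ≤ 1` and `1 / c ≤ A`
  set s := t / (2 * A) with hs
  have hs0 : 0 ≤ s := by positivity
  have hsc : |s| ≤ c / 2 := by
    rw [abs_of_nonneg hs0, hs, div_le_iff₀ (by positivity)]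
    have : 1 ≤ c * A := by rw [div_le_iff₀ hc] at hA0; linarith
    nlinarith
  have hint1 : Integrable (fun ω => Real.exp (s * Y ω)) μ :=
    integrable_exp_mul_of_abs_le hY hYF hint (hsc.trans (by linarith))
  have hprod : ∀ B : Fin m → Ω, Real.exp (s * ∑ i, Y (B i)) = ∏ i, Real.exp (s * Y (B i)) := by
    intro B; rw [Finset.mul_sum, Real.exp_sum]
  have hint2 : Integrable (fun B : Fin m → Ω => Real.exp (s * ∑ i, Y (B i)))
      (Measure.pi fun _ => μ) := by
    simp only [hprod]
    exact Integrable.fintype_prod fun _ => hint1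
  have h1 := measure_ge_le_exp_mul_mgf (μ := Measure.pi (fun _ : Fin m => μ))
    (X := fun B => ∑ i, Y (B i)) (m * (∫ ω, Y ω ∂μ + t)) hs0 hint2
  have h2 : mgf (fun B => ∑ i, Y (B i)) (Measure.pi (fun _ : Fin m => μ)) s =
      (∫ ω, Real.exp (s * Y ω) ∂μ) ^ m := by
    rw [mgf]
    simp only [hprod]
    rw [integral_fintype_prod_eq_pow (ι := Fin m) (fun ω => Real.exp (s * Y ω)), Fintype.card_fin]
  have h3 : (∫ ω, Real.exp (s * Y ω) ∂μ) ^ m ≤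
      Real.exp (s * ∫ ω, Y ω ∂μ + A * s ^ 2) ^ m :=
    pow_le_pow_left₀ (integral_nonneg fun _ => (Real.exp_pos _).le)
      (integral_exp_mul_le hc hY hYF hint hK hsc) m
  rw [← ENNReal.ofReal_toReal (measure_ne_top _ _)]
  refine ENNReal.ofReal_le_ofReal (h1.trans ?_)
  rw [h2]
  refine (mul_le_mul_of_nonneg_left h3 (Real.exp_pos _).le).trans ?_
  rw [← Real.exp_nat_mul, ← Real.exp_add]
  refine Real.exp_le_exp.2 (le_of_eq ?_)
  rw [hs]; field_simp; ring

/-- Two-sided deviation bound, for a variable dominated by a multiple of `F`. -/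
theorem measure_abs_sum_sub_ge_le [IsProbabilityMeasure μ] {g : Ω → ℝ} {s : ℝ} (hs : 0 < s)
    (hc : 0 < c) (hK0 : 0 ≤ K)
    (hg : Measurable g) (hgF : ∀ ω, |g ω| ≤ s * F ω)
    (hint : Integrable (fun ω => Real.exp (c * F ω)) μ) (hK : ∫ ω, Real.exp (c * F ω) ∂μ ≤ K)
    {t : ℝ} (ht0 : 0 ≤ t) (ht1 : t ≤ 1) (m : ℕ) :
    Measure.pi (fun _ : Fin m => μ) {B | s * t * m ≤ |∑ i, g (B i) - m * ∫ ω, g ω ∂μ|} ≤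
      2 * ENNReal.ofReal (Real.exp (-(m * t ^ 2 / (4 * chernoffConst c K)))) := by
  have hYF : ∀ ω, |s⁻¹ * g ω| ≤ F ω := by
    intro ω
    rw [abs_mul, abs_of_pos (inv_pos.2 hs), inv_mul_le_iff₀ hs]
    exact hgF ω
  have h1 := measure_sum_ge_le hc hK0 (hg.const_mul s⁻¹) hYF hint hK ht0 ht1 m
  have h2 := measure_sum_ge_le (Y := fun ω => -(s⁻¹ * g ω)) hc hK0 (hg.const_mul s⁻¹).neg
    (fun ω => by rw [abs_neg]; exact hYF ω) hint hK ht0 ht1 m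
  rw [two_mul]
  refine (measure_mono ?_).trans ((measure_union_le _ _).trans (add_le_add h1 h2))
  intro B hB
  simp only [Set.mem_ofPred_eq] at hB
  simp only [Set.mem_union, Set.mem_ofPred_eq, integral_neg, integral_const_mul,
    Finset.sum_neg_distrib, ← Finset.mul_sum]
  rcases le_abs.1 hB with h | h
  · left
    rw [le_inv_mul_iff₀ hs]
    have : s * (m * (s⁻¹ * ∫ ω, g ω ∂μ + t)) = m * ∫ ω, g ω ∂μ + s * t * m := by field_simp
    rw [this]; linarith
  · right
    rw [le_neg, inv_mul_le_iff₀ hs]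
    have : s * -(m * (-(s⁻¹ * ∫ ω, g ω ∂μ) + t)) = m * ∫ ω, g ω ∂μ - s * t * m := by
      field_simp; ring
    rw [this]; linarith

end Chernoff

/-! ### Moments of bags -/

section Bags

variable {d q k : ℕ} {S : Matrix (Fin d) (Fin d) ℝ} {r : Vec d}

/-- The label of the `j`-th vector of a bag. -/
def bagLabel (k j : ℕ) : Fin 2 := if j < k then 1 else 0

theorem bagOracle_eq (D : Measure (Vec d)) (f : Vec d → Fin 2) (q k : ℕ) :
    bagOracle f D q k = Measure.pi fun j : Fin q => condLabel D f (bagLabel k j) := rfl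

theorem isProbabilityMeasure_bagOracle (hS : S.PosDef) (hr : r ≠ 0) :
    IsProbabilityMeasure (bagOracle (ltf r) (normal S) q k) := by
  have := fun a => isProbabilityMeasure_condLabel hS hr a
  rw [bagOracle_eq]
  infer_instance

theorem isProbabilityMeasure_sampleLaw (hS : S.PosDef) (hr : r ≠ 0) (m : ℕ) :
    IsProbabilityMeasure (sampleLaw (ltf r) (normal S) q k m) := by
  have := isProbabilityMeasure_bagOracle (q := q) (k := k) hS hr
  rw [sampleLaw]
  infer_instance

theorem sum_labelSign (hk : k ≤ q) : ∑ j : Fin q, labelSign (bagLabel k j) = 2 * k - q := by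
  rw [Fin.sum_univ_eq_sum_range (fun j => labelSign (bagLabel k j)) q]
  have h1 : ∀ j, labelSign (bagLabel k j) = (if j < k then 2 else 0) - 1 := by
    intro j
    by_cases h : j < k
    · simp [labelSign, bagLabel, h]; norm_num
    · simp [labelSign, bagLabel, h]
  simp only [h1, Finset.sum_sub_distrib, Finset.sum_const, Finset.card_range, nsmul_eq_mul, mul_one]
  congr 1
  rw [← Finset.sum_filter]
  have : (Finset.range q).filter (· < k) = Finset.range k := by
    ext j; simp; omega
  rw [this]; simp; ring

theorem sq_labelSign (a : Fin 2) : labelSign a * labelSign a = 1 := by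
  simp only [labelSign]; split_ifs <;> norm_num

theorem integral_bag_eval (hS : S.PosDef) (hr : r ≠ 0) (j : Fin q) {g : Vec d → ℝ}
    (hg : Measurable g) :
    ∫ b, g (b j) ∂(bagOracle (ltf r) (normal S) q k) =
      ∫ x, g x ∂(condLabel (normal S) (ltf r) (bagLabel k j)) := by
  have := fun a => isProbabilityMeasure_condLabel hS hr a
  rw [bagOracle_eq]
  exact integral_comp_eval (μ := fun j : Fin q => condLabel (normal S) (ltf r) (bagLabel k j))
    hg.aestronglyMeasurable

theorem integrable_bag_eval (hS : S.PosDef) (hr : r ≠ 0) (j : Fin q) {g : Vec d → ℝ}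
    (hg : Integrable g (condLabel (normal S) (ltf r) (bagLabel k j))) :
    Integrable (fun b => g (b j)) (bagOracle (ltf r) (normal S) q k) := by
  have := fun a => isProbabilityMeasure_condLabel hS hr a
  rw [bagOracle_eq]
  exact integrable_comp_eval (μ := fun j : Fin q => condLabel (normal S) (ltf r) (bagLabel k j)) hg

theorem integral_bag_gram (hS : S.PosDef) (hr : r ≠ 0) (n n' : Vec d) :
    ∫ b, ∑ j, (inner ℝ n (b j) : ℝ) * inner ℝ n' (b j) ∂(bagOracle (ltf r) (normal S) q k) =
      q * inner ℝ n (covOp S n') := by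
  rw [integral_finsetSum _ fun j _ => integrable_bag_eval
    (g := fun x => (inner ℝ n x : ℝ) * inner ℝ n' x) hS hr j
    (integrable_condLabel hS hr _ (integrable_inner_mul_inner n n'))]
  have h : ∀ j : Fin q, ∫ b, (inner ℝ n (b j) : ℝ) * inner ℝ n' (b j)
      ∂(bagOracle (ltf r) (normal S) q k) = inner ℝ n (covOp S n') := fun j => by
    rw [integral_bag_eval (g := fun x => (inner ℝ n x : ℝ) * inner ℝ n' x) hS hr j (by fun_prop),
      integral_inner_mul_inner_condLabel hS hr]
  simp [h]

theorem integral_bag_sum (hS : S.PosDef) (hr : r ≠ 0) (hk : k ≤ q) (n : Vec d) :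
    ∫ b, (inner ℝ n (∑ j, b j) : ℝ) ∂(bagOracle (ltf r) (normal S) q k) =
      (2 * k - q) * (absMean * inner ℝ n (meanDir S r)) := by
  simp only [inner_sum]
  rw [integral_finsetSum _ fun j _ => integrable_bag_eval
    (g := fun x => (inner ℝ n x : ℝ)) hS hr j (integrable_condLabel hS hr _ (integrable_inner n))]
  have h : ∀ j : Fin q, ∫ b, (inner ℝ n (b j) : ℝ) ∂(bagOracle (ltf r) (normal S) q k) =
      labelSign (bagLabel k j) * (absMean * inner ℝ n (meanDir S r)) := fun j => by
    rw [integral_bag_eval (g := fun x => (inner ℝ n x : ℝ)) hS hr j (by fun_prop),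
      integral_inner_condLabel hS hr]
  rw [Finset.sum_congr rfl fun j _ => h j, ← Finset.sum_mul, sum_labelSign hk]

/-- In a balanced bag the conditional means cancel in the sum. So the second moment of the bag sum
is its covariance, and each of the `q` independent vectors contributes its conditional covariance,
from which the square of the conditional mean is subtracted. -/
theorem integral_bag_sum_mul_sum (hS : S.PosDef) (hr : r ≠ 0) (hk : 2 * k = q) (n n' : Vec d) :
    ∫ b, (inner ℝ n (∑ j, b j) : ℝ) * inner ℝ n' (∑ j, b j) ∂(bagOracle (ltf r) (normal S) q k) =
      q * (inner ℝ n (covOp S n') -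
        absMean ^ 2 * (inner ℝ n (meanDir S r) * inner ℝ n' (meanDir S r))) := by
  classical
  have hp := fun a => isProbabilityMeasure_condLabel hS hr a
  have hpb := isProbabilityMeasure_bagOracle (q := q) (k := k) hS hr
  set P := absMean * (inner ℝ n (meanDir S r) : ℝ) with hP
  set P' := absMean * (inner ℝ n' (meanDir S r) : ℝ) with hP'
  have hmem : ∀ (w : Vec d) (j : Fin q), MemLp (fun b : Fin q → Vec d => (inner ℝ w (b j) : ℝ)) 2
      (bagOracle (ltf r) (normal S) q k) := by
    intro w j
    rw [memLp_two_iff_integrable_sq (Measurable.aestronglyMeasurable (by fun_prop))]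
    simp only [sq]
    exact integrable_bag_eval (g := fun x => (inner ℝ w x : ℝ) * inner ℝ w x) hS hr j
      (integrable_condLabel hS hr _ (integrable_inner_mul_inner w w))
  have hterm : ∀ i j : Fin q, ∫ b, (inner ℝ n (b i) : ℝ) * inner ℝ n' (b j)
      ∂(bagOracle (ltf r) (normal S) q k) =
      labelSign (bagLabel k i) * labelSign (bagLabel k j) * (P * P') +
        (if i = j then inner ℝ n (covOp S n') - P * P' else 0) := by
    intro i j
    split_ifs with hij
    · subst hij
      rw [integral_bag_eval (g := fun x => (inner ℝ n x : ℝ) * inner ℝ n' x) hS hr i (by fun_prop),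
        integral_inner_mul_inner_condLabel hS hr, sq_labelSign]
      ring
    · have hI := (iIndepFun_pi (μ := fun j : Fin q => condLabel (normal S) (ltf r) (bagLabel k j))
        (X := fun _ x => x) fun _ => aemeasurable_id).indepFun hij
      rw [← bagOracle_eq] at hI
      rw [hI.integral_fun_comp_mul_comp (f := fun x => (inner ℝ n x : ℝ))
        (g := fun x => (inner ℝ n' x : ℝ)) (measurable_pi_apply i).aemeasurable
        (measurable_pi_apply j).aemeasurable (by fun_prop) (by fun_prop),
        integral_bag_eval (g := fun x => (inner ℝ n x : ℝ)) hS hr i (by fun_prop),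
        integral_bag_eval (g := fun x => (inner ℝ n' x : ℝ)) hS hr j (by fun_prop),
        integral_inner_condLabel hS hr, integral_inner_condLabel hS hr]
      ring
  have hexp : ∀ b : Fin q → Vec d, (inner ℝ n (∑ j, b j) : ℝ) * inner ℝ n' (∑ j, b j) =
      ∑ i, ∑ j, (inner ℝ n (b i) : ℝ) * inner ℝ n' (b j) := by
    intro b; rw [inner_sum, inner_sum, Finset.sum_mul_sum]
  simp only [hexp]
  have hint : ∀ i j : Fin q, Integrable (fun b => (inner ℝ n (b i) : ℝ) * inner ℝ n' (b j))
      (bagOracle (ltf r) (normal S) q k) := fun i j => (hmem n i).integrable_mul (hmem n' j)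
  rw [integral_finsetSum _ fun i _ => integrable_finsetSum _ fun j _ => hint i j]
  have h1 : ∀ i : Fin q, ∫ b, ∑ j, (inner ℝ n (b i) : ℝ) * inner ℝ n' (b j)
      ∂(bagOracle (ltf r) (normal S) q k) =
      labelSign (bagLabel k i) * (∑ j : Fin q, labelSign (bagLabel k j)) * (P * P') +
        (inner ℝ n (covOp S n') - P * P') := by
    intro i
    rw [integral_finsetSum _ fun j _ => hint i j, Finset.sum_congr rfl fun j _ => hterm i j,
      Finset.sum_add_distrib, ← Finset.sum_mul, ← Finset.mul_sum]
    simp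
  have h0 : (2 * k - q : ℝ) = 0 := by rw [← hk]; push_cast; ring
  rw [Finset.sum_congr rfl fun i _ => h1 i, sum_labelSign (by omega), h0]
  simp only [mul_zero, zero_mul, zero_add, Finset.sum_const, Finset.card_univ, Fintype.card_fin,
    nsmul_eq_mul]
  rw [hP, hP']; ring

/-- A common majorant for the statistics of a bag in the directions `n`, `n'`. -/
noncomputable def bagMajorant (L : ℝ) (n n' : Vec d) (b : Fin q → Vec d) : ℝ :=
  1 + (q : ℝ)⁻¹ * ∑ j, ((inner ℝ n (b j) : ℝ) ^ 2 / L + (inner ℝ n' (b j) : ℝ) ^ 2 / L)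

/-- Jensen's inequality moves the exponential into the average over the bag, so that the exponential
moment does not depend on `q`. -/
theorem bagMajorant_exp_moment (hS : S.PosDef) (hr : r ≠ 0) (hq : 0 < q) {c K L : ℝ} (hc : 0 < c)
    (hmom : ∀ (a : Fin 2) (w : Vec d), quad S w ≤ L →
      Integrable (fun x => Real.exp (c * ((inner ℝ w x : ℝ) ^ 2 / L)))
        (condLabel (normal S) (ltf r) a) ∧
      ∫ x, Real.exp (c * ((inner ℝ w x : ℝ) ^ 2 / L)) ∂(condLabel (normal S) (ltf r) a) ≤ K)
    {n n' : Vec d} (hn : quad S n ≤ L) (hn' : quad S n' ≤ L) :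
    Integrable (fun b => Real.exp (c / 2 * bagMajorant L n n' b))
      (bagOracle (ltf r) (normal S) q k) ∧
    ∫ b, Real.exp (c / 2 * bagMajorant L n n' b) ∂(bagOracle (ltf r) (normal S) q k) ≤
      Real.exp (c / 2) * (2 * K) := by
  have hq' : (0 : ℝ) < q := by exact_mod_cast hq
  set e : Vec d → Vec d → ℝ := fun w x => Real.exp (c * ((inner ℝ w x : ℝ) ^ 2 / L)) with he
  set R : (Fin q → Vec d) → ℝ := fun b =>
    Real.exp (c / 2) * ∑ j, (q : ℝ)⁻¹ * (e n (b j) + e n' (b j)) with hR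
  have hpt : ∀ b : Fin q → Vec d, Real.exp (c / 2 * bagMajorant L n n' b) ≤ R b := by
    intro b
    set z : Fin q → ℝ := fun j =>
      c / 2 * ((inner ℝ n (b j) : ℝ) ^ 2 / L + (inner ℝ n' (b j) : ℝ) ^ 2 / L) with hz
    have h1 : c / 2 * bagMajorant L n n' b = c / 2 + ∑ j, (q : ℝ)⁻¹ • z j := by
      simp only [bagMajorant, hz, smul_eq_mul, mul_add, mul_one, Finset.mul_sum]
      congr 1
      exact Finset.sum_congr rfl fun j _ => by ring
    rw [h1, Real.exp_add]
    refine mul_le_mul_of_nonneg_left ?_ (Real.exp_pos _).le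
    refine (convexOn_exp.map_sum_le (t := Finset.univ) (w := fun _ => (q : ℝ)⁻¹) (p := z)
      (fun _ _ => by positivity) (by simp [hq'.ne']) (fun _ _ => Set.mem_univ _)).trans ?_
    refine Finset.sum_le_sum fun j _ => ?_
    rw [smul_eq_mul]
    refine mul_le_mul_of_nonneg_left ?_ (by positivity)
    -- the exponential of an average of two numbers is at most the sum of the exponentials
    rcases le_total ((inner ℝ n (b j) : ℝ) ^ 2 / L) ((inner ℝ n' (b j) : ℝ) ^ 2 / L) with h | h
    · refine le_trans (Real.exp_le_exp.2 ?_) (le_add_of_nonneg_left (Real.exp_pos _).le)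
      simp only [hz]; nlinarith
    · refine le_trans (Real.exp_le_exp.2 ?_) (le_add_of_nonneg_right (Real.exp_pos _).le)
      simp only [hz]; nlinarith
  have hie : ∀ (w : Vec d), quad S w ≤ L → ∀ j : Fin q, Integrable (fun b => e w (b j))
      (bagOracle (ltf r) (normal S) q k) := fun w hw j =>
    integrable_bag_eval (g := e w) hS hr j (hmom _ w hw).1
  have hie2 : ∀ j : Fin q, Integrable (fun b => (q : ℝ)⁻¹ * (e n (b j) + e n' (b j)))
      (bagOracle (ltf r) (normal S) q k) := fun j =>
    ((hie n hn j).add (hie n' hn' j)).const_mul _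
  have hRint : Integrable R (bagOracle (ltf r) (normal S) q k) :=
    (integrable_finsetSum _ fun j _ => hie2 j).const_mul _
  have hint : Integrable (fun b => Real.exp (c / 2 * bagMajorant L n n' b))
      (bagOracle (ltf r) (normal S) q k) := by
    refine hRint.mono' ?_ (Filter.Eventually.of_forall fun b => ?_)
    · simp only [bagMajorant]; fun_prop
    · rw [Real.norm_of_nonneg (Real.exp_pos _).le]; exact hpt b
  refine ⟨hint, (integral_mono hint hRint hpt).trans ?_⟩
  have hem : ∀ w, Measurable (e w) := fun w => by simp only [he]; fun_prop
  have hbound : ∀ (w : Vec d), quad S w ≤ L → ∀ j : Fin q,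
      ∫ b, e w (b j) ∂(bagOracle (ltf r) (normal S) q k) ≤ K := fun w hw j => by
    rw [integral_bag_eval hS hr j (hem w)]; exact (hmom _ w hw).2
  rw [hR, integral_const_mul, integral_finsetSum _ fun j _ => hie2 j]
  gcongr
  calc ∑ j, ∫ b, (q : ℝ)⁻¹ * (e n (b j) + e n' (b j)) ∂(bagOracle (ltf r) (normal S) q k)
      ≤ ∑ _j : Fin q, (q : ℝ)⁻¹ * (K + K) := by
        refine Finset.sum_le_sum fun j _ => ?_
        rw [integral_const_mul, integral_add (hie n hn j) (hie n' hn' j)]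
        gcongr
        exacts [hbound n hn j, hbound n' hn' j]
    _ = 2 * K := by
        rw [Finset.sum_const, Finset.card_univ, Fintype.card_fin, nsmul_eq_mul]
        field_simp; ring

theorem abs_bag_gram_le {L : ℝ} (hL : 0 < L) (hq : 0 < q) (n n' : Vec d) (b : Fin q → Vec d) :
    |∑ j, (inner ℝ n (b j) : ℝ) * inner ℝ n' (b j)| ≤ q * L * bagMajorant L n n' b := by
  have hq' : (0 : ℝ) < q := by exact_mod_cast hq
  have h1 : q * L * bagMajorant L n n' b =
      q * L + ∑ j, ((inner ℝ n (b j) : ℝ) ^ 2 + (inner ℝ n' (b j) : ℝ) ^ 2) := by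
    simp only [bagMajorant, ← add_div, ← Finset.sum_div]
    field_simp
  rw [h1]
  refine (Finset.abs_sum_le_sum_abs _ _).trans (le_add_of_nonneg_of_le (by positivity) ?_)
  refine Finset.sum_le_sum fun j _ => ?_
  rw [abs_le]
  constructor <;> nlinarith [sq_nonneg ((inner ℝ n (b j) : ℝ) + inner ℝ n' (b j)),
    sq_nonneg ((inner ℝ n (b j) : ℝ) - inner ℝ n' (b j)), sq_nonneg (inner ℝ n (b j) : ℝ),
    sq_nonneg (inner ℝ n' (b j) : ℝ)]

theorem abs_bag_sum_mul_sum_le {L : ℝ} (hL : 0 < L) (hq : 0 < q) (n n' : Vec d)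
    (b : Fin q → Vec d) :
    |(inner ℝ n (∑ j, b j) : ℝ) * inner ℝ n' (∑ j, b j)| ≤ q ^ 2 * L * bagMajorant L n n' b := by
  have hq' : (0 : ℝ) < q := by exact_mod_cast hq
  have h1 : q ^ 2 * L * bagMajorant L n n' b =
      q ^ 2 * L + q * ∑ j, ((inner ℝ n (b j) : ℝ) ^ 2 + (inner ℝ n' (b j) : ℝ) ^ 2) := by
    simp only [bagMajorant, ← add_div, ← Finset.sum_div]
    field_simp
  have h2 : ∀ w : Vec d, (inner ℝ w (∑ j, b j) : ℝ) ^ 2 ≤ q * ∑ j, (inner ℝ w (b j) : ℝ) ^ 2 := by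
    intro w
    rw [inner_sum]
    simpa using sq_sum_le_card_mul_sum_sq (s := Finset.univ) (f := fun j => (inner ℝ w (b j) : ℝ))
  rw [h1, Finset.sum_add_distrib]
  have h3 := h2 n
  have h4 := h2 n'
  have h5 : 0 ≤ (q : ℝ) ^ 2 * L := by positivity
  rw [abs_le]
  constructor <;> nlinarith [sq_nonneg ((inner ℝ n (∑ j, b j) : ℝ) + inner ℝ n' (∑ j, b j)),
    sq_nonneg ((inner ℝ n (∑ j, b j) : ℝ) - inner ℝ n' (∑ j, b j))]

theorem abs_bag_sum_le {L : ℝ} (hL : 0 < L) (hq : 0 < q) (n n' : Vec d) (b : Fin q → Vec d) :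
    |(inner ℝ n (∑ j, b j) : ℝ)| ≤ q * Real.sqrt L * bagMajorant L n n' b := by
  have hq' : (0 : ℝ) < q := by exact_mod_cast hq
  have hs := Real.sqrt_pos.2 hL
  have hs2 := Real.sq_sqrt hL.le
  have h1 : q * Real.sqrt L * bagMajorant L n n' b = ∑ j, (Real.sqrt L +
      ((inner ℝ n (b j) : ℝ) ^ 2 + (inner ℝ n' (b j) : ℝ) ^ 2) / Real.sqrt L) := by
    simp only [bagMajorant, ← add_div, ← Finset.sum_div, Finset.sum_add_distrib, Finset.sum_const,
      Finset.card_univ, Fintype.card_fin, nsmul_eq_mul]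
    rw [← hs2]
    field_simp
    rw [Real.sqrt_sq hs.le]
  rw [h1, inner_sum]
  refine (Finset.abs_sum_le_sum_abs _ _).trans (Finset.sum_le_sum fun j _ => ?_)
  rw [← sub_le_iff_le_add', le_div_iff₀ hs]
  rw [← sq_abs (inner ℝ n (b j) : ℝ)]
  nlinarith [sq_nonneg (|(inner ℝ n (b j) : ℝ)| - Real.sqrt L), sq_nonneg (inner ℝ n' (b j) : ℝ),
    abs_nonneg (inner ℝ n (b j) : ℝ)]

end Bags

/-! ### The typical sample -/

section Typical

variable {d q k m : ℕ} {S : Matrix (Fin d) (Fin d) ℝ} {r : Vec d}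

/-- The empirical second moments of the vectors, the empirical mean of the bag sums and, for
balanced bags, the empirical second moments of the bag sums are close to their expectations, with
relative accuracy `η` on their natural scales. -/
structure Typical (hS : S.PosDef) (r : Vec d) (k : ℕ) (η : ℝ) (B : Fin m → Fin q → Vec d) :
    Prop where
  gram : ∀ x, ‖gramOp (allVecs B) x - (m * q : ℝ) • covOp S x‖ ≤
    4 * (q * lamMax hS.isHermitian * η * m) * ‖x‖
  mean : ‖∑ i, bagSum B i - (m * ((2 * k - q) * absMean) : ℝ) • meanDir S r‖ ≤
    2 * (q * Real.sqrt (lamMax hS.isHermitian) * η * m)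
  diff : 2 * k = q → ∀ x, ‖gramOp (bagSum B) x - (m * q : ℝ) •
    (covOp S x - (absMean ^ 2 * inner ℝ (meanDir S r) x) • meanDir S r)‖ ≤
    4 * (q ^ 2 * lamMax hS.isHermitian * η * m) * ‖x‖

theorem sum_allVecs_relist (σ : Fin m → Equiv.Perm (Fin q)) (B : Fin m → Fin q → Vec d)
    {E : Type*} [AddCommMonoid E] (f : Vec d → E) :
    ∑ p, f (allVecs (relist σ B) p) = ∑ p, f (allVecs B p) := by
  rw [Fintype.sum_prod_type, Fintype.sum_prod_type]
  exact Finset.sum_congr rfl fun i _ => Equiv.sum_comp (σ i) fun j => f (B i j)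

theorem gramOp_allVecs_relist (σ : Fin m → Equiv.Perm (Fin q)) (B : Fin m → Fin q → Vec d) :
    gramOp (allVecs (relist σ B)) = gramOp (allVecs B) :=
  sum_allVecs_relist σ B fun x => (innerₛₗ ℝ x).smulRight x

theorem bagSum_relist (σ : Fin m → Equiv.Perm (Fin q)) (B : Fin m → Fin q → Vec d) :
    bagSum (relist σ B) = bagSum B := by
  funext i
  exact Equiv.sum_comp (σ i) fun j => B i j

/-- Being typical does not depend on the order in which the bags are listed. -/
theorem Typical.relist {hS : S.PosDef} {η : ℝ} {B : Fin m → Fin q → Vec d}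
    (h : Typical hS r k η B) (σ : Fin m → Equiv.Perm (Fin q)) :
    Typical hS r k η (LLP.relist σ B) := by
  obtain ⟨h1, h2, h3⟩ := h
  refine ⟨?_, ?_, ?_⟩
  · rwa [gramOp_allVecs_relist]
  · rwa [bagSum_relist]
  · rwa [bagSum_relist]

theorem covOp_sub_isSymmetric (hS : S.PosDef) (a b : ℝ) (u : Vec d) :
    (LinearMap.IsSymmetric (a • (covOp S - b • (innerₛₗ ℝ u).smulRight u))) := by
  intro x y
  simp only [LinearMap.smul_apply, LinearMap.sub_apply, LinearMap.smulRight_apply,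
    innerₛₗ_apply_apply, real_inner_smul_left, real_inner_smul_right, inner_sub_left,
    inner_sub_right, covOp_isSymmetric hS.isHermitian x y]
  rw [real_inner_comm x u]
  ring

/-- It suffices to test a sample in the directions of a net. -/
theorem typical_of_net (hS : S.PosDef) {N : Finset (Vec d)} (hN : IsNet N) {η : ℝ}
    {B : Fin m → Fin q → Vec d}
    (h1 : ∀ n ∈ N, ∀ n' ∈ N, |∑ i, ∑ j, (inner ℝ n (B i j) : ℝ) * inner ℝ n' (B i j) -
      m * (q * inner ℝ n (covOp S n'))| ≤ q * lamMax hS.isHermitian * η * m)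
    (h2 : ∀ n ∈ N, |∑ i, (inner ℝ n (∑ j, B i j) : ℝ) -
      m * ((2 * k - q) * (absMean * inner ℝ n (meanDir S r)))| ≤
        q * Real.sqrt (lamMax hS.isHermitian) * η * m)
    (h3 : 2 * k = q → ∀ n ∈ N, ∀ n' ∈ N, |∑ i, (inner ℝ n (∑ j, B i j) : ℝ) *
      inner ℝ n' (∑ j, B i j) - m * (q * (inner ℝ n (covOp S n') -
        absMean ^ 2 * (inner ℝ n (meanDir S r) * inner ℝ n' (meanDir S r))))| ≤
        q ^ 2 * lamMax hS.isHermitian * η * m) :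
    Typical hS r k η B := by
  refine ⟨fun x => ?_, ?_, fun hk x => ?_⟩
  · have hA : LinearMap.IsSymmetric (gramOp (allVecs B) - (m * q : ℝ) • covOp S) := by
      have h := (gramOp_isSymmetric (allVecs B)).sub (covOp_sub_isSymmetric hS (m * q) 0 0)
      simpa using h
    refine hN.norm_apply_le hA (fun n hn n' hn' => ?_) x
    have e : (inner ℝ n ((gramOp (allVecs B) - (m * q : ℝ) • covOp S) n') : ℝ) =
        ∑ i, ∑ j, (inner ℝ n (B i j) : ℝ) * inner ℝ n' (B i j) - m * (q * inner ℝ n (covOp S n')) := by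
      rw [LinearMap.sub_apply, inner_sub_right, LinearMap.smul_apply, real_inner_smul_right,
        real_inner_comm, inner_gramOp, Fintype.sum_prod_type]
      congr 1
      · refine Finset.sum_congr rfl fun i _ => Finset.sum_congr rfl fun j _ => ?_
        rw [real_inner_comm n', real_inner_comm n, mul_comm]; rfl
      · ring
    rw [e]
    exact h1 n hn n' hn'
  · refine hN.norm_le fun n hn => ?_
    have e : (inner ℝ n (∑ i, bagSum B i - (m * ((2 * k - q) * absMean) : ℝ) • meanDir S r) : ℝ) =
        ∑ i, (inner ℝ n (∑ j, B i j) : ℝ) -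
          m * ((2 * k - q) * (absMean * inner ℝ n (meanDir S r))) := by
      rw [inner_sub_right, real_inner_smul_right, inner_sum]
      simp only [bagSum]
      ring
    rw [e]
    exact h2 n hn
  · set A : Vec d →ₗ[ℝ] Vec d := gramOp (bagSum B) - (m * q : ℝ) •
      (covOp S - absMean ^ 2 • (innerₛₗ ℝ (meanDir S r)).smulRight (meanDir S r)) with hAdef
    have hA : A.IsSymmetric :=
      (gramOp_isSymmetric (bagSum B)).sub (covOp_sub_isSymmetric hS (m * q) (absMean ^ 2) _)
    have hAx : ∀ x, A x = gramOp (bagSum B) x - (m * q : ℝ) •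
        (covOp S x - (absMean ^ 2 * inner ℝ (meanDir S r) x) • meanDir S r) := by
      intro x
      simp [A, smul_smul]
    rw [← hAx]
    refine hN.norm_apply_le hA (fun n hn n' hn' => ?_) x
    have e : (inner ℝ n (A n') : ℝ) = ∑ i, (inner ℝ n (∑ j, B i j) : ℝ) *
        inner ℝ n' (∑ j, B i j) - m * (q * (inner ℝ n (covOp S n') -
          absMean ^ 2 * (inner ℝ n (meanDir S r) * inner ℝ n' (meanDir S r)))) := by
      rw [hAx, inner_sub_right, real_inner_smul_right, inner_sub_right, real_inner_smul_right,
        real_inner_comm, inner_gramOp, real_inner_comm n' (meanDir S r)]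
      congr 1
      · refine Finset.sum_congr rfl fun i _ => ?_
        rw [real_inner_comm n', real_inner_comm n, mul_comm]; rfl
      · ring
    rw [e]
    exact h3 hk n hn n' hn'

/-- Samples are typical with high probability, and in a fixed direction the mean of the bag sums
obeys a one-sided bound without a factor in front of the exponential. -/
theorem exists_typical_bound : ∃ a : ℝ, 0 < a ∧
    ∀ (d q k m : ℕ) (S : Matrix (Fin d) (Fin d) ℝ) (hS : S.PosDef) (r : Vec d) (η : ℝ),
      0 < d → 0 < q → k ≤ q → r ≠ 0 → 0 ≤ η → η ≤ 1 →
      sampleLaw (ltf r) (normal S) q k m {B | ¬ Typical hS r k η B} ≤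
        ENNReal.ofReal (6 * 25 ^ d * Real.exp (-(a * (m * η ^ 2)))) ∧
      ∀ n : Vec d, ‖n‖ ≤ 1 → sampleLaw (ltf r) (normal S) q k m
        {B | m * ((2 * k - q) * (absMean * inner ℝ n (meanDir S r)) +
          q * Real.sqrt (lamMax hS.isHermitian) * η) ≤ ∑ i, (inner ℝ n (∑ j, B i j) : ℝ)} ≤
        ENNReal.ofReal (Real.exp (-(a * (m * η ^ 2)))) := by
  obtain ⟨c, K, hc, hK1, hmom⟩ := exists_exp_moment
  set K' := Real.exp (c / 2) * (2 * K) with hK'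
  have hK'0 : 0 ≤ K' := by positivity
  set A := chernoffConst (c / 2) K' with hA
  have hA0 : 0 < A := by rw [hA, chernoffConst]; positivity
  refine ⟨1 / (4 * A), by positivity, ?_⟩
  intro d q k m S hS r η hd hq hk hr hη0 hη1
  have hq' : (0 : ℝ) < q := by exact_mod_cast hq
  set L := lamMax hS.isHermitian with hLdef
  have hL : 0 < L := lt_of_lt_of_le (lamMin_pos hS hd) (lamMin_le_lamMax _ hd)
  have hprob := isProbabilityMeasure_bagOracle (q := q) (k := k) hS hr
  have hquad : ∀ n : Vec d, ‖n‖ ≤ 1 → quad S n ≤ L := by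
    intro n hn
    refine (quad_le_lamMax_mul hS n).trans ?_
    have : ‖n‖ ^ 2 ≤ 1 := pow_le_one₀ (norm_nonneg n) hn
    nlinarith
  have hF : ∀ n n' : Vec d, ‖n‖ ≤ 1 → ‖n'‖ ≤ 1 →
      Integrable (fun b => Real.exp (c / 2 * bagMajorant L n n' b))
        (bagOracle (ltf r) (normal S) q k) ∧
      ∫ b, Real.exp (c / 2 * bagMajorant L n n' b) ∂(bagOracle (ltf r) (normal S) q k) ≤ K' :=
    fun n n' hn hn' => bagMajorant_exp_moment hS hr hq hc
      (fun a w hw => hmom d S hS r hr a w L hL hw) (hquad n hn) (hquad n' hn')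
  have hexp : Real.exp (-(m * η ^ 2 / (4 * A))) = Real.exp (-(1 / (4 * A) * (m * η ^ 2))) := by
    congr 1; ring
  set E := Real.exp (-(1 / (4 * A) * (m * η ^ 2))) with hE
  have hE0 : 0 < E := Real.exp_pos _
  constructor
  · obtain ⟨N, hcard, hN⟩ := exists_net d
    have hN1 := hN.1
    -- the three kinds of deviations in a pair of directions
    set bad : Vec d × Vec d → Set (Fin m → Fin q → Vec d) := fun p =>
      ({B | q * L * η * m ≤ |∑ i, ∑ j, (inner ℝ p.1 (B i j) : ℝ) * inner ℝ p.2 (B i j) -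
        m * ∫ b, ∑ j, (inner ℝ p.1 (b j) : ℝ) * inner ℝ p.2 (b j)
          ∂(bagOracle (ltf r) (normal S) q k)|} ∪
      {B | q * Real.sqrt L * η * m ≤ |∑ i, (inner ℝ p.1 (∑ j, B i j) : ℝ) -
        m * ∫ b, (inner ℝ p.1 (∑ j, b j) : ℝ) ∂(bagOracle (ltf r) (normal S) q k)|}) ∪
      {B | q ^ 2 * L * η * m ≤ |∑ i, (inner ℝ p.1 (∑ j, B i j) : ℝ) * inner ℝ p.2 (∑ j, B i j) -
        m * ∫ b, (inner ℝ p.1 (∑ j, b j) : ℝ) * inner ℝ p.2 (∑ j, b j)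
          ∂(bagOracle (ltf r) (normal S) q k)|} with hbad
    have hbadm : ∀ p ∈ N ×ˢ N, sampleLaw (ltf r) (normal S) q k m (bad p) ≤
        ENNReal.ofReal (6 * E) := by
      intro p hp
      obtain ⟨hp1, hp2⟩ := Finset.mem_product.1 hp
      obtain ⟨f1, f2⟩ := hF p.1 p.2 (hN1 _ hp1) (hN1 _ hp2)
      have b1 := measure_abs_sum_sub_ge_le (s := q * L) (by positivity) (by positivity) hK'0
        (by fun_prop) (abs_bag_gram_le hL hq p.1 p.2) f1 f2 hη0 hη1 m
      have b2 := measure_abs_sum_sub_ge_le (s := q * Real.sqrt L) (by positivity) (by positivity)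
        hK'0 (by fun_prop) (abs_bag_sum_le hL hq p.1 p.2) f1 f2 hη0 hη1 m
      have b3 := measure_abs_sum_sub_ge_le (s := q ^ 2 * L) (by positivity) (by positivity) hK'0
        (by fun_prop) (abs_bag_sum_mul_sum_le hL hq p.1 p.2) f1 f2 hη0 hη1 m
      rw [← hA, hexp] at b1 b2 b3
      refine ((measure_union_le _ _).trans (add_le_add ((measure_union_le _ _).trans
        (add_le_add b1 b2)) b3)).trans (le_of_eq ?_)
      rw [ENNReal.ofReal_mul (by norm_num), ← add_mul, ← add_mul]
      norm_num
    have hsub : {B | ¬ Typical hS r k η B} ⊆ ⋃ p ∈ N ×ˢ N, bad p := by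
      intro B hB
      by_contra hcon
      refine hB (typical_of_net hS hN (fun n hn n' hn' => ?_) (fun n hn => ?_)
        fun hk2 n hn n' hn' => ?_)
      all_goals
        simp only [Set.mem_iUnion, not_exists] at hcon
      · have h := hcon (n, n') (Finset.mk_mem_product hn hn')
        simp only [hbad, Set.mem_union, Set.mem_ofPred_eq, not_or, not_le] at h
        rw [integral_bag_gram hS hr] at h
        exact h.1.1.le
      · have h := hcon (n, n) (Finset.mk_mem_product hn hn)
        simp only [hbad, Set.mem_union, Set.mem_ofPred_eq, not_or, not_le] at h
        rw [integral_bag_sum hS hr hk] at h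
        exact h.1.2.le
      · have h := hcon (n, n') (Finset.mk_mem_product hn hn')
        simp only [hbad, Set.mem_union, Set.mem_ofPred_eq, not_or, not_le] at h
        rw [integral_bag_sum_mul_sum hS hr hk2] at h
        exact h.2.le
    refine (measure_mono hsub).trans ((measure_biUnion_finset_le _ _).trans
      ((Finset.sum_le_card_nsmul _ _ _ hbadm).trans ?_))
    have hcard2 : ((N ×ˢ N).card : ℝ) ≤ 25 ^ d := by
      rw [Finset.card_product]
      calc ((N.card * N.card : ℕ) : ℝ) ≤ ((5 ^ d * 5 ^ d : ℕ) : ℝ) := by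
            exact_mod_cast Nat.mul_le_mul hcard hcard
        _ = 25 ^ d := by push_cast; rw [← mul_pow]; norm_num
    rw [nsmul_eq_mul, ← ENNReal.ofReal_natCast, ← ENNReal.ofReal_mul (by positivity)]
    refine ENNReal.ofReal_le_ofReal ?_
    calc ((N ×ˢ N).card : ℝ) * (6 * E) ≤ 25 ^ d * (6 * E) := by gcongr
      _ = _ := by ring
  · intro n hn
    obtain ⟨f1, f2⟩ := hF n n hn hn
    have hs : 0 < q * Real.sqrt L := by have := Real.sqrt_pos.2 hL; positivity
    have h := measure_sum_ge_le (Y := fun b : Fin q → Vec d =>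
      (q * Real.sqrt L)⁻¹ * (inner ℝ n (∑ j, b j) : ℝ)) (F := bagMajorant L n n)
      (by positivity) hK'0 (by fun_prop) (fun b => by
        rw [abs_mul, abs_of_pos (inv_pos.2 hs), inv_mul_le_iff₀ hs]
        exact abs_bag_sum_le hL hq n n b) f1 f2 hη0 hη1 m
    rw [← hA, hexp] at h
    refine le_trans (measure_mono ?_) h
    intro B hB
    simp only [Set.mem_ofPred_eq] at hB ⊢
    rw [integral_const_mul, integral_bag_sum hS hr hk, ← Finset.mul_sum, le_inv_mul_iff₀ hs]
    refine le_trans (le_of_eq ?_) hB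
    field_simp

end Typical

/-! ### A typical sample leads to a good hypothesis -/

section Accuracy

variable {d q k m : ℕ} {S : Matrix (Fin d) (Fin d) ℝ} {r : Vec d}

theorem dim_pos (hr : ‖r‖ = 1) : 0 < d := by
  rcases Nat.eq_zero_or_pos d with rfl | hd
  · rw [Subsingleton.elim r 0, norm_zero] at hr
    exact absurd hr zero_ne_one
  · exact hd

/-- The vector that the algorithm returns, given the right-hand side `v`. -/
noncomputable def solution (B : Fin m → Fin q → Vec d) (v : Vec d) : Vec d :=
  (richardson (gramOp (allVecs B)) (∑ p, ‖allVecs B p‖ ^ 2) v)^[m] 0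

/-- The sum of the squared lengths is the trace of the Gram operator. -/
theorem sum_norm_sq_eq_trace {ι : Type*} [Fintype ι] (X : ι → Vec d) :
    ∑ i, ‖X i‖ ^ 2 = ∑ j : Fin d, inner ℝ (gramOp X (EuclideanSpace.single j 1))
      (EuclideanSpace.single j 1) := by
  simp_rw [inner_gramOp]
  rw [Finset.sum_comm]
  refine Finset.sum_congr rfl fun i _ => ?_
  rw [EuclideanSpace.norm_sq_eq]
  refine Finset.sum_congr rfl fun j _ => ?_
  simp [EuclideanSpace.inner_single_right, sq]

/-- On a typical sample the iteration is accurate: `ρ` is nearly reached if the right-hand side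
is nearly the image of `ρ` under the expected Gram operator. -/
theorem Typical.norm_solution_sub_le {hS : S.PosDef} {η χ : ℝ} {B : Fin m → Fin q → Vec d}
    (hB : Typical hS r k η B) (hd : 0 < d) (hq : 0 < q) (hη : 0 < η)
    (hηκ : 8 * (η * (lamMax hS.isHermitian / lamMin hS.isHermitian)) ≤ 1) (hm : d ≤ m * η ^ 2)
    {v ρ : Vec d}
    (hv : ‖v - (m * q : ℝ) • covOp S ρ‖ ≤ χ * (m * q * lamMin hS.isHermitian * ‖ρ‖)) :
    ‖solution B v - ρ‖ ≤
      (17 * (η * (lamMax hS.isHermitian / lamMin hS.isHermitian)) + 4 * χ) * ‖ρ‖ := by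
  have hl := lamMin_pos hS hd
  have hlL := lamMin_le_lamMax hS.isHermitian hd
  have hgram := hB.gram
  have hlow := lamMin_mul_le_inner_covOp hS.isHermitian
  have hupp := inner_covOp_le_lamMax_mul hS.isHermitian
  set L := lamMax hS.isHermitian with hLdef
  set l := lamMin hS.isHermitian with hldef
  set κ := L / l with hκdef
  have hLκ : L = κ * l := by rw [hκdef]; field_simp
  have hκ : 1 ≤ κ := by rw [hκdef, le_div_iff₀ hl]; linarith
  have hd' : (1 : ℝ) ≤ d := by exact_mod_cast hd
  have hq' : (1 : ℝ) ≤ q := by exact_mod_cast hq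
  have hL : 0 < L := by linarith
  have hm0 : (0 : ℝ) < m := by
    by_contra h
    have : (m : ℝ) * η ^ 2 ≤ 0 := mul_nonpos_of_nonpos_of_nonneg (not_lt.1 h) (sq_nonneg _)
    linarith
  have hη8 : 8 * η ≤ 1 := by nlinarith
  have hmq : (0 : ℝ) < m * q := by positivity
  -- the deviation of the Gram operator as a quadratic form
  have hdev : ∀ x, |(inner ℝ (gramOp (allVecs B) x) x : ℝ) - m * q * inner ℝ x (covOp S x)| ≤
      4 * η * L * (m * q) * ‖x‖ ^ 2 := by
    intro x
    have e : (inner ℝ (gramOp (allVecs B) x) x : ℝ) - m * q * inner ℝ x (covOp S x) =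
        inner ℝ (gramOp (allVecs B) x - (m * q : ℝ) • covOp S x) x := by
      rw [inner_sub_left, real_inner_smul_left, real_inner_comm x (covOp S x)]
    rw [e]
    calc _ ≤ ‖gramOp (allVecs B) x - (m * q : ℝ) • covOp S x‖ * ‖x‖ := abs_real_inner_le_norm _ _
      _ ≤ 4 * (q * L * η * m) * ‖x‖ * ‖x‖ := by gcongr; exact hgram x
      _ = _ := by ring
  set τ := ∑ p, ‖allVecs B p‖ ^ 2 with hτdef
  have hlower : ∀ x, m * q * l / 2 * ‖x‖ ^ 2 ≤ (inner ℝ (gramOp (allVecs B) x) x : ℝ) := by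
    intro x
    have h1 := (abs_le.1 (hdev x)).1
    have h2 : m * q * (l * ‖x‖ ^ 2) ≤ m * q * (inner ℝ x (covOp S x) : ℝ) := by
      gcongr; exact hlow x
    have h3 : 4 * η * L * (m * q) * ‖x‖ ^ 2 ≤ l / 2 * (m * q) * ‖x‖ ^ 2 := by
      gcongr
      rw [hLκ]; nlinarith
    linarith
  -- the step length is not too small
  have hτup : τ ≤ 2 * d * (m * q * L) := by
    rw [hτdef, sum_norm_sq_eq_trace]
    calc _ ≤ ∑ _j : Fin d, 2 * (m * q * L) := by
          refine Finset.sum_le_sum fun j _ => ?_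
          have h1 := (abs_le.1 (hdev (EuclideanSpace.single j 1))).2
          have h2 : m * q * (inner ℝ (EuclideanSpace.single j (1 : ℝ))
              (covOp S (EuclideanSpace.single j 1)) : ℝ) ≤
              m * q * (L * ‖EuclideanSpace.single j (1 : ℝ)‖ ^ 2) := by
            gcongr; exact hupp _
          rw [PiLp.norm_single] at h1 h2
          have h3 : 4 * η * L * (m * q) ≤ 1 * L * (m * q) := by gcongr; linarith
          simp only [norm_one, one_pow, mul_one] at h1 h2
          linarith
      _ = _ := by rw [Finset.sum_const, Finset.card_univ, Fintype.card_fin, nsmul_eq_mul]; ring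
  have hτ : 0 < τ := by
    have h1 := hlower (EuclideanSpace.single ⟨0, hd⟩ 1)
    have h2 := norm_gramOp_sq_le (allVecs B) (EuclideanSpace.single ⟨0, hd⟩ 1)
    rw [PiLp.norm_single] at h1
    simp only [norm_one, one_pow, mul_one] at h1
    by_contra h
    have hτ0 : τ = 0 := le_antisymm (not_lt.1 h) (Finset.sum_nonneg fun _ _ => sq_nonneg _)
    rw [← hτdef, hτ0, zero_mul] at h2
    have h3 : gramOp (allVecs B) (EuclideanSpace.single ⟨0, hd⟩ 1) = 0 := by
      rw [← norm_eq_zero]; exact pow_eq_zero_iff two_ne_zero |>.1 (le_antisymm h2 (sq_nonneg _))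
    rw [h3, inner_zero_left] at h1
    have : 0 < m * q * l / 2 := by positivity
    linarith
  have hmain := norm_richardson_sub_le (gramOp (allVecs B)) hτ
    (l := m * q * l / 2) (by positivity) (norm_gramOp_sq_le _) hlower v ρ m
  -- `m` steps reduce the initial error to a fraction `η`, because the exponent is at least
  -- `m / (8 d κ) ≥ 1 / η`
  have hexp : Real.exp (-(m * (m * q * l / 2 / (2 * τ)))) ≤ η := by
    set y := (m : ℝ) * (m * q * l / 2 / (2 * τ)) with hy
    have hy1 : 1 / η ≤ y := by
      have h1 : m / (8 * d * κ) ≤ y := by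
        have e : y = m * (m * q * l) / (2 * (2 * τ)) := by rw [hy]; field_simp
        rw [e, div_le_div_iff₀ (by positivity) (by positivity)]
        calc (m : ℝ) * (2 * (2 * τ)) ≤ m * (2 * (2 * (2 * d * (m * q * L)))) := by gcongr
          _ = m * (m * q * l) * (8 * d * κ) := by rw [hLκ]; ring
      refine le_trans ?_ h1
      rw [div_le_div_iff₀ hη (by positivity)]
      calc 1 * (8 * d * κ) = d * (8 * κ) := by ring
        _ ≤ m * η ^ 2 * (8 * κ) := by gcongr
        _ = m * η * (8 * (η * κ)) := by ring
        _ ≤ m * η * 1 := by gcongr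
        _ = _ := by ring
    have hy0 : 0 < y := lt_of_lt_of_le (by positivity) hy1
    rw [Real.exp_neg]
    refine inv_le_of_inv_le₀ hη ?_
    rw [← one_div]
    linarith [Real.add_one_le_exp y]
  have hres : 2 * ‖v - gramOp (allVecs B) ρ‖ / (m * q * l / 2) ≤ (4 * χ + 16 * (η * κ)) * ‖ρ‖ := by
    rw [div_le_iff₀ (by positivity)]
    have h1 : ‖v - gramOp (allVecs B) ρ‖ ≤ χ * (m * q * l * ‖ρ‖) + 4 * (q * L * η * m) * ‖ρ‖ := by
      calc _ = ‖(v - (m * q : ℝ) • covOp S ρ) - (gramOp (allVecs B) ρ - (m * q : ℝ) • covOp S ρ)‖ := by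
            congr 1; abel
        _ ≤ _ := (norm_sub_le _ _).trans (add_le_add hv (hgram ρ))
    rw [hLκ] at h1
    linarith
  calc _ ≤ _ := hmain
    _ ≤ η * ‖ρ‖ + (4 * χ + 16 * (η * κ)) * ‖ρ‖ := by gcongr
    _ ≤ η * κ * ‖ρ‖ + (4 * χ + 16 * (η * κ)) * ‖ρ‖ := by
        gcongr
        nlinarith
    _ = _ := by ring

theorem quad_le_norm_covOp (hr : ‖r‖ = 1) : quad S r ≤ ‖covOp S r‖ := by
  have h := real_inner_le_norm r (covOp S r)
  rwa [hr, one_mul] at h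

theorem one_le_abs_two_mul_sub (hkq : 2 * k ≠ q) : 1 ≤ |(2 * k - q : ℝ)| := by
  have h : (1 : ℝ) ≤ ((|2 * (k : ℤ) - q| : ℤ) : ℝ) := by
    exact_mod_cast Int.one_le_abs (show 2 * (k : ℤ) - q ≠ 0 by omega)
  simpa using h

/-- Unbalanced bags: `(2 k - q)` times the sum of all vectors is nearly a positive multiple of
`Σ r`. -/
theorem Typical.close_unbalanced {hS : S.PosDef} {η : ℝ} {B : Fin m → Fin q → Vec d}
    (hB : Typical hS r k η B) (hr : ‖r‖ = 1) (hq : 0 < q) (hkq : 2 * k ≠ q) (hη : 0 < η)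
    (hηκ : 8 * (η * (lamMax hS.isHermitian / lamMin hS.isHermitian)) ≤ 1) (hm : d ≤ m * η ^ 2)
    {v : Vec d} (hv : v = (2 * k - q : ℝ) • ∑ i, bagSum B i) :
    ∃ c : ℝ, 0 < c ∧ ‖solution B v - c • r‖ ≤
      (17 + 8 / absMean) * η * q * (lamMax hS.isHermitian / lamMin hS.isHermitian) ^ 2 *
        ‖c • r‖ := by
  have hd := dim_pos hr
  have hr0 : r ≠ 0 := by rintro rfl; simp at hr
  have hl := lamMin_pos hS hd
  have hlL := lamMin_le_lamMax hS.isHermitian hd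
  have hc1 := absMean_pos
  have hσ := quad_pos hS hr0
  have hσL := quad_le_lamMax_mul hS r
  rw [hr, one_pow, mul_one] at hσL
  have hmean := hB.mean
  set L := lamMax hS.isHermitian with hLdef
  set l := lamMin hS.isHermitian with hldef
  set κ := L / l with hκdef
  have hLκ : L = κ * l := by rw [hκdef]; field_simp
  have hκ : 1 ≤ κ := by rw [hκdef, le_div_iff₀ hl]; linarith
  have hq' : (1 : ℝ) ≤ q := by exact_mod_cast hq
  have hL : 0 < L := by linarith
  set δ : ℝ := 2 * k - q with hδ
  have hδ1 : 1 ≤ |δ| := one_le_abs_two_mul_sub hkq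
  have hs : 0 < Real.sqrt (quad S r) := Real.sqrt_pos.2 hσ
  have hsL : Real.sqrt (quad S r) ≤ Real.sqrt L := Real.sqrt_le_sqrt hσL
  -- `m q S (c r)` is the expectation of `v`
  set c : ℝ := δ ^ 2 * absMean / (q * Real.sqrt (quad S r)) with hc
  have hδ2 : 0 < δ ^ 2 := by rw [← sq_abs]; positivity
  have hc0 : 0 < c := by positivity
  refine ⟨c, hc0, ?_⟩
  have hnorm : ‖c • r‖ = c := by rw [norm_smul, hr, mul_one, Real.norm_of_nonneg hc0.le]
  have hχ : ‖v - (m * q : ℝ) • covOp S (c • r)‖ ≤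
      2 * η * q * κ / absMean * (m * q * l * ‖c • r‖) := by
    have e : v - (m * q : ℝ) • covOp S (c • r) =
        δ • (∑ i, bagSum B i - (m * (δ * absMean) : ℝ) • meanDir S r) := by
      rw [hv, smul_sub, map_smul, meanDir, smul_smul, smul_smul, smul_smul]
      congr 2
      rw [hc]; field_simp
    rw [e, norm_smul, Real.norm_eq_abs, hnorm]
    calc |δ| * _ ≤ |δ| * (2 * (q * Real.sqrt L * η * m)) := by gcongr
      _ ≤ |δ| ^ 2 * (2 * (q * Real.sqrt L * η * m)) := by
          gcongr
          exact le_self_pow₀ hδ1 two_ne_zero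
      _ = |δ| ^ 2 * (2 * (q * L * η * m)) / Real.sqrt L := by
          conv_rhs => rw [← Real.mul_self_sqrt hL.le]
          have := (Real.sqrt_pos.2 hL).ne'
          field_simp
          rw [Real.sqrt_sq (Real.sqrt_nonneg _), mul_comm]
      _ ≤ |δ| ^ 2 * (2 * (q * L * η * m)) / Real.sqrt (quad S r) := by gcongr
      _ = _ := by rw [hc, hLκ, sq_abs]; field_simp
  refine (hB.norm_solution_sub_le hd hq hη hηκ hm hχ).trans ?_
  gcongr
  rw [← hLdef, ← hldef, ← hκdef]
  have h1 : η * κ ≤ η * q * κ ^ 2 := by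
    calc η * κ = η * 1 * (κ * 1) := by ring
      _ ≤ η * q * (κ * κ) := by gcongr
      _ = _ := by ring
  have h2 : 8 / absMean * (η * q * κ) ≤ 8 / absMean * (η * q * κ ^ 2) := by
    gcongr
    exact le_self_pow₀ hκ two_ne_zero
  calc 17 * (η * κ) + 4 * (2 * η * q * κ / absMean) = 17 * (η * κ) + 8 / absMean * (η * q * κ) := by
        ring
    _ ≤ 17 * (η * q * κ ^ 2) + 8 / absMean * (η * q * κ ^ 2) := by gcongr
    _ = _ := by ring

/-- Balanced bags: the operator of the power iteration is nearly a multiple of the projection on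
`Σ r`, so its power vector is nearly a multiple of `Σ r`, of unknown sign. -/
theorem Typical.close_balanced {hS : S.PosDef} {η : ℝ} {B : Fin m → Fin q → Vec d}
    (hB : Typical hS r k η B) (hr : ‖r‖ = 1) (hq : 0 < q) (hkq : 2 * k = q) (hη : 0 < η)
    (hηκ : 8 * (η * (lamMax hS.isHermitian / lamMin hS.isHermitian)) ≤ 1)
    (hηκ' : 80 * (η * q * (lamMax hS.isHermitian / lamMin hS.isHermitian)) ≤ absMean ^ 2)
    (hm : d ≤ m * η ^ 2) {v : Vec d} (hv : IsPowerVec (diffOp B) m v) :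
    ∃ c : ℝ, c ≠ 0 ∧ ‖solution B v - c • r‖ ≤
      (21 + 128 / absMean ^ 2) * η * q * (lamMax hS.isHermitian / lamMin hS.isHermitian) ^ 2 *
        ‖c • r‖ := by
  have hd := dim_pos hr
  have hr0 : r ≠ 0 := by rintro rfl; simp at hr
  have hl := lamMin_pos hS hd
  have hlL := lamMin_le_lamMax hS.isHermitian hd
  have hc1 := absMean_pos
  have hσ := quad_pos hS hr0
  have hσl := lamMin_mul_le_quad hS r
  rw [hr, one_pow, mul_one] at hσl
  have hnL := norm_covOp_le hS hd r
  rw [hr, mul_one] at hnL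
  have hnσ := quad_le_norm_covOp (S := S) hr
  have hgram := hB.gram
  have hdiff := hB.diff hkq
  set L := lamMax hS.isHermitian with hLdef
  set l := lamMin hS.isHermitian with hldef
  set κ := L / l with hκdef
  have hLκ : L = κ * l := by rw [hκdef]; field_simp
  have hκ : 1 ≤ κ := by rw [hκdef, le_div_iff₀ hl]; linarith
  have hq' : (1 : ℝ) ≤ q := by exact_mod_cast hq
  have hd' : (1 : ℝ) ≤ d := by exact_mod_cast hd
  have hL : 0 < L := by linarith
  have hη1 : η ≤ 1 := by nlinarith
  have hdm : (d : ℝ) / m ≤ η ∧ (0 : ℝ) < m ∧ (d : ℝ) ≤ m := by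
    have hm0 : (0 : ℝ) < m := by
      by_contra h
      have : (m : ℝ) * η ^ 2 ≤ 0 := mul_nonpos_of_nonpos_of_nonneg (not_lt.1 h) (sq_nonneg _)
      linarith
    have h2 : η ^ 2 ≤ η := by nlinarith
    have h3 : m * η ^ 2 ≤ m * η := by gcongr
    have h4 : m * η ≤ m * 1 := by gcongr
    refine ⟨?_, hm0, by linarith⟩
    rw [div_le_iff₀ hm0]; linarith
  obtain ⟨hdm, hm0, hdm'⟩ := hdm
  have hs : 0 < Real.sqrt (quad S r) := Real.sqrt_pos.2 hσ
  have hss : Real.sqrt (quad S r) * Real.sqrt (quad S r) = quad S r := Real.mul_self_sqrt hσ.le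
  set s := Real.sqrt (quad S r) with hsdef
  have hu : ‖meanDir S r‖ = s⁻¹ * ‖covOp S r‖ := by
    rw [meanDir, norm_smul, Real.norm_of_nonneg (by positivity)]
  have hn0 : 0 < ‖covOp S r‖ := by linarith
  set u := meanDir S r with hudef
  have hu0 : 0 < ‖u‖ := by rw [hu]; positivity
  have hus : ‖u‖ * s = ‖covOp S r‖ := by rw [hu]; field_simp
  have hul : l ≤ ‖u‖ ^ 2 := by
    have h1 : s ≤ ‖u‖ := by
      rw [hu, inv_mul_eq_div, le_div_iff₀ hs, hss]; exact hnσ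
    calc l ≤ quad S r := hσl
      _ = s ^ 2 := by rw [sq, hss]
      _ ≤ ‖u‖ ^ 2 := by gcongr
  set p : Vec d := ‖u‖⁻¹ • u with hp
  have hp1 : ‖p‖ = 1 := by
    rw [hp, norm_smul, norm_inv, norm_norm, inv_mul_cancel₀ hu0.ne']
  set γ : ℝ := m * q * absMean ^ 2 * ‖u‖ ^ 2 with hγ
  have hγ0 : 0 < γ := by positivity
  set e : ℝ := 8 * (η * q * κ) / absMean ^ 2 with he
  have he0 : 0 ≤ e := by positivity
  have he1 : e ≤ 1 / 10 := by rw [he, div_le_iff₀ (by positivity)]; linarith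
  have hsym : (diffOp B).IsSymmetric := (gramOp_isSymmetric _).sub (gramOp_isSymmetric _)
  -- `S` cancels in the difference of the two Gram operators
  have hrank : ∀ x, ‖diffOp B x - (γ * inner ℝ p x) • p‖ ≤ e * γ * ‖x‖ := by
    intro x
    have e1 : diffOp B x - (γ * inner ℝ p x) • p =
        (gramOp (allVecs B) x - (m * q : ℝ) • covOp S x) - (gramOp (bagSum B) x - (m * q : ℝ) •
          (covOp S x - (absMean ^ 2 * inner ℝ u x) • u)) := by
      have e2 : (γ * inner ℝ p x) • p = (m * q * (absMean ^ 2 * inner ℝ u x) : ℝ) • u := by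
        rw [hp, real_inner_smul_left, smul_smul]
        congr 1
        rw [hγ]; field_simp
      rw [e2, diffOp, LinearMap.sub_apply, smul_sub, smul_smul]
      abel
    rw [e1]
    calc _ ≤ 4 * (q * L * η * m) * ‖x‖ + 4 * (q ^ 2 * L * η * m) * ‖x‖ :=
          (norm_sub_le _ _).trans (add_le_add (hgram x) (hdiff x))
      _ ≤ 4 * (q ^ 2 * L * η * m) * ‖x‖ + 4 * (q ^ 2 * L * η * m) * ‖x‖ := by
          gcongr
          exact le_self_pow₀ hq' two_ne_zero
      _ = 8 * (η * q * κ) * (m * q * l) * ‖x‖ := by rw [hLκ]; ring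
      _ ≤ 8 * (η * q * κ) * (m * q * ‖u‖ ^ 2) * ‖x‖ := by gcongr
      _ = _ := by rw [he, hγ]; field_simp
  have h3m : (m : ℝ) * 2 ≤ 3 ^ m := by
    have := one_add_mul_le_pow (a := (2 : ℝ)) (by norm_num) m
    norm_num at this
    linarith
  have hsd : Real.sqrt d ≤ d := by
    rw [Real.sqrt_le_left (by positivity)]; exact le_self_pow₀ hd' two_ne_zero
  obtain ⟨a, ha, hva⟩ := IsPowerVec.exists_near hsym hp1 hγ0 he0 he1 hrank
    (m := m) (by linarith) hv
  have herr : 2 * Real.sqrt d / 3 ^ m ≤ η := by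
    calc 2 * Real.sqrt d / 3 ^ m ≤ 2 * d / (m * 2) := by gcongr
      _ = d / m := by field_simp
      _ ≤ η := hdm
  -- `m q S (c r) = a p`
  set c : ℝ := a / (‖u‖ * s * (m * q)) with hc
  have hc0 : c ≠ 0 := by positivity
  refine ⟨c, hc0, ?_⟩
  have hnorm : ‖c • r‖ = |a| / (‖u‖ * s * (m * q)) := by
    rw [norm_smul, hr, mul_one, Real.norm_eq_abs, hc, abs_div,
      abs_of_pos (show 0 < ‖u‖ * s * (m * q) by positivity)]
  have hχ : ‖v - (m * q : ℝ) • covOp S (c • r)‖ ≤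
      (4 * e + η) * κ * (m * q * l * ‖c • r‖) := by
    have e1 : (m * q : ℝ) • covOp S (c • r) = a • p := by
      have e2 : a • p = a • ‖u‖⁻¹ • s⁻¹ • covOp S r := rfl
      rw [e2, map_smul, smul_smul, smul_smul, smul_smul]
      congr 1
      rw [hc]; field_simp
    rw [e1, hnorm]
    calc _ ≤ (4 * e + 2 * Real.sqrt d / 3 ^ m) * |a| := hva
      _ ≤ (4 * e + η) * |a| := by gcongr
      _ = (4 * e + η) * (|a| * L / L) := by field_simp
      _ ≤ (4 * e + η) * (|a| * L / (‖u‖ * s)) := by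
          gcongr
          rw [hus]; exact hnL
      _ = _ := by rw [hLκ]; field_simp
  refine (hB.norm_solution_sub_le hd hq hη hηκ hm hχ).trans ?_
  gcongr
  rw [← hLdef, ← hldef, ← hκdef]
  have h1 : η * κ ≤ η * q * κ ^ 2 := by
    calc η * κ = η * 1 * (κ * 1) := by ring
      _ ≤ η * q * (κ * κ) := by gcongr
      _ = _ := by ring
  calc 17 * (η * κ) + 4 * ((4 * e + η) * κ) = 21 * (η * κ) + 128 / absMean ^ 2 * (η * q * κ ^ 2) := by
        rw [he]; ring
    _ ≤ 21 * (η * q * κ ^ 2) + 128 / absMean ^ 2 * (η * q * κ ^ 2) := by gcongr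
    _ = _ := by ring

/-- The constant that relates the accuracy of the statistics to that of the hypothesis. -/
noncomputable def accuracyConst : ℝ := 25 + 8 / absMean + 128 / absMean ^ 2

theorem accuracyConst_ge : 25 ≤ accuracyConst := by
  have := absMean_pos
  have h1 : 0 ≤ 8 / absMean := by positivity
  have h2 : 0 ≤ 128 / absMean ^ 2 := by positivity
  unfold accuracyConst
  linarith

/-- On a typical sample the algorithm succeeds. -/
theorem Typical.succeeds {hS : S.PosDef} {η ε : ℝ} {B : Fin m → Fin q → Vec d}
    (hB : Typical hS r k η B) (hr : ‖r‖ = 1) (hq : 0 < q) (hη : 0 < η) (hε : 0 < ε) (hε1 : ε ≤ 1)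
    (hηε : 3 * accuracyConst * η * q ^ 4 *
      (lamMax hS.isHermitian / lamMin hS.isHermitian) ^ 3 ≤ ε ^ 2)
    (hm : d ≤ m * η ^ 2) {v : Vec d} (hv : IsRhs k B v) :
    Succeeds (normal S) (ltf r) q k ε (solution B v) := by
  have hd := dim_pos hr
  have hr0 : r ≠ 0 := by rintro rfl; simp at hr
  have hl := lamMin_pos hS hd
  have hlL := lamMin_le_lamMax hS.isHermitian hd
  have hc1 := absMean_pos
  have hW := accuracyConst_ge
  have hq' : (1 : ℝ) ≤ q := by exact_mod_cast hq
  have hκ : 1 ≤ lamMax hS.isHermitian / lamMin hS.isHermitian := by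
    rw [le_div_iff₀ hl]; linarith
  have hcu := fun h1 h2 h3 => hB.close_unbalanced (v := v) hr hq h1 hη h2 hm h3
  have hcb := fun h1 h2 h3 h4 => hB.close_balanced (v := v) hr hq h1 hη h2 h3 hm h4
  have hie := fun r' c θ (hc : (0 : ℝ) < c) => instErr_le hS (r' := r') (θ := θ) hr0 hc rfl hε
  set κ := lamMax hS.isHermitian / lamMin hS.isHermitian with hκdef
  have hx : 3 * accuracyConst * (η * q * κ) ≤ 1 := by
    calc 3 * accuracyConst * (η * q * κ) = 3 * accuracyConst * η * (q * κ) := by ring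
      _ ≤ 3 * accuracyConst * η * (q ^ 4 * κ ^ 3) := by
          gcongr
          · exact le_self_pow₀ hq' (by norm_num)
          · exact le_self_pow₀ hκ (by norm_num)
      _ = 3 * accuracyConst * η * q ^ 4 * κ ^ 3 := by ring
      _ ≤ ε ^ 2 := hηε
      _ ≤ 1 := pow_le_one₀ hε.le hε1
  have hy : η * κ ≤ η * q * κ := by
    rw [mul_assoc]; gcongr; nlinarith
  have hηκ : 8 * (η * κ) ≤ 1 := by
    refine le_trans ?_ hx
    gcongr
    linarith
  have hηκ' : 80 * (η * q * κ) ≤ absMean ^ 2 := by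
    have h1 : 128 / absMean ^ 2 ≤ accuracyConst := by
      have : 0 ≤ 8 / absMean := by positivity
      unfold accuracyConst; linarith
    have h2 : 3 * (128 / absMean ^ 2) * (η * q * κ) ≤ 1 := by
      refine le_trans ?_ hx
      gcongr
    have h3 : 3 * (128 / absMean ^ 2) * (η * q * κ) = 384 * (η * q * κ) / absMean ^ 2 := by ring
    rw [h3, div_le_one (by positivity)] at h2
    have : 0 ≤ η * q * κ := by positivity
    linarith
  -- the final accuracy, for any constant below `accuracyConst`
  have hθ : ∀ w : ℝ, 0 ≤ w → w ≤ accuracyConst → 8 * (w * η * q * κ ^ 2) ^ 2 * κ ≤ ε ^ 3 := by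
    intro w hw0 hw
    calc 8 * (w * η * q * κ ^ 2) ^ 2 * κ ≤ 8 * (accuracyConst * η * q * κ ^ 2) ^ 2 * κ := by gcongr
      _ = 8 / 9 * (3 * accuracyConst * η) ^ 2 * (q ^ 2 * κ ^ 5) := by ring
      _ ≤ 1 * (3 * accuracyConst * η) ^ 2 * (q ^ 8 * κ ^ 6) := by
          gcongr
          · norm_num
          · norm_num
          · norm_num
      _ = (3 * accuracyConst * η * q ^ 4 * κ ^ 3) ^ 2 := by ring
      _ ≤ (ε ^ 2) ^ 2 := by gcongr
      _ = ε ^ 3 * ε := by ring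
      _ ≤ ε ^ 3 * 1 := by gcongr
      _ = ε ^ 3 := mul_one _
  refine ⟨fun hk => ?_, fun hk => ?_⟩
  · obtain ⟨c, hc, h⟩ := hcu hk hηκ (hv.1 hk)
    refine hie _ c _ hc h (hθ _ (by positivity) ?_)
    have : 0 ≤ 128 / absMean ^ 2 := by positivity
    unfold accuracyConst; linarith
  · obtain ⟨c, hc, h⟩ := hcb hk hηκ hηκ' (hv.2 hk)
    have hw : 21 + 128 / absMean ^ 2 ≤ accuracyConst := by
      have : 0 ≤ 8 / absMean := by positivity
      unfold accuracyConst; linarith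
    rcases hc.lt_or_gt with hc | hc
    · refine min_le_of_right_le (hie _ (-c) _ (neg_pos.2 hc) ?_ (hθ _ (by positivity) hw))
      rw [neg_smul, norm_neg, ← neg_sub', norm_neg]
      exact h
    · exact min_le_of_left_le (hie _ c _ hc h (hθ _ (by positivity) hw))

end Accuracy

/-! ### Dimension one -/

section DimOne

variable {q k m : ℕ} {S : Matrix (Fin 1) (Fin 1) ℝ} {r : Vec 1}

theorem eq_inner_smul (hr : ‖r‖ = 1) (x : Vec 1) : x = (inner ℝ r x : ℝ) • r := by
  have hr0 : r ≠ 0 := by rintro rfl; simp at hr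
  obtain ⟨c, rfl⟩ := (finrank_eq_one_iff_of_nonzero' r hr0).1 finrank_euclideanSpace_fin x
  rw [real_inner_smul_right, real_inner_self_eq_norm_sq, hr, one_pow, mul_one]

theorem norm_sq_eq_inner_sq (hr : ‖r‖ = 1) (x : Vec 1) : ‖x‖ ^ 2 = (inner ℝ r x : ℝ) ^ 2 := by
  conv_lhs => rw [eq_inner_smul hr x, norm_smul, hr, mul_one, Real.norm_eq_abs, sq_abs]

/-- On the line, one Richardson step already solves the system, and further steps change
nothing. If all vectors vanish, both sides are zero. -/
theorem solution_eq (hr : ‖r‖ = 1) (hm : 0 < m) (B : Fin m → Fin q → Vec 1) (v : Vec 1) :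
    solution B v = (∑ p, ‖allVecs B p‖ ^ 2)⁻¹ • v := by
  have hG : ∀ x, gramOp (allVecs B) x = (∑ p, ‖allVecs B p‖ ^ 2) • x := by
    intro x
    rw [gramOp_apply, Finset.sum_smul]
    refine Finset.sum_congr rfl fun p _ => ?_
    rw [norm_sq_eq_inner_sq hr, eq_inner_smul hr (allVecs B p), eq_inner_smul hr x]
    simp only [real_inner_smul_left, real_inner_smul_right, real_inner_self_eq_norm_sq, hr,
      smul_smul]
    congr 1
    ring
  set τ := ∑ p, ‖allVecs B p‖ ^ 2 with hτ
  have hstep : ∀ x, (x = 0 ∨ τ ≠ 0) → richardson (gramOp (allVecs B)) τ v x = τ⁻¹ • v := by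
    rintro x (rfl | h)
    · simp [richardson]
    · rw [richardson, hG, smul_sub, smul_smul, inv_mul_cancel₀ h, one_smul, add_sub_cancel]
  obtain ⟨n, rfl⟩ : ∃ n, m = n + 1 := ⟨m - 1, by omega⟩
  have h : ∀ t, (richardson (gramOp (allVecs B)) τ v)^[t + 1] 0 = τ⁻¹ • v := by
    intro t
    induction t with
    | zero => exact hstep 0 (Or.inl rfl)
    | succ t ih =>
      rw [Function.iterate_succ_apply', ih]
      refine hstep _ ?_
      rcases eq_or_ne τ 0 with h | h
      · left; rw [h, inv_zero, zero_smul]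
      · exact Or.inr h
  exact h n

theorem ltf_smul {d : ℕ} (r : Vec d) {c : ℝ} (hc : 0 < c) : ltf (c • r) = ltf r := by
  funext x
  simp only [ltf, real_inner_smul_left, pos, mul_pos_iff_of_pos_left hc]

theorem instErr_smul {d : ℕ} (D : Measure (Vec d)) (r : Vec d) {c : ℝ} (hc : 0 < c) :
    instErr D (ltf r) (ltf (c • r)) = 0 := by
  simp [instErr, ltf_smul r hc]

/-- Unbalanced bags on the line: only the sign of the mean matters. -/
theorem succeeds_unbalanced_line (hr : ‖r‖ = 1) (hm : 0 < m) (hkq : 2 * k ≠ q)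
    {B : Fin m → Fin q → Vec 1} {v : Vec 1} (hv : IsRhs k B v) {ε : ℝ} (hε : 0 < ε)
    (hpos : 0 < (2 * k - q : ℝ) * ∑ i, (inner ℝ r (bagSum B i) : ℝ)) :
    Succeeds (normal S) (ltf r) q k ε (solution B v) := by
  refine ⟨fun _ => ?_, fun h => absurd h hkq⟩
  have hin : (inner ℝ r v : ℝ) = (2 * k - q : ℝ) * ∑ i, (inner ℝ r (bagSum B i) : ℝ) := by
    rw [hv.1 hkq, real_inner_smul_right, inner_sum]
  have hτ : 0 < ∑ p, ‖allVecs B p‖ ^ 2 := by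
    refine lt_of_le_of_ne (Finset.sum_nonneg fun _ _ => sq_nonneg _) fun h => ?_
    rw [eq_comm, Finset.sum_eq_zero_iff_of_nonneg fun _ _ => sq_nonneg _] at h
    have hB : ∀ i j, B i j = 0 := fun i j => by
      simpa [allVecs] using h (i, j) (Finset.mem_univ _)
    simp [bagSum, hB] at hpos
  rw [solution_eq hr hm, eq_inner_smul hr v, hin, smul_smul,
    instErr_smul _ _ (mul_pos (inv_pos.2 hτ) hpos)]
  exact hε.le

/-- Balanced bags on the line: any nonzero vector will do. -/
theorem succeeds_balanced_line (hr : ‖r‖ = 1) (hm : 0 < m) (hkq : 2 * k = q)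
    {B : Fin m → Fin q → Vec 1} {v : Vec 1} (hv : IsRhs k B v) {ε : ℝ} (hε : 0 < ε)
    (hB : 0 < ∑ p, ‖allVecs B p‖ ^ 2) :
    Succeeds (normal S) (ltf r) q k ε (solution B v) := by
  refine ⟨fun h => absurd hkq h, fun _ => ?_⟩
  have hv0 : v ≠ 0 := by
    rcases (hv.2 hkq).2 with h | h
    · exact h.1
    · rintro rfl
      simpa using h.2 0
  have hin : (inner ℝ r v : ℝ) ≠ 0 := fun h => hv0 (by rw [eq_inner_smul hr v, h, zero_smul])
  rw [solution_eq hr hm, eq_inner_smul hr v, smul_smul]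
  rcases hin.lt_or_gt with h | h
  · refine min_le_of_right_le ?_
    rw [← neg_smul, ← mul_neg, instErr_smul _ _ (mul_pos (inv_pos.2 hB) (neg_pos.2 h))]
    exact hε.le
  · refine min_le_of_left_le ?_
    rw [instErr_smul _ _ (mul_pos (inv_pos.2 hB) h)]
    exact hε.le

theorem lamMax_eq_lamMin (hS : S.IsHermitian) : lamMax hS = lamMin hS := by
  rw [lamMax, lamMin, ciSup_unique, ciInf_unique]

end DimOne

/-! ### The failure probability -/

section Failure

variable {d q k m : ℕ} {S : Matrix (Fin d) (Fin d) ℝ} {r : Vec d}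

/-- Each single vector of the sample avoids the separating hyperplane almost surely. -/
theorem sampleLaw_inner_eq_zero (hS : S.PosDef) (hr : r ≠ 0) (i : Fin m) (j : Fin q) :
    sampleLaw (ltf r) (normal S) q k m {B | (inner ℝ r (B i j) : ℝ) = 0} = 0 := by
  have := fun a => isProbabilityMeasure_condLabel hS hr a
  have := isProbabilityMeasure_bagOracle (q := q) (k := k) hS hr
  have h1 := measurePreserving_eval (fun _ : Fin m => bagOracle (ltf r) (normal S) q k) i
  have h2 := measurePreserving_eval
    (fun j : Fin q => condLabel (normal S) (ltf r) (bagLabel k j)) j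
  have hms : MeasurableSet {x : Vec d | (inner ℝ r x : ℝ) = 0} :=
    measurableSet_eq_fun (by fun_prop) (by fun_prop)
  have h3 := (h2.comp h1).measure_preimage hms.nullMeasurableSet
  rw [condLabel_ac _ _ _ (normal_inner_eq_zero hS hr)] at h3
  exact h3

theorem succeeds_of_one_le {ε : ℝ} (hε : 1 ≤ ε) (r' : Vec d) :
    Succeeds (normal S) (ltf r) q k ε r' :=
  ⟨fun _ => measureReal_le_one.trans hε, fun _ => (min_le_left _ _).trans
    (measureReal_le_one.trans hε)⟩

/-- The samples on which the algorithm fails for some order of listing the bags. -/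
def failSet (r : Vec d) (S : Matrix (Fin d) (Fin d) ℝ) (q k m : ℕ) (ε : ℝ) :
    Set (Fin m → Fin q → Vec d) :=
  {B | ¬ ∀ σ : Fin m → Equiv.Perm (Fin q),
    Succeeds (normal S) (ltf r) q k ε (output learner k (relist σ B))}

/-- Success for every admissible right-hand side, in every order of listing, is success. -/
theorem notMem_failSet {ε : ℝ} {B : Fin m → Fin q → Vec d}
    (h : ∀ σ v, IsRhs k (relist σ B) v →
      Succeeds (normal S) (ltf r) q k ε (solution (relist σ B) v)) : B ∉ failSet r S q k m ε := by
  intro hB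
  refine hB fun σ => ?_
  obtain ⟨v, hv, ho⟩ := exists_rhs_output (k := k) (relist σ B)
  rw [ho]
  exact h σ v hv

/-- A sufficient constant in the sample size, in terms of the rate `a` of the concentration
inequality. -/
noncomputable def sampleConst (a : ℝ) : ℝ :=
  2 + 18 * accuracyConst ^ 2 + 81 * accuracyConst ^ 2 / a + 1 / (a * min 1 absMean ^ 2)

theorem sampleConst_ge {a : ℝ} (ha : 0 < a) :
    2 ≤ sampleConst a ∧ 18 * accuracyConst ^ 2 ≤ sampleConst a ∧
      81 * accuracyConst ^ 2 / a ≤ sampleConst a ∧ 1 / (a * min 1 absMean ^ 2) ≤ sampleConst a := by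
  have h1 : 0 ≤ 18 * accuracyConst ^ 2 := by positivity
  have h2 : 0 ≤ 81 * accuracyConst ^ 2 / a := by positivity
  have h3 : 0 ≤ 1 / (a * min 1 absMean ^ 2) := by positivity
  unfold sampleConst
  refine ⟨?_, ?_, ?_, ?_⟩ <;> linarith

/-- The number of bags that guarantees error `ε` with probability `1 - δ`, up to a constant. -/
noncomputable def sampleSize (hS : S.PosDef) (q : ℕ) (ε δ : ℝ) : ℝ :=
  (d / ε ^ 4) * Real.log (d / δ) * (lamMax hS.isHermitian / lamMin hS.isHermitian) ^ 6 * (q : ℝ) ^ 8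

theorem one_le_conditionNumber (hS : S.PosDef) (hd : 0 < d) :
    1 ≤ lamMax hS.isHermitian / lamMin hS.isHermitian := by
  rw [le_div_iff₀ (lamMin_pos hS hd), one_mul]
  exact lamMin_le_lamMax _ hd

theorem log_two_ge : (1 : ℝ) / 2 ≤ Real.log 2 := by linarith [Real.log_two_gt_d9]

/-- From dimension two on, the factor `d` in the sample size absorbs the factor `25 ^ d` that the
net costs. -/
theorem sampleLaw_failSet_le_of_two_le {a : ℝ} (ha : 0 < a) (hS : S.PosDef)
    (hbound : ∀ η, 0 ≤ η → η ≤ 1 →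
      sampleLaw (ltf r) (normal S) q k m {B | ¬ Typical hS r k η B} ≤
        ENNReal.ofReal (6 * 25 ^ d * Real.exp (-(a * (m * η ^ 2)))))
    (hd : 2 ≤ d) (hq : 0 < q) (hr : ‖r‖ = 1) {ε δ : ℝ} (hε : 0 < ε) (hε1 : ε ≤ 1)
    (hδ : 0 < δ) (hδ1 : δ ≤ 1) (hm : sampleConst a * sampleSize hS q ε δ ≤ m) :
    sampleLaw (ltf r) (normal S) q k m (failSet r S q k m ε) ≤ ENNReal.ofReal δ := by
  obtain ⟨-, hC1, hC2, -⟩ := sampleConst_ge ha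
  have hC0 : 0 ≤ sampleConst a := le_trans (by positivity) hC1
  have hW := accuracyConst_ge
  have hκ := one_le_conditionNumber hS (by omega)
  have hq' : (1 : ℝ) ≤ q := by exact_mod_cast hq
  have hd' : (2 : ℝ) ≤ d := by exact_mod_cast hd
  have hsucc := fun η (B : Fin m → Fin q → Vec d) (hB : Typical hS r k η B) hη =>
    fun h1 h2 σ v hv => (hB.relist σ).succeeds (ε := ε) (v := v) hr hq hη hε hε1 h1 h2 hv
  rw [sampleSize] at hm
  set κ := lamMax hS.isHermitian / lamMin hS.isHermitian with hκdef
  -- the coarsest accuracy of the statistics that suffices for the error `ε`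
  set η := ε ^ 2 / (3 * accuracyConst * q ^ 4 * κ ^ 3) with hη
  have hη0 : 0 < η := by positivity
  have hη1 : η ≤ 1 := by
    rw [hη, div_le_one (by positivity)]
    have h1 : (1 : ℝ) ≤ q ^ 4 := one_le_pow₀ hq'
    have h2 : 1 ≤ κ ^ 3 := one_le_pow₀ hκ
    calc ε ^ 2 ≤ 1 := pow_le_one₀ hε.le hε1
      _ ≤ 75 * 1 * 1 := by norm_num
      _ ≤ 3 * accuracyConst * q ^ 4 * κ ^ 3 := by gcongr; linarith
  set T := Real.log (d / δ) with hT
  have hTlog : Real.log 2 ≤ T := by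
    refine Real.log_le_log two_pos ?_
    rw [le_div_iff₀ hδ]; nlinarith
  have hT2 := log_two_ge
  have hT0 : 0 < T := by linarith
  have hexpT : Real.exp (-T) = δ / d := by
    rw [hT, ← Real.log_inv, inv_div, Real.exp_log (by positivity)]
  have hmη : sampleConst a * (d * T) / (9 * accuracyConst ^ 2) ≤ m * η ^ 2 := by
    calc _ = sampleConst a * (d / ε ^ 4 * T * κ ^ 6 * q ^ 8) * η ^ 2 := by
          rw [hη]; field_simp; norm_num
      _ ≤ _ := by gcongr
  have hmd : (d : ℝ) ≤ m * η ^ 2 := by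
    refine le_trans ?_ hmη
    calc (d : ℝ) = 2 * (d * (1 / 2)) := by ring
      _ ≤ 2 * (d * T) := by gcongr; linarith
      _ = 18 * accuracyConst ^ 2 * (d * T) / (9 * accuracyConst ^ 2) := by field_simp; norm_num
      _ ≤ _ := by gcongr
  have hma : 9 * (d * T) ≤ a * (m * η ^ 2) := by
    calc 9 * (d * T) = a * (81 * accuracyConst ^ 2 / a * (d * T) / (9 * accuracyConst ^ 2)) := by
          field_simp; norm_num
      _ ≤ a * (sampleConst a * (d * T) / (9 * accuracyConst ^ 2)) := by gcongr
      _ ≤ _ := by gcongr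
  have hsub : failSet r S q k m ε ⊆ {B | ¬ Typical hS r k η B} := by
    intro B hB hty
    refine notMem_failSet (hsucc η B hty hη0 ?_ hmd) hB
    rw [hη]
    refine le_of_eq ?_
    field_simp
  refine (measure_mono hsub).trans ((hbound η hη0.le hη1).trans (ENNReal.ofReal_le_ofReal ?_))
  have hx2 : Real.exp (-T) ≤ 1 / 2 := by
    rw [hexpT, div_le_div_iff₀ (by linarith) two_pos]; nlinarith
  calc 6 * 25 ^ d * Real.exp (-(a * (m * η ^ 2))) ≤ 6 * 25 ^ d * Real.exp (-(9 * (d * T))) := by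
        gcongr
    _ = 6 * 25 ^ d * Real.exp (-T) ^ (9 * d) := by
        rw [← Real.exp_nat_mul]; congr 2; push_cast; ring
    _ ≤ 6 * 25 ^ d * Real.exp (-T) ^ (8 * d + 1) := by
        gcongr ?_ * ?_
        exact pow_le_pow_of_le_one (Real.exp_pos _).le (by linarith) (by omega)
    _ = 6 * (25 * Real.exp (-T) ^ 8) ^ d * Real.exp (-T) := by
        rw [pow_succ, pow_mul, mul_pow]; ring
    _ ≤ 6 * (25 * (1 / 2) ^ 8) ^ d * (δ / d) := by rw [← hexpT]; gcongr
    _ ≤ 6 * (25 * (1 / 2) ^ 8) ^ 1 * (δ / 1) := by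
        have h1 : (25 * (1 / 2) ^ 8 : ℝ) ^ d ≤ (25 * (1 / 2) ^ 8) ^ 1 :=
          pow_le_pow_of_le_one (by norm_num) (by norm_num) (by omega)
        have h2 : δ / d ≤ δ / 1 := div_le_div_of_nonneg_left hδ.le one_pos (by linarith)
        gcongr
    _ ≤ δ := by norm_num; linarith

/-- In dimension one the factor `log (d / δ)` can be near zero, so that no constant in front of
the exponential can be afforded: unbalanced bags need the one-sided bound, and balanced bags almost
never fail. -/
theorem sampleLaw_failSet_le_of_dim_one {a : ℝ} (ha : 0 < a) {S : Matrix (Fin 1) (Fin 1) ℝ}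
    {r : Vec 1} (hS : S.PosDef)
    (hbound : ∀ η, 0 ≤ η → η ≤ 1 → ∀ n : Vec 1, ‖n‖ ≤ 1 → sampleLaw (ltf r) (normal S) q k m
        {B | m * ((2 * k - q) * (absMean * inner ℝ n (meanDir S r)) +
          q * Real.sqrt (lamMax hS.isHermitian) * η) ≤ ∑ i, (inner ℝ n (∑ j, B i j) : ℝ)} ≤
        ENNReal.ofReal (Real.exp (-(a * (m * η ^ 2)))))
    (hq : 0 < q) (hr : ‖r‖ = 1) {ε δ : ℝ} (hε : 0 < ε) (hε1 : ε ≤ 1)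
    (hδ : 0 < δ) (hδ1 : δ < 1) (hm : sampleConst a * sampleSize hS q ε δ ≤ m) :
    sampleLaw (ltf r) (normal S) q k m (failSet r S q k m ε) ≤ ENNReal.ofReal δ := by
  obtain ⟨hC2, -, -, hC1⟩ := sampleConst_ge ha
  have hr0 : r ≠ 0 := by rintro rfl; simp at hr
  have hκ := one_le_conditionNumber hS one_pos
  have hq' : (1 : ℝ) ≤ q := by exact_mod_cast hq
  have hc1 := absMean_pos
  rw [sampleSize] at hm
  set κ := lamMax hS.isHermitian / lamMin hS.isHermitian with hκdef
  set T := Real.log ((1 : ℕ) / δ) with hT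
  have hT0 : 0 < T := Real.log_pos (by rw [lt_div_iff₀ hδ]; simpa using hδ1)
  have hexpT : Real.exp (-T) = δ := by
    rw [hT, ← Real.log_inv, inv_div, Nat.cast_one, div_one, Real.exp_log hδ]
  have hmT : sampleConst a * (T * q ^ 2) ≤ m := by
    refine le_trans ?_ hm
    have h1 : 1 / ε ^ 4 ≥ 1 := by
      rw [ge_iff_le, le_div_iff₀ (by positivity), one_mul]; exact pow_le_one₀ hε.le hε1
    have h2 : 1 ≤ κ ^ 6 := one_le_pow₀ hκ
    have h3 : (q : ℝ) ^ 2 ≤ q ^ 8 := pow_le_pow_right₀ hq' (by norm_num)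
    gcongr
    calc T = 1 * T * 1 := by ring
      _ ≤ ((1 : ℕ) : ℝ) / ε ^ 4 * T * κ ^ 6 := by rw [Nat.cast_one]; gcongr
  have hm0 : 0 < m := by
    have : 0 < sampleConst a * (T * q ^ 2) := by positivity
    exact_mod_cast this.trans_le hmT
  by_cases hkq : 2 * k = q
  · -- failure forces the first vector of the first bag to vanish
    have hsub : failSet r S q k m ε ⊆ {B | (inner ℝ r (B ⟨0, hm0⟩ ⟨0, hq⟩) : ℝ) = 0} := by
      intro B hB
      by_contra hne
      refine notMem_failSet (fun σ v hv => succeeds_balanced_line hr hm0 hkq hv hε ?_) hB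
      rw [sum_allVecs_relist σ B fun x => ‖x‖ ^ 2]
      refine Finset.sum_pos' (fun _ _ => sq_nonneg _) ⟨(⟨0, hm0⟩, ⟨0, hq⟩), Finset.mem_univ _, ?_⟩
      rw [norm_sq_eq_inner_sq hr]
      exact lt_of_le_of_ne (sq_nonneg _) (pow_ne_zero 2 hne).symm
    refine (measure_mono hsub).trans ?_
    rw [sampleLaw_inner_eq_zero hS hr0]
    exact bot_le
  · set δk : ℝ := 2 * k - q with hδk
    have hδk1 : 1 ≤ |δk| := one_le_abs_two_mul_sub hkq
    have hδk0 : δk ≠ 0 := abs_pos.1 (by linarith)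
    -- failure means that the mean of the bag sums has the wrong sign: it is nonnegative in the
    -- direction `n`, where its expectation is negative
    set n : Vec 1 := (-(δk / |δk|)) • r with hn
    set b := min 1 absMean with hb
    have hb0 : 0 < b := lt_min one_pos hc1
    have hn1 : ‖n‖ ≤ 1 := by
      rw [hn, norm_smul, hr, mul_one, norm_neg, norm_div, Real.norm_eq_abs, Real.norm_eq_abs,
        abs_abs, div_self (abs_ne_zero.2 hδk0)]
    have hη1 : b / q ≤ 1 := by
      rw [div_le_one (by linarith)]
      exact (min_le_left _ _).trans hq'
    have hsub : failSet r S q k m ε ⊆ {B | m * (δk * (absMean * inner ℝ n (meanDir S r)) +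
        q * Real.sqrt (lamMax hS.isHermitian) * (b / q)) ≤ ∑ i, (inner ℝ n (∑ j, B i j) : ℝ)} := by
      intro B hB
      rw [Set.mem_ofPred_eq]
      have h1 : ∑ i, (inner ℝ n (∑ j, B i j) : ℝ) =
          -(|δk|⁻¹ * (δk * ∑ i, (inner ℝ r (bagSum B i) : ℝ))) := by
        simp only [hn, real_inner_smul_left, ← Finset.mul_sum]
        rw [div_eq_inv_mul]
        simp only [bagSum]
        ring
      have h2 : δk * ∑ i, (inner ℝ r (bagSum B i) : ℝ) ≤ 0 := by
        by_contra hpos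
        refine notMem_failSet (fun σ v hv =>
          succeeds_unbalanced_line hr hm0 hkq hv hε ?_) hB
        rw [bagSum_relist]
        exact not_le.1 hpos
      have h3 : (inner ℝ r (meanDir S r) : ℝ) = Real.sqrt (quad S r) := by
        rw [meanDir, real_inner_smul_right, ← quad, inv_mul_eq_div, Real.div_sqrt]
      have h4 : Real.sqrt (lamMax hS.isHermitian) ≤ Real.sqrt (quad S r) := by
        refine Real.sqrt_le_sqrt ?_
        have := lamMin_mul_le_quad hS r
        rw [hr, one_pow, mul_one] at this
        rwa [lamMax_eq_lamMin]
      have h5 : δk * (absMean * inner ℝ n (meanDir S r)) =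
          -(|δk| * (absMean * Real.sqrt (quad S r))) := by
        rw [hn, real_inner_smul_left, h3]
        have : δk * δk = |δk| * |δk| := (abs_mul_abs_self _).symm
        have h0 : |δk| ≠ 0 := abs_ne_zero.2 hδk0
        field_simp
        rw [sq, sq, this]
      have h6 : q * Real.sqrt (lamMax hS.isHermitian) * (b / q) ≤
          |δk| * (absMean * Real.sqrt (quad S r)) := by
        calc _ = 1 * (b * Real.sqrt (lamMax hS.isHermitian)) := by field_simp
          _ ≤ _ := by
            gcongr
            exact min_le_right _ _
      have h7 : (0 : ℝ) ≤ |δk|⁻¹ := by positivity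
      refine (mul_nonpos_of_nonneg_of_nonpos (Nat.cast_nonneg m) (by rw [h5]; linarith)).trans ?_
      rw [h1, Left.nonneg_neg_iff]
      exact mul_nonpos_of_nonneg_of_nonpos h7 h2
    refine (measure_mono hsub).trans ((hbound _ (by positivity) hη1 n hn1).trans
      (ENNReal.ofReal_le_ofReal ?_))
    rw [← hexpT]
    gcongr
    calc T = a * (1 / (a * b ^ 2) * (T * q ^ 2) * (b / q) ^ 2) := by field_simp
      _ ≤ a * (sampleConst a * (T * q ^ 2) * (b / q) ^ 2) := by gcongr
      _ ≤ _ := by gcongr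

/-- Up to degenerate parameters the number of bags is at least `d` and `q`, so that a running time
polynomial in all three is polynomial in `m`. -/
theorem le_of_sampleSize_le {a : ℝ} (ha : 0 < a) (hS : S.PosDef) (hd : 0 < d) (hq : 0 < q)
    {ε δ : ℝ} (hε : 0 < ε) (hε1 : ε ≤ 1) (hδ : 0 < δ) (hδd : δ ≤ d / 2)
    (hm : sampleConst a * sampleSize hS q ε δ ≤ m) : d ≤ m ∧ q ≤ m := by
  obtain ⟨hC2, -⟩ := sampleConst_ge ha
  have hκ := one_le_conditionNumber hS hd
  have hq' : (1 : ℝ) ≤ q := by exact_mod_cast hq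
  have hd' : (1 : ℝ) ≤ d := by exact_mod_cast hd
  have h1 : (d : ℝ) * q ≤ m := by
    refine le_trans ?_ hm
    rw [sampleSize]
    have hT : 1 / 2 ≤ Real.log (d / δ) := by
      refine log_two_ge.trans (Real.log_le_log two_pos ?_)
      rw [le_div_iff₀ hδ]; linarith
    have hε4 : (d : ℝ) ≤ d / ε ^ 4 := by
      rw [le_div_iff₀ (by positivity)]
      exact mul_le_of_le_one_right (by linarith) (pow_le_one₀ hε.le hε1)
    calc (d : ℝ) * q = 2 * (d * (1 / 2) * 1 * q) := by ring
      _ ≤ _ := by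
        gcongr
        · exact one_le_pow₀ hκ
        · exact le_self_pow₀ hq' (by norm_num)
  constructor
  · have : (d : ℝ) ≤ m := by nlinarith
    exact_mod_cast this
  · have : (q : ℝ) ≤ m := by nlinarith
    exact_mod_cast this

end Failure

end LLP

theorem theorem2 :
    ∃ (P : LLP.Prog) (C : ℝ) (K : ℕ), 0 < C ∧
      -- on every input the running time is polynomial in the number of bags and their dimensions
      (∀ (d q k m : ℕ), 2 < q → 1 ≤ k → k ≤ q - 1 → ∀ B : Fin m → Fin q → LLP.Vec d,
        LLP.runTime P k B ≤ K * (max m (max d q)) ^ K) ∧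
      ∀ (d q k : ℕ), 2 < q → 1 ≤ k → k ≤ q - 1 →
      ∀ r : LLP.Vec d, ‖r‖ = 1 →
      ∀ (S : Matrix (Fin d) (Fin d) ℝ) (hS : S.PosDef),
      ∀ ε δ : ℝ, 0 < ε → 0 < δ →
      ∀ m : ℕ,
        C * ((d / ε ^ 4) * Real.log (d / δ) *
          (LLP.lamMax hS.isHermitian / LLP.lamMin hS.isHermitian) ^ 6 * (q : ℝ) ^ 8) ≤ m →
        -- the number of bags dominates `d` and `q`, so the running time is polynomial in `m`
        (ε ≤ 1 → δ ≤ d / 2 → ∀ B : Fin m → Fin q → LLP.Vec d,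
          LLP.runTime P k B ≤ K * m ^ K) ∧
        -- with probability at least `1 - δ` the output is good, however the bags are listed
        LLP.sampleLaw (LLP.ltf r) (multivariateGaussian 0 S) q k m
          {B | ¬ ∀ σ : Fin m → Equiv.Perm (Fin q),
            LLP.Succeeds (multivariateGaussian 0 S) (LLP.ltf r) q k ε
              (LLP.output P k (LLP.relist σ B))} ≤ ENNReal.ofReal δ := by
  obtain ⟨K, hK⟩ := LLP.exists_runTime_le
  obtain ⟨a, ha, hbound⟩ := LLP.exists_typical_bound
  refine ⟨LLP.learner, LLP.sampleConst a, K, by linarith [(LLP.sampleConst_ge ha).1],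
    fun d q k m hq _ _ B => hK d q k m _ (by omega) (by omega) (by omega) (by omega) B, ?_⟩
  intro d q k hq _ hk r hr S hS ε δ hε hδ m hm
  have hd := LLP.dim_pos hr
  have hr0 : r ≠ 0 := by rintro rfl; simp at hr
  refine ⟨fun hε1 hδd B => ?_, ?_⟩
  · obtain ⟨h1, h2⟩ := LLP.le_of_sampleSize_le ha hS hd (by omega) hε hε1 hδ hδd hm
    exact hK d q k m m (by omega) h1 h2 le_rfl B
  have hprob := LLP.isProbabilityMeasure_sampleLaw (q := q) (k := k) hS hr0 m
  rcases le_or_gt 1 δ with hδ1 | hδ1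
  · refine prob_le_one.trans ?_
    rw [← ENNReal.ofReal_one]
    exact ENNReal.ofReal_le_ofReal hδ1
  rcases le_or_gt 1 ε with hε1 | hε1
  · have : {B | ¬ ∀ σ : Fin m → Equiv.Perm (Fin q),
        LLP.Succeeds (multivariateGaussian 0 S) (LLP.ltf r) q k ε
          (LLP.output LLP.learner k (LLP.relist σ B))} = ∅ :=
      Set.eq_empty_of_forall_notMem fun B hB => hB fun σ => LLP.succeeds_of_one_le hε1 _
    rw [this, measure_empty]
    exact bot_le
  have hb := fun η => hbound d q k m S hS r η hd (by omega) (by omega) hr0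
  rcases (show d = 1 ∨ 2 ≤ d by omega) with rfl | hd2
  · exact LLP.sampleLaw_failSet_le_of_dim_one ha hS (fun η h0 h1 => (hb η h0 h1).2) (by omega) hr
      hε hε1.le hδ hδ1 hm
  · exact LLP.sampleLaw_failSet_le_of_two_le ha hS (fun η h0 h1 => (hb η h0 h1).1) hd2 (by omega)
      hr hε hε1.le hδ hδ1.le hm
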